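/- Let $X$ be a complex Banach space and let $\alpha\ge 0$ and $0<\sigma<1$. **Notation.** For $0<\theta\le\pi/2$ put $S_\theta=\{z\in\mathbb C\setminus\{0\}:|\arg z|<\theta\}$, and put $S_0=(0,\infty)$; thus $S_{\pi/2}=\mathbb C^+=\{z:\operatorname{Re}z>0\}$. All complex powers and $\operatorname{Log}$ are principal branches, with argument in $(-\pi,\pi]$. For a function $\varphi$ on $(0,\infty)$ the Weyl fractional derivative of order $\alpha$ is $$W^\alpha\varphi(s)=(-1)^n\frac{d^n}{ds^n}\left(\frac1{\Gamma(n-\alpha)}\int_s^\infty (t-s)^{n-\alpha-1}\varphi(t)\,dt\right),\qquad s>0,\quad n=\lfloor\alpha\rfloor+1 .$$ Here $W^\alpha$ always acts in the variable $t$. A closed, densely defined operator $A$ on $X$ is the generator of a tempered $\alpha$-times integrated cosine family $(\mathcal C_\alpha(t))_{t\ge0}\subseteq\mathcal B(X)$ if $t\mapsto\mathcal C_\alpha(t)f$ is continuous on $[0,\infty)$ for every $f\in X$, $\sup_{t>0}t^{-\alpha}\|\mathcal C_\alpha(t)\|<\infty$, and for every $\lambda$ with $\operatorname{Re}\lambda>0$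 the operator $\lambda^2-A$ is invertible with $$(\lambda^2-A)^{-1}f=\lambda^{\alpha-1}\int_0^\infty e^{-\lambda t}\,\mathcal C_\alpha(t)f\,dt,\qquad f\in X.$$ For such $A$ and $f\in\mathcal D(A)$ the Balakrishnan fractional power is $$(-A)^\sigma f=\frac{\sin(\pi\sigma)}{\pi}\int_0^\infty\lambda^{\sigma-1}(\lambda-A)^{-1}(-Af)\,d\lambda .$$ **Theorem.** Let $A$ be the generator of a tempered $\alpha$-times integrated cosine family $(\mathcal C_\alpha(t))_{t\ge0}$ on $X$. Then there are operators $u(z)\in\mathcal B(X)$, $z\in\mathbb C^+$, such that $z\mapsto u(z)$ is holomorphic on $\mathbb C^+$ and such that, for every $f\in X$, the function $z\mapsto u(z)f$ solves the extension problem: for every $z\in\mathbb C^+$ one has $u(z)f\in\mathcal D(A)$ and $$u''(z)f+\frac{1-2\sigma}{z}\,u'(z)f=-A\,u(z)f ,$$ and $\lim_{z\to0,\ z\in S_{\pi/2-\eta}}u(z)f=f$ for every $0<\eta\le\pi/2$. This solution is given, for $z\in\mathbb C^+$ and $f\in X$, by the absolutely convergent integral $$u(z)f=d_\sigma\int_0^\infty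 W^\alpha\left(\frac{z^{2\sigma}}{(z^2+t^2)^{\sigma+1/2}}\right)\mathcal C_\alpha(t)f\,dt,\qquad d_\sigma=\frac{2\,\Gamma(\sigma+1/2)}{\sqrt\pi\,\Gamma(\sigma)} .$$ If $f\in\mathcal D(A)$, then moreover, for every $z\in\mathbb C^+$ and again with absolutely convergent integrals: if $\sigma\ne1/2$, then $$u(z)f=f+\kappa_\sigma\int_0^\infty W^\alpha\left((z^2+t^2)^{\sigma-1/2}-t^{2\sigma-1}\right)\mathcal C_\alpha(t)(-A)^\sigma f\,dt,\qquad \kappa_\sigma=\frac{2\,\Gamma(1/2-\sigma)}{4^\sigma\sqrt\pi\,\Gamma(\sigma)} ;$$ and if $\sigma=1/2$, then $$u(z)f=f+\frac1\pi\int_0^\infty W^\alpha\left(\operatorname{Log}\left(\frac{t^2}{z^2+t^2}\right)\right)\mathcal C_\alpha(t)(-A)^{1/2}f\,dt .$$ -/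

import Mathlib

open Filter Topology MeasureTheory

noncomputable section

namespace ExtensionProblem

/-- The sector `S_θ`: for `θ > 0` the nonzero complex numbers `z` with `|arg z| < θ`, and
`S_0 = (0, ∞)`.  Note that `0` never belongs to a sector. -/
def sector (θ : ℝ) : Set ℂ :=
  if 0 < θ then {z : ℂ | z ≠ 0 ∧ |z.arg| < θ} else {z : ℂ | 0 < z.re ∧ z.im = 0}

/-- The sector of half-aperture `π / 2` is the open right half-plane `ℂ⁺`. -/
theorem mem_sector_pi_div_two {z : ℂ} : z ∈ sector (Real.pi / 2) ↔ 0 < z.re := by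
  have h : (0 : ℝ) < Real.pi / 2 := by positivity
  simp only [sector, if_pos h, Set.mem_ofPred_eq, Complex.abs_arg_lt_pi_div_two_iff]
  constructor
  · rintro ⟨h0, h1 | h1⟩
    · exact h1
    · exact absurd h1 h0
  · intro h1
    refine ⟨?_, Or.inl h1⟩
    rintro rfl
    simp at h1

/-- The Weyl fractional integral of order `β > 0`:
`W^{-β} φ (s) = 1 / Γ(β) * ∫_s^∞ (t - s)^(β - 1) φ(t) dt`. -/
def weylIntegral (β : ℝ) (φ : ℝ → ℂ) (s : ℝ) : ℂ :=
  ((1 / Real.Gamma β : ℝ) : ℂ) * ∫ t in Set.Ioi s, (((t - s) ^ (β - 1) : ℝ) : ℂ) * φ t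

/-- The Weyl fractional derivative of order `α ≥ 0`: with `n = ⌊α⌋ + 1` and `β = n - α ∈ (0, 1]`,
`W^α φ (s) = (-1)^n (d/ds)^n W^{-β} φ (s)`. -/
def weylDeriv (α : ℝ) (φ : ℝ → ℂ) (s : ℝ) : ℂ :=
  (-1) ^ (⌊α⌋₊ + 1) *
    iteratedDeriv (⌊α⌋₊ + 1) (weylIntegral (((⌊α⌋₊ + 1 : ℕ) : ℝ) - α) φ) s

variable {X : Type*} [NormedAddCommGroup X] [NormedSpace ℂ X]

/-- The closed, densely defined operator `A` is the generator of the tempered `α`-times integrated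
cosine family `(C t)_{t ≥ 0}` in `B(X)`.  (A cosine family is extended to negative times as an even
function; only the values `C t` with `t ≥ 0` matter.) -/
structure IsTemperedIntegratedCosine (α : ℝ) (C : ℝ → X →L[ℂ] X) (A : X →ₗ.[ℂ] X) : Prop where
  /-- `C` is strongly continuous on `[0, ∞)`. -/
  strongly_continuous : ∀ f : X, ContinuousOn (fun t => C t f) (Set.Ici 0)
  /-- `sup_{t > 0} t^{-α} ‖C t‖ < ∞`. -/
  tempered : ∃ M : ℝ, ∀ t : ℝ, 0 < t → ‖C t‖ ≤ M * t ^ α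
  closed : A.IsClosed
  dense : Dense (A.domain : Set X)
  /-- For `Re μ > 0`, the operator `f ↦ μ^{α-1} ∫_0^∞ e^{-μ t} C(t) f dt` is a right inverse of
  `μ² - A` ... -/
  right_inverse : ∀ μ : ℂ, 0 < μ.re → ∀ f : X,
    ∃ x : A.domain,
      (x : X) = μ ^ ((α : ℂ) - 1) • ∫ t in Set.Ioi (0 : ℝ), Complex.exp (-μ * t) • C t f ∧
      μ ^ 2 • (x : X) - A x = f
  /-- ... and a left inverse: `μ² - A : D(A) → X` is injective. -/
  left_inverse : ∀ μ : ℂ, 0 < μ.re → ∀ x : A.domain, μ ^ 2 • (x : X) - A x = 0 → x = 0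

/-- The resolvent `(μ - A)⁻¹ g`, i.e. the element `x` of `D(A)` with `μ x - A x = g`
(meaningful when `μ - A : D(A) → X` is bijective). -/
def resolventApply (A : X →ₗ.[ℂ] X) (μ : ℂ) (g : X) : X :=
  ((Function.invFun (fun x : A.domain => μ • (x : X) - A x) g : A.domain) : X)

/-- The Balakrishnan fractional power on `D(A)`:
`(-A)^σ f = sin(πσ)/π * ∫_0^∞ μ^{σ-1} (μ - A)⁻¹ (-A f) dμ`. -/
def fracPow (A : X →ₗ.[ℂ] X) (σ : ℝ) (f : A.domain) : X :=
  ((Real.sin (Real.pi * σ) / Real.pi : ℝ) : ℂ) •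
    ∫ μ in Set.Ioi (0 : ℝ), ((μ ^ (σ - 1) : ℝ) : ℂ) • resolventApply A (μ : ℂ) (-(A f))

/-- `u` is a holomorphic solution, in the sector `S_φ`, of the extension problem
`u'' + ((1 - 2σ)/z) u' = -A u`, with `u(z) → f` as `z → 0` through `S_{φ-η}`, `0 < η ≤ φ`.
The equation includes the assertion that `u z ∈ D(A)`. -/
structure IsExtensionSolution (A : X →ₗ.[ℂ] X) (σ φ : ℝ) (f : X) (u : ℂ → X) : Prop where
  holomorphic : DifferentiableOn ℂ u (sector φ)
  equation : ∀ z ∈ sector φ, ∃ x : A.domain, (x : X) = u z ∧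
    deriv (deriv u) z + ((1 - 2 * (σ : ℂ)) / z) • deriv u z = -(A x)
  boundary : ∀ η : ℝ, 0 < η → η ≤ φ → Tendsto u (𝓝[sector (φ - η)] 0) (𝓝 f)

/-- `z^{2σ} / (z² + t²)^{σ + 1/2}` (principal branches). -/
def poissonKernel (σ : ℝ) (z : ℂ) (t : ℝ) : ℂ :=
  z ^ (2 * (σ : ℂ)) / (z ^ 2 + (t : ℂ) ^ 2) ^ ((σ : ℂ) + 1 / 2)

/-- `(z² + t²)^{σ - 1/2} - t^{2σ - 1}` (principal branches). -/
def differenceKernel (σ : ℝ) (z : ℂ) (t : ℝ) : ℂ :=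
  (z ^ 2 + (t : ℂ) ^ 2) ^ ((σ : ℂ) - 1 / 2) - (t : ℂ) ^ (2 * (σ : ℂ) - 1)

/-- `Log (t² / (z² + t²))` (principal branch). -/
def logKernel (z : ℂ) (t : ℝ) : ℂ :=
  Complex.log ((t : ℂ) ^ 2 / (z ^ 2 + (t : ℂ) ^ 2))

/-- `d_σ = 2 Γ(σ + 1/2) / (√π Γ(σ))`. -/
def dConst (σ : ℝ) : ℝ :=
  2 * Real.Gamma (σ + 1 / 2) / (√Real.pi * Real.Gamma σ)

/-- `κ_σ = 2 Γ(1/2 - σ) / (4^σ √π Γ(σ))`. -/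
def kappaConst (σ : ℝ) : ℝ :=
  2 * Real.Gamma (1 / 2 - σ) / ((4 : ℝ) ^ σ * √Real.pi * Real.Gamma σ)

end ExtensionProblem

end

noncomputable section

namespace ExtensionProblem

/-! The problem is reduced to a bounded heat semigroup, for which the solution is the classical
subordination integral. Put `n = ⌊α⌋ + 1` and `β = n - α`. The Weyl derivative is `(-1)^n (d/dt)^n`
followed by a fractional integral of order `β`. Fubini moves that integral onto `C`, which turns `C`
into a family growing like `p^n`. Division by `p^n` leaves a bounded family `B` (`exists_average`,
`IsTemperedIntegratedCosine.exists_boundedFamily`) with `∫ W^α φ(t) C(t) f dt = ∫ (-1)^n p^n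
φ^(n)(p) B(p) f dp`.

Every kernel in play is a function of `t²`. If `φ(t) = F(t²)`, then `t^n φ^(n)(t)` is a combination
of the terms `t^(2i) F^(i)(t²)` (`hasDerivAt_towerSum`). These scale like `F(t²)` itself, so all
estimates are homogeneous and nothing singular appears at `t = 0`.

With the kernel `(π s)^(-1/2) e^(-t²/(4s))` one obtains operators `T(s)` that are bounded, satisfy
`‖T'(s)‖ ≤ K/s`, and have the resolvent of `A` as Laplace transform (`exists_isLaplaceFamily`).
Uniqueness of the Laplace transform (`eq_zero_of_laplace_eq_zero`) then yields `T(s)x = x + ∫_0^s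
T(r)Ax dr`, commutation with the resolvent, and the semigroup law.

Let `U_a(z)` be the operator with kernel `Γ(a)(z² + t²)^(-a)` (`mainOp`). For real `z > 0` it is a
constant times `∫ s^(-a-1/2) e^(-z²/(4s)) T(s) ds` (`mainOp_eq_integral`). Integration by parts
gives `A U_a = (4a+2) U_(a+1) - 4z² U_(a+2)`, and the identity theorem extends this to complex `z`
(`exists_domain_mainOp`). Together with `U_a' = -2z U_(a+1)` it gives the equation for `u(z) = k
z^(2σ) U_(σ+1/2)(z)`, where `k` is a constant (`extensionOp_equation`).

For `f ∈ D(A)`, the subordination integral splits off `f` (`integral_subordination_eq`). The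
remainder is recognised, through a Gamma-integral convolution identity (`integral_convolution_eq`)
and the formula for the fractional power by `T` (`fracPow_eq`), as a multiple of `∫_0^1 z²
U_(3/2-σ)(√r z) (-A)^σ f dr` (`extensionOp_apply_domain`). The difference and logarithmic kernels
are exactly such integrals over `r`, by the fundamental theorem of calculus along `r ↦ r z² + t²`.
The same remainder is `O(|z|^(2σ))` in sectors. With the uniform bound `norm_extensionOp_le` and the
density of `D(A)` this gives the boundary value (`tendsto_extensionOp`). -/

/-! ### Integrals of power and exponential weights on the half-line. -/

theorem integrableOn_rpow_mul_one_add_rpow {p q : ℝ} (hp : -1 < p) (hq : p + 1 < q) :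
    IntegrableOn (fun r : ℝ => r ^ p * (1 + r) ^ (-q)) (Set.Ioi 0) := by
  have hc : ContinuousOn (fun r : ℝ => r ^ p * (1 + r) ^ (-q)) (Set.Ioi 0) := by
    intro r hr
    have hr : (0 : ℝ) < r := hr
    refine ContinuousAt.continuousWithinAt ?_
    exact (continuousAt_id.rpow_const (Or.inl hr.ne')).mul
      ((continuousAt_const.add continuousAt_id).rpow_const (Or.inl (by simp; linarith)))
  rw [← Set.Ioc_union_Ioi_eq_Ioi zero_le_one]
  refine IntegrableOn.union ?_ ?_
  · have h1 : IntegrableOn (fun r : ℝ => r ^ p) (Set.Ioc 0 1) :=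
      (intervalIntegrable_iff_integrableOn_Ioc_of_le zero_le_one).1
        (intervalIntegral.intervalIntegrable_rpow' hp)
    refine Integrable.mono' h1
      ((hc.mono Set.Ioc_subset_Ioi_self).aestronglyMeasurable measurableSet_Ioc) ?_
    filter_upwards [ae_restrict_mem measurableSet_Ioc] with r hr
    have hr0 : 0 < r := hr.1
    rw [Real.norm_of_nonneg (by positivity)]
    refine mul_le_of_le_one_right (by positivity) ?_
    exact Real.rpow_le_one_of_one_le_of_nonpos (by linarith) (by linarith)
  · have h1 : IntegrableOn (fun r : ℝ => r ^ (p - q)) (Set.Ioi 1) :=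
      integrableOn_Ioi_rpow_of_lt (by linarith) one_pos
    refine Integrable.mono' h1
      ((hc.mono (Set.Ioi_subset_Ioi zero_le_one)).aestronglyMeasurable measurableSet_Ioi) ?_
    filter_upwards [ae_restrict_mem measurableSet_Ioi] with r hr
    have hr0 : 0 < r := lt_trans one_pos hr
    rw [Real.norm_of_nonneg (by positivity), sub_eq_add_neg, Real.rpow_add hr0]
    have hq0 : -q ≤ 0 := by linarith
    exact mul_le_mul_of_nonneg_left
      (Real.rpow_le_rpow_of_nonpos hr0 (by linarith) hq0) (by positivity)

theorem integrableOn_rpow_mul_add_rpow {p q δ : ℝ} (hδ : 0 < δ) (hp : -1 < p) (hq : p + 1 < q) :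
    IntegrableOn (fun r : ℝ => r ^ p * (δ + r) ^ (-q)) (Set.Ioi 0) := by
  have h := (integrableOn_Ioi_comp_mul_left_iff
    (fun r : ℝ => r ^ p * (1 + r) ^ (-q)) 0 (inv_pos.2 hδ)).2
      (by simpa using integrableOn_rpow_mul_one_add_rpow hp hq)
  refine IntegrableOn.congr_fun (f := fun r => δ ^ p * δ ^ (-q) * _)
    (Integrable.const_mul h (δ ^ p * δ ^ (-q))) (fun r hr => ?_) measurableSet_Ioi
  have hr : (0 : ℝ) < r := hr
  have h1 : r = δ * (δ⁻¹ * r) := by field_simp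
  have h2 : δ + r = δ * (1 + δ⁻¹ * r) := by field_simp
  rw [h2]
  conv_rhs => rw [h1]
  rw [Real.mul_rpow hδ.le (by positivity), Real.mul_rpow hδ.le (by positivity)]
  have h3 : δ⁻¹ * (δ * (δ⁻¹ * r)) = δ⁻¹ * r := by field_simp
  rw [h3]
  ring

theorem integrableOn_one_add_sq_rpow {a : ℝ} (ha : 1 / 2 < a) :
    IntegrableOn (fun t : ℝ => (1 + t ^ 2) ^ (-a)) (Set.Ioi 0) := by
  have h := integrable_rpow_neg_one_add_norm_sq (E := ℝ) (μ := volume) (r := 2 * a)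
    (by simp; linarith)
  refine (h.integrableOn (s := Set.Ioi 0)).congr_fun (fun t _ => ?_) measurableSet_Ioi
  simp only [Real.norm_eq_abs, sq_abs]
  congr 1; ring

theorem sq_add_sq_rpow_eq {a ρ t : ℝ} (hρ : 0 < ρ) :
    (ρ ^ 2 + t ^ 2) ^ (-a) = ρ ^ (-(2 * a)) * (1 + (ρ⁻¹ * t) ^ 2) ^ (-a) := by
  have h1 : ρ ^ 2 + t ^ 2 = ρ ^ 2 * (1 + (ρ⁻¹ * t) ^ 2) := by field_simp
  rw [h1, Real.mul_rpow (by positivity) (by positivity), ← Real.rpow_natCast ρ 2,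
    ← Real.rpow_mul hρ.le]
  congr 2; push_cast; ring

theorem integrableOn_sq_add_sq_rpow {a ρ : ℝ} (ha : 1 / 2 < a) (hρ : 0 < ρ) :
    IntegrableOn (fun t : ℝ => (ρ ^ 2 + t ^ 2) ^ (-a)) (Set.Ioi 0) := by
  simp_rw [sq_add_sq_rpow_eq hρ]
  refine Integrable.const_mul ?_ _
  exact (integrableOn_Ioi_comp_mul_left_iff (fun t : ℝ => (1 + t ^ 2) ^ (-a)) 0
    (inv_pos.2 hρ)).2 (by simpa using integrableOn_one_add_sq_rpow ha)

theorem integral_sq_add_sq_rpow {a ρ : ℝ} (hρ : 0 < ρ) :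
    ∫ t in Set.Ioi (0 : ℝ), (ρ ^ 2 + t ^ 2) ^ (-a) =
      ρ ^ (1 - 2 * a) * ∫ t in Set.Ioi (0 : ℝ), (1 + t ^ 2) ^ (-a) := by
  simp_rw [sq_add_sq_rpow_eq hρ]
  rw [integral_const_mul, integral_comp_mul_left_Ioi (fun t : ℝ => (1 + t ^ 2) ^ (-a)) 0
    (inv_pos.2 hρ), sub_eq_add_neg, Real.rpow_add hρ]
  simp
  ring

/-- The substitution `q = 1/s`, with Jacobian `s^(-2)`, in the Gamma integrand. It turns the Gamma
integral into the integral of the subordination weight `s^(-b-1) e^(-y/s)`. -/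
theorem inv_comp_eq {b y s : ℝ} (hs : 0 < s) :
    (|(-1 : ℝ)| * s ^ ((-1 : ℝ) - 1)) •
      ((s ^ (-1 : ℝ)) ^ (b - 1) * Real.exp (-(y * s ^ (-1 : ℝ)))) =
      s ^ (-b - 1) * Real.exp (-(y / s)) := by
  rw [Real.rpow_neg_one, Real.inv_rpow hs.le, ← Real.rpow_neg hs.le]
  simp only [abs_neg, abs_one, one_mul, smul_eq_mul]
  rw [← mul_assoc, ← Real.rpow_add hs]
  congr 2
  ring

theorem integrableOn_rpow_mul_exp_neg_div {b y : ℝ} (hb : 0 < b) (hy : 0 < y) :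
    IntegrableOn (fun s : ℝ => s ^ (-b - 1) * Real.exp (-(y / s))) (Set.Ioi 0) := by
  have h := integrableOn_rpow_mul_exp_neg_mul_rpow (p := 1) (s := b - 1) (b := y)
    (by linarith) one_pos hy
  have h2 := (integrableOn_Ioi_comp_rpow_iff
    (fun q : ℝ => q ^ (b - 1) * Real.exp (-(y * q))) (p := -1) (by norm_num)).2
    (h.congr_fun (fun q _ => by simp) measurableSet_Ioi)
  exact h2.congr_fun (fun s hs => inv_comp_eq hs) measurableSet_Ioi

theorem integral_rpow_mul_exp_neg_div {b y : ℝ} (hb : 0 < b) (hy : 0 < y) :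
    ∫ s in Set.Ioi (0 : ℝ), s ^ (-b - 1) * Real.exp (-(y / s)) = Real.Gamma b * y ^ (-b) := by
  have h := Real.integral_rpow_mul_exp_neg_mul_Ioi hb hy
  rw [← integral_comp_rpow_Ioi (fun q : ℝ => q ^ (b - 1) * Real.exp (-(y * q))) (p := -1)
    (by norm_num)] at h
  rw [← setIntegral_congr_fun measurableSet_Ioi (fun s hs => inv_comp_eq hs), h,
    one_div, Real.inv_rpow hy.le, Real.rpow_neg hy.le, mul_comm]

/-! ### The identity theorem on the right half-plane. -/

/-- A function holomorphic on the right half-plane that vanishes on the positive reals is zero. -/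
theorem eq_zero_of_eq_zero_on_pos {E : Type*} [NormedAddCommGroup E] [NormedSpace ℂ E]
    [CompleteSpace E] {F : ℂ → E} (hF : DifferentiableOn ℂ F {z : ℂ | 0 < z.re})
    (h0 : ∀ x : ℝ, 0 < x → F x = 0) {z : ℂ} (hz : 0 < z.re) : F z = 0 := by
  have hopen : IsOpen {z : ℂ | 0 < z.re} := isOpen_lt continuous_const Complex.continuous_re
  have hconv : Convex ℝ {z : ℂ | 0 < z.re} := convex_halfSpace_re_gt 0
  refine (hF.analyticOnNhd hopen).eqOn_zero_of_preconnected_of_frequently_eq_zero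
    hconv.isPreconnected (z₀ := 1) (by simp) ?_ hz
  -- Positive reals different from `1` that accumulate at `1` suffice for the identity theorem.
  have ht : Tendsto (fun n : ℕ => ((1 + 1 / ((n : ℝ) + 1) : ℝ) : ℂ)) atTop (𝓝[≠] 1) := by
    refine tendsto_nhdsWithin_iff.2 ⟨?_, Eventually.of_forall fun n => ?_⟩
    · have := (tendsto_one_div_add_atTop_nhds_zero_nat (𝕜 := ℝ)).const_add 1
      have h2 := (Complex.continuous_ofReal.tendsto _).comp this
      rw [add_zero, Complex.ofReal_one] at h2
      exact h2
    · have : (0 : ℝ) < 1 / ((n : ℝ) + 1) := by positivity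
      simp only [Set.mem_compl_iff, Set.mem_singleton_iff]
      intro h
      have h2 := congrArg Complex.re h
      simp only [Complex.ofReal_re, Complex.one_re] at h2
      linarith
  exact ht.frequently (Frequently.of_forall fun n => h0 _ (by positivity))

/-! ### The Laplace transform of the heat kernel. -/

/-- The Gauss error primitive `∫_0^w e^{-x²} dx`. -/
def gaussPrimitive (w : ℝ) : ℝ := ∫ x in (0 : ℝ)..w, Real.exp (-1 * x ^ 2)

theorem hasDerivAt_gaussPrimitive (w : ℝ) :
    HasDerivAt gaussPrimitive (Real.exp (-1 * w ^ 2)) w := by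
  have hc : Continuous fun x : ℝ => Real.exp (-1 * x ^ 2) := by fun_prop
  exact intervalIntegral.integral_hasDerivAt_right (hc.intervalIntegrable _ _)
    (hc.stronglyMeasurableAtFilter _ _) hc.continuousAt

theorem tendsto_gaussPrimitive_atTop : Tendsto gaussPrimitive atTop (𝓝 (√Real.pi / 2)) := by
  have h := intervalIntegral_tendsto_integral_Ioi (μ := volume) 0
    ((integrable_exp_neg_mul_sq one_pos).integrableOn (s := Set.Ioi 0)) tendsto_id
  rwa [integral_gaussian_Ioi, div_one] at h

theorem gaussPrimitive_neg (w : ℝ) : gaussPrimitive (-w) = -gaussPrimitive w := by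
  have h := intervalIntegral.integral_comp_neg (a := 0) (b := w)
    (fun x : ℝ => Real.exp (-1 * x ^ 2))
  simp only [even_two.neg_pow, neg_zero] at h
  rw [gaussPrimitive, gaussPrimitive, h, intervalIntegral.integral_symm (-w) 0]

theorem tendsto_gaussPrimitive_atBot : Tendsto gaussPrimitive atBot (𝓝 (-(√Real.pi / 2))) := by
  have h := (tendsto_gaussPrimitive_atTop.comp tendsto_neg_atBot_atTop).neg
  refine h.congr fun w => ?_
  simp [gaussPrimitive_neg]

/-- Overwriting the value at `0` by the limit `l` replaces continuity there. The integrands to come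
contain `1/s` or negative powers of `s`, so their values at `0` carry no meaning. -/
theorem integral_Ioi_zero_of_hasDerivAt {E : Type*} [NormedAddCommGroup E] [NormedSpace ℝ E]
    [CompleteSpace E] {f f' : ℝ → E} {l m : E} (hd : ∀ x : ℝ, 0 < x → HasDerivAt f (f' x) x)
    (hi : IntegrableOn f' (Set.Ioi 0)) (h0 : Tendsto f (𝓝[>] 0) (𝓝 l))
    (hm : Tendsto f atTop (𝓝 m)) : ∫ x in Set.Ioi (0 : ℝ), f' x = m - l := by
  have he : ∀ x : ℝ, 0 < x → Function.update f 0 l =ᶠ[𝓝 x] f := fun x hx => by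
    filter_upwards [lt_mem_nhds hx] with y hy
    simp [Function.update_of_ne hy.ne']
  have h := integral_Ioi_of_hasDerivAt_of_tendsto (f := Function.update f 0 l) (f' := f') (a := 0)
    (m := m) ?_ (fun x hx => (hd x hx).congr_of_eventuallyEq (he x hx)) hi ?_
  · simpa using h
  · rw [continuousWithinAt_update_same]
    exact h0.mono_left (nhdsWithin_mono _ fun x hx => lt_of_le_of_ne hx.1 (Ne.symm hx.2))
  · refine hm.congr' ?_
    filter_upwards [eventually_gt_atTop 0] with y hy
    simp [Function.update_of_ne hy.ne']

theorem integrableOn_exp_mul_rpow_neg_half {μ : ℝ} (hμ : 0 < μ) :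
    IntegrableOn (fun s : ℝ => Real.exp (-(μ * s)) * s ^ (-(1 / 2) : ℝ)) (Set.Ioi 0) := by
  have h := integrableOn_rpow_mul_exp_neg_mul_rpow (p := 1) (s := -(1 / 2)) (b := μ)
    (by norm_num) one_pos hμ
  exact h.congr_fun (fun q _ => by simp [mul_comm]) measurableSet_Ioi

/-- The Laplace transform of the heat kernel. -/
theorem integral_exp_mul_heat {l t : ℝ} (hl : 0 < l) (ht : 0 < t) :
    ∫ s in Set.Ioi (0 : ℝ), Real.exp (-(l ^ 2 * s)) * s ^ (-(1 / 2) : ℝ) *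
      Real.exp (-(t ^ 2 / (4 * s))) = √Real.pi * Real.exp (-(l * t)) / l := by
  -- `Q` is `l` times a primitive of the integrand. Completing the square, `(l√s ∓ t/(2√s))² = l²s ∓
  -- lt + t²/(4s)`, makes both exponentials equal, and the terms with `t/s^(3/2)` cancel in the
  -- derivative.
  set Q : ℝ → ℝ := fun s => Real.exp (-(l * t)) * gaussPrimitive (l * √s - t / (2 * √s)) +
    Real.exp (l * t) * gaussPrimitive (l * √s + t / (2 * √s)) with hQ
  have hsq0 : Tendsto (fun s : ℝ => √s) (𝓝[>] 0) (𝓝[>] 0) := by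
    refine tendsto_nhdsWithin_iff.2 ⟨?_, ?_⟩
    · have := (Real.continuous_sqrt.tendsto 0).mono_left (nhdsWithin_le_nhds (s := Set.Ioi 0))
      simpa using this
    · filter_upwards [self_mem_nhdsWithin] with s hs using Real.sqrt_pos.2 hs
  have hdiv0 : Tendsto (fun s : ℝ => t / (2 * √s)) (𝓝[>] 0) atTop := by
    have := (tendsto_inv_nhdsGT_zero.comp hsq0).const_mul_atTop (half_pos ht)
    refine this.congr fun s => ?_
    simp only [Function.comp]; ring
  have hdivT : Tendsto (fun s : ℝ => t / (2 * √s)) atTop (𝓝 0) := by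
    have := (tendsto_inv_atTop_zero.comp Real.tendsto_sqrt_atTop).const_mul (t / 2)
    rw [mul_zero] at this
    refine this.congr fun s => ?_
    simp only [Function.comp]; ring
  have hmul0 : Tendsto (fun s : ℝ => l * √s) (𝓝[>] 0) (𝓝 0) := by
    simpa using (hsq0.mono_right nhdsWithin_le_nhds).const_mul l
  have hmulT : Tendsto (fun s : ℝ => l * √s) atTop atTop :=
    Real.tendsto_sqrt_atTop.const_mul_atTop hl
  have hd : ∀ s : ℝ, 0 < s → HasDerivAt Q (l * (Real.exp (-(l ^ 2 * s)) * s ^ (-(1 / 2) : ℝ) *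
      Real.exp (-(t ^ 2 / (4 * s))))) s := by
    intro s hs
    have hs2 : 0 < √s := Real.sqrt_pos.2 hs
    have hss : √s ^ 2 = s := Real.sq_sqrt hs.le
    have h1 : HasDerivAt (fun s : ℝ => √s) (1 / (2 * √s)) s := Real.hasDerivAt_sqrt hs.ne'
    have h2 : HasDerivAt (fun s : ℝ => l * √s) (l * (1 / (2 * √s))) s := h1.const_mul l
    have h3 : HasDerivAt (fun s : ℝ => t / (2 * √s))
        ((0 * (2 * √s) - t * (2 * (1 / (2 * √s)))) / (2 * √s) ^ 2) s :=
      (hasDerivAt_const s t).div (h1.const_mul 2) (by positivity)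
    have h4 := ((hasDerivAt_gaussPrimitive _).comp s (h2.sub h3)).const_mul (Real.exp (-(l * t)))
    have h5 := ((hasDerivAt_gaussPrimitive _).comp s (h2.add h3)).const_mul (Real.exp (l * t))
    refine (h4.add h5).congr_deriv ?_
    have e0 : Real.exp (-(l ^ 2 * s)) * Real.exp (-(t ^ 2 / (4 * s))) =
      Real.exp (-(l ^ 2 * s) - t ^ 2 / (4 * s)) := by rw [← Real.exp_add]; ring_nf
    have ee : -(l ^ 2 * s) - t ^ 2 / (4 * s) = -(l ^ 2 * √s ^ 2) - t ^ 2 / (4 * √s ^ 2) := by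
      rw [hss]
    have e1 : Real.exp (-(l * t)) * Real.exp (-1 * (l * √s - t / (2 * √s)) ^ 2) =
      Real.exp (-(l ^ 2 * s) - t ^ 2 / (4 * s)) := by
      rw [← Real.exp_add, ee]; congr 1; field_simp; ring
    have e2 : Real.exp (l * t) * Real.exp (-1 * (l * √s + t / (2 * √s)) ^ 2) =
      Real.exp (-(l ^ 2 * s) - t ^ 2 / (4 * s)) := by
      rw [← Real.exp_add, ee]; congr 1; field_simp; ring
    have e3 : s ^ (-(1 / 2) : ℝ) = 1 / √s := by
      rw [Real.rpow_neg hs.le, ← Real.sqrt_eq_rpow, one_div]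
    simp only [Pi.sub_apply, Pi.add_apply]
    rw [← mul_assoc (Real.exp (-(l * t))), e1, ← mul_assoc (Real.exp (l * t)), e2,
      mul_right_comm _ (s ^ _), e0, e3]
    field_simp
    ring
  have hi : IntegrableOn (fun s : ℝ => Real.exp (-(l ^ 2 * s)) * s ^ (-(1 / 2) : ℝ) *
      Real.exp (-(t ^ 2 / (4 * s)))) (Set.Ioi 0) := by
    refine Integrable.mono' (integrableOn_exp_mul_rpow_neg_half (pow_pos hl 2))
      (by fun_prop) ?_
    filter_upwards [ae_restrict_mem measurableSet_Ioi] with s hs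
    have hs : (0 : ℝ) < s := hs
    rw [Real.norm_of_nonneg (by positivity)]
    exact mul_le_of_le_one_right (by positivity) (Real.exp_le_one_iff.2 (by
      rw [neg_nonpos]; positivity))
  have h := integral_Ioi_zero_of_hasDerivAt (l := Real.exp (-(l * t)) * -(√Real.pi / 2) +
    Real.exp (l * t) * (√Real.pi / 2)) (m := Real.exp (-(l * t)) * (√Real.pi / 2) +
    Real.exp (l * t) * (√Real.pi / 2)) hd (hi.const_mul l) ?_ ?_
  · rw [integral_const_mul] at h
    rw [eq_div_iff hl.ne', mul_comm, h]
    ring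
  · refine Tendsto.add (Tendsto.const_mul _ (tendsto_gaussPrimitive_atBot.comp ?_))
      (Tendsto.const_mul _ (tendsto_gaussPrimitive_atTop.comp ?_))
    · exact hmul0.add_atBot (tendsto_neg_atTop_atBot.comp hdiv0)
    · exact hmul0.add_atTop hdiv0
  · refine Tendsto.add (Tendsto.const_mul _ (tendsto_gaussPrimitive_atTop.comp ?_))
      (Tendsto.const_mul _ (tendsto_gaussPrimitive_atTop.comp ?_))
    · exact hmulT.atTop_add hdivT.neg
    · exact hmulT.atTop_add hdivT

/-! ### Holomorphy and uniqueness of the Laplace transform. -/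

theorem mul_exp_neg_mul_le {δ s : ℝ} (hδ : 0 < δ) : s * Real.exp (-(δ * s)) ≤ δ⁻¹ := by
  have h := Real.add_one_le_exp (δ * s)
  rw [Real.exp_neg, ← div_eq_mul_inv, div_le_iff₀ (Real.exp_pos _)]
  calc s = δ⁻¹ * (δ * s) := by field_simp
    _ ≤ δ⁻¹ * Real.exp (δ * s) := by gcongr; linarith

theorem integrableOn_exp_neg_mul {μ : ℝ} (hμ : 0 < μ) :
    IntegrableOn (fun s : ℝ => Real.exp (-(μ * s))) (Set.Ioi 0) := by
  simpa using exp_neg_integrableOn_Ioi 0 hμ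

theorem hasDerivAt_exp_neg_mul (μ s : ℝ) :
    HasDerivAt (fun s : ℝ => Real.exp (-(μ * s))) (Real.exp (-(μ * s)) * -μ) s := by
  have : HasDerivAt (fun s : ℝ => -(μ * s)) (-(μ * 1)) s := ((hasDerivAt_id s).const_mul μ).neg
  rw [mul_one] at this
  exact this.exp

theorem differentiableOn_laplace {E : Type*} [NormedAddCommGroup E] [NormedSpace ℂ E] {g : ℝ → E}
    (hc : ContinuousOn g (Set.Ioi 0))
    (hi : ∀ μ : ℝ, 0 < μ → IntegrableOn (fun s => Real.exp (-(μ * s)) • g s) (Set.Ioi 0)) :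
    DifferentiableOn ℂ (fun z : ℂ => ∫ s in Set.Ioi (0 : ℝ), Complex.exp (-z * s) • g s)
      {z : ℂ | 0 < z.re} := by
  intro z₀ hz₀
  have hz₀ : 0 < z₀.re := hz₀
  -- On `Re z > 2δ` the exponential splits into two factors `e^(-δs)`: one absorbs the `s` produced
  -- by differentiation, the other is integrable against `g`.
  set δ := z₀.re / 4 with hδ
  have hδ0 : 0 < δ := by positivity
  have hmeas : ∀ z : ℂ, AEStronglyMeasurable (fun s : ℝ => Complex.exp (-z * s) • g s)
      (volume.restrict (Set.Ioi 0)) := fun z =>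
    (ContinuousOn.smul (by fun_prop) hc).aestronglyMeasurable measurableSet_Ioi
  have hnorm : ∀ (z : ℂ) (s : ℝ), ‖Complex.exp (-z * s) • g s‖ = Real.exp (-(z.re * s)) * ‖g s‖ :=
    by
    intro z s
    rw [norm_smul, Complex.norm_exp]
    simp
  refine (hasDerivAt_integral_of_dominated_loc_of_deriv_le (𝕜 := ℂ)
    (F' := fun (z : ℂ) (s : ℝ) => (Complex.exp (-z * s) * -(s : ℂ)) • g s)
    (s := {z : ℂ | 2 * δ < z.re}) (bound := fun s => ‖δ⁻¹ • Real.exp (-(δ * s)) • g s‖) ?_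
    (Eventually.of_forall hmeas) ?_ ?_ ?_ ((hi δ hδ0).smul δ⁻¹).norm ?_).2.differentiableAt
    |>.differentiableWithinAt
  · exact (isOpen_lt continuous_const Complex.continuous_re).mem_nhds (by
      simp only [Set.mem_ofPred_eq]; linarith)
  · refine Integrable.congr' (hi _ hz₀) (hmeas _) ?_
    refine Eventually.of_forall fun s => ?_
    simp only [hnorm, norm_smul, Real.norm_eq_abs, Real.abs_exp]
  · exact (ContinuousOn.smul (by fun_prop) hc).aestronglyMeasurable measurableSet_Ioi
  · filter_upwards [ae_restrict_mem measurableSet_Ioi] with s hs z hz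
    have hs : (0 : ℝ) < s := hs
    have hz : 2 * δ < z.re := hz
    have h1 : ‖Complex.exp (-z * s)‖ ≤ Real.exp (-(δ * s)) * Real.exp (-(δ * s)) := by
      rw [Complex.norm_exp, ← Real.exp_add]
      refine Real.exp_le_exp.2 ?_
      simp only [Complex.mul_re, Complex.neg_re, Complex.ofReal_re, Complex.ofReal_im, mul_zero,
        sub_zero]
      nlinarith
    rw [norm_smul, norm_mul, norm_neg, Complex.norm_real, Real.norm_of_nonneg hs.le, norm_smul,
      norm_smul, Real.norm_of_nonneg (Real.exp_pos _).le, Real.norm_of_nonneg (by positivity),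
      ← mul_assoc]
    refine mul_le_mul_of_nonneg_right ?_ (norm_nonneg _)
    calc ‖Complex.exp (-z * s)‖ * s ≤ Real.exp (-(δ * s)) * Real.exp (-(δ * s)) * s := by gcongr
      _ = (s * Real.exp (-(δ * s))) * Real.exp (-(δ * s)) := by ring
      _ ≤ _ := by gcongr; exact mul_exp_neg_mul_le hδ0
  · refine Eventually.of_forall fun s z _ => ?_
    have h1 : HasDerivAt (fun z : ℂ => -z * s) (-(s : ℂ)) z := by
      simpa using (hasDerivAt_id z).neg.mul_const (s : ℂ)
    exact h1.cexp.smul_const (g s)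

/-- Uniqueness for the Laplace transform on the positive half-line. -/
theorem eq_zero_of_laplace_eq_zero {E : Type*} [NormedAddCommGroup E] [NormedSpace ℂ E]
    [CompleteSpace E] {g : ℝ → E} (hc : ContinuousOn g (Set.Ioi 0))
    (hi : ∀ μ : ℝ, 0 < μ → IntegrableOn (fun s => Real.exp (-(μ * s)) • g s) (Set.Ioi 0))
    (h0 : ∀ μ : ℝ, 0 < μ → ∫ s in Set.Ioi (0 : ℝ), Real.exp (-(μ * s)) • g s = 0)
    {s : ℝ} (hs : 0 < s) : g s = 0 := by
  -- The identity theorem carries the vanishing from positive `μ` to the half-plane.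
  have hG : ∀ z : ℂ, 0 < z.re → ∫ s in Set.Ioi (0 : ℝ), Complex.exp (-z * s) • g s = 0 := by
    intro z hz
    refine eq_zero_of_eq_zero_on_pos (differentiableOn_laplace hc hi) (fun x hx => ?_) hz
    rw [← h0 x hx]
    refine setIntegral_congr_fun measurableSet_Ioi fun s _ => ?_
    rw [← Complex.coe_smul]
    push_cast
    simp
  -- On the line `z = 1 + 2πiξ` the transform of `g` is the Fourier transform of `f`. Since it
  -- vanishes it is integrable, and Fourier inversion applies at every point where `f` is
  -- continuous.
  set f : ℝ → E := (Set.Ioi (0 : ℝ)).indicator fun s => Real.exp (-(1 * s)) • g s with hf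
  have hF : FourierTransform.fourier f = 0 := by
    ext ξ
    rw [Real.fourier_eq', Pi.zero_apply, ← hG (1 + 2 * Real.pi * ξ * Complex.I) (by simp),
      ← integral_indicator measurableSet_Ioi]
    refine integral_congr_ae (Eventually.of_forall fun s => ?_)
    simp only [hf]
    by_cases h : s ∈ Set.Ioi (0 : ℝ)
    · simp only [Set.indicator_of_mem h]
      rw [← Complex.coe_smul, smul_smul, Complex.ofReal_exp, ← Complex.exp_add]
      congr 2
      simp
      ring
    · simp only [Set.indicator_of_notMem h, smul_zero]
  have hfi : Integrable f := (integrable_indicator_iff measurableSet_Ioi).2 (hi 1 one_pos)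
  have hcont : ContinuousAt f s := by
    have h1 : ContinuousAt (fun s => Real.exp (-(1 * s)) • g s) s :=
      (show ContinuousAt (fun s : ℝ => Real.exp (-(1 * s))) s by fun_prop).smul
        (hc.continuousAt (Ioi_mem_nhds hs))
    refine h1.congr ?_
    filter_upwards [Ioi_mem_nhds hs] with x hx
    simp [hf, Set.indicator_of_mem hx]
  have h := hfi.fourierInv_fourier_eq (by rw [hF]; exact integrable_zero _ _ _) hcont
  rw [hF, Real.fourierInv_eq'] at h
  simp only [Pi.zero_apply, smul_zero, integral_zero] at h
  have h2 : f s = Real.exp (-(1 * s)) • g s := by simp [hf, hs]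
  rw [h2] at h
  exact (smul_eq_zero.1 h.symm).resolve_left (Real.exp_pos _).ne'

/-! ### The semigroup calculus of a family whose Laplace transform is a resolvent. -/

/-- `T` is a bounded family on `(0, ∞)`, strongly differentiable with `‖T' s‖ = O(1 / s)`, whose
Laplace transform is the resolvent `R` of `A`. -/
structure IsLaplaceFamily {X : Type*} [NormedAddCommGroup X] [NormedSpace ℂ X]
    (A : X →ₗ.[ℂ] X) (R T T' : ℝ → X →L[ℂ] X) (K : ℝ) : Prop where
  bound : ∀ s : ℝ, 0 < s → ‖T s‖ ≤ K
  bound' : ∀ s : ℝ, 0 < s → ‖T' s‖ ≤ K / s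
  hasDeriv : ∀ s : ℝ, 0 < s → ∀ f : X, HasDerivAt (fun s => T s f) (T' s f) s
  laplace : ∀ μ : ℝ, 0 < μ → ∀ f : X, ∫ s in Set.Ioi (0 : ℝ), Real.exp (-(μ * s)) • T s f = R μ f
  right : ∀ μ : ℝ, 0 < μ → ∀ f : X, ∃ x : A.domain, (x : X) = R μ f ∧ (μ : ℂ) • (x : X) - A x = f
  left : ∀ μ : ℝ, 0 < μ → ∀ x : A.domain, R μ ((μ : ℂ) • (x : X) - A x) = x

namespace IsLaplaceFamily

variable {X : Type*} [NormedAddCommGroup X] [NormedSpace ℂ X]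
  {A : X →ₗ.[ℂ] X} {R T T' : ℝ → X →L[ℂ] X} {K : ℝ}

theorem norm_apply_le (h : IsLaplaceFamily A R T T' K) {s : ℝ} (hs : 0 < s) (f : X) :
    ‖T s f‖ ≤ K * ‖f‖ := (T s).le_of_opNorm_le (h.bound s hs) f

theorem continuousOn (h : IsLaplaceFamily A R T T' K) (f : X) :
    ContinuousOn (fun s => T s f) (Set.Ioi 0) :=
  fun s hs => (h.hasDeriv s hs f).continuousAt.continuousWithinAt

theorem integrableOn_smul (h : IsLaplaceFamily A R T T' K) {w : ℝ → ℝ}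
    (hw : IntegrableOn w (Set.Ioi 0)) (f : X) :
    IntegrableOn (fun s => w s • T s f) (Set.Ioi 0) := by
  refine Integrable.mono' (hw.norm.mul_const (K * ‖f‖))
    (hw.aestronglyMeasurable.smul ((h.continuousOn f).aestronglyMeasurable measurableSet_Ioi)) ?_
  filter_upwards [ae_restrict_mem measurableSet_Ioi] with s hs
  rw [norm_smul]
  gcongr
  exact h.norm_apply_le hs f

theorem integrableOn_exp_smul (h : IsLaplaceFamily A R T T' K) {μ : ℝ} (hμ : 0 < μ) (f : X) :
    IntegrableOn (fun s => Real.exp (-(μ * s)) • T s f) (Set.Ioi 0) :=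
  h.integrableOn_smul (integrableOn_exp_neg_mul hμ) f

theorem intervalIntegrable (h : IsLaplaceFamily A R T T' K) {s : ℝ} (hs : 0 ≤ s) (f : X) :
    IntervalIntegrable (fun r => T r f) volume 0 s := by
  rw [intervalIntegrable_iff_integrableOn_Ioc_of_le hs]
  refine Integrable.mono' (g := fun _ => K * ‖f‖) (integrableOn_const (by simp))
    (((h.continuousOn f).mono Set.Ioc_subset_Ioi_self).aestronglyMeasurable measurableSet_Ioc) ?_
  filter_upwards [ae_restrict_mem measurableSet_Ioc] with r hr using h.norm_apply_le hr.1 f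

theorem hasDerivAt_integral [CompleteSpace X] (h : IsLaplaceFamily A R T T' K) {s : ℝ} (hs : 0 < s)
    (f : X) :
    HasDerivAt (fun s => ∫ r in (0 : ℝ)..s, T r f) (T s f) s :=
  intervalIntegral.integral_hasDerivAt_right (h.intervalIntegrable hs.le f)
    ((h.continuousOn f).stronglyMeasurableAtFilter isOpen_Ioi _ hs)
    ((h.continuousOn f).continuousAt (Ioi_mem_nhds hs))

theorem norm_integral_le (h : IsLaplaceFamily A R T T' K) {s : ℝ} (hs : 0 < s) (f : X) :
    ‖∫ r in (0 : ℝ)..s, T r f‖ ≤ K * ‖f‖ * s := by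
  have h1 := intervalIntegral.norm_integral_le_of_norm_le_const (a := 0) (b := s)
    (f := fun r => T r f) (C := K * ‖f‖) (fun r hr => by
      rw [Set.uIoc_of_le hs.le] at hr; exact h.norm_apply_le hr.1 f)
  rwa [sub_zero, abs_of_pos hs] at h1

theorem integrableOn_exp_smul_integral [CompleteSpace X] (h : IsLaplaceFamily A R T T' K) {μ : ℝ}
    (hμ : 0 < μ)
    (f : X) : IntegrableOn (fun s => Real.exp (-(μ * s)) • ∫ r in (0 : ℝ)..s, T r f)
      (Set.Ioi 0) := by
  have h1 : IntegrableOn (fun s : ℝ => (μ / 2)⁻¹ * (K * ‖f‖) * Real.exp (-(μ / 2 * s)))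
      (Set.Ioi 0) :=
    Integrable.const_mul (integrableOn_exp_neg_mul (half_pos hμ)) _
  have hc : ContinuousOn (fun s : ℝ => Real.exp (-(μ * s))) (Set.Ioi 0) := by fun_prop
  refine Integrable.mono' h1 ((hc.smul fun s hs =>
    (h.hasDerivAt_integral hs f).continuousAt.continuousWithinAt).aestronglyMeasurable
      measurableSet_Ioi) ?_
  filter_upwards [ae_restrict_mem measurableSet_Ioi] with s hs
  rw [norm_smul, Real.norm_of_nonneg (Real.exp_pos _).le]
  have h2 := h.norm_integral_le hs f
  have h3 := mul_exp_neg_mul_le (s := s) (half_pos hμ)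
  have h4 : 0 ≤ K * ‖f‖ := (norm_nonneg _).trans (h.norm_apply_le hs f)
  calc Real.exp (-(μ * s)) * ‖∫ r in (0 : ℝ)..s, T r f‖
      ≤ Real.exp (-(μ * s)) * (K * ‖f‖ * s) := by gcongr
    _ = (s * Real.exp (-(μ / 2 * s))) * (K * ‖f‖) * Real.exp (-(μ / 2 * s)) := by
        rw [show -(μ * s) = -(μ / 2 * s) + -(μ / 2 * s) by ring, Real.exp_add]; ring
    _ ≤ _ := by gcongr

theorem laplace_integral [CompleteSpace X] (h : IsLaplaceFamily A R T T' K) {μ : ℝ} (hμ : 0 < μ)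
    (f : X) :
    ∫ s in Set.Ioi (0 : ℝ), Real.exp (-(μ * s)) • ∫ r in (0 : ℝ)..s, T r f = μ⁻¹ • R μ f := by
  set V : ℝ → X := fun s => ∫ r in (0 : ℝ)..s, T r f with hV
  have hd : ∀ s : ℝ, 0 < s → HasDerivAt (fun s => Real.exp (-(μ * s)) • V s)
      (Real.exp (-(μ * s)) • T s f - μ • Real.exp (-(μ * s)) • V s) s := by
    intro s hs
    have h1 := hasDerivAt_exp_neg_mul μ s
    refine (h1.smul (h.hasDerivAt_integral hs f)).congr_deriv ?_
    rw [mul_neg, neg_smul, ← sub_eq_add_neg, smul_smul, mul_comm μ (Real.exp _)]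
  have hb : ∀ s : ℝ, 0 < s → ‖Real.exp (-(μ * s)) • V s‖ ≤ K * ‖f‖ * s := fun s hs => by
    rw [norm_smul, Real.norm_of_nonneg (Real.exp_pos _).le]
    refine (mul_le_of_le_one_left (norm_nonneg _) ?_).trans (h.norm_integral_le hs f)
    exact Real.exp_le_one_iff.2 (by rw [neg_nonpos]; positivity)
  have hb2 : ∀ s : ℝ, 0 < s → ‖Real.exp (-(μ * s)) • V s‖ ≤
      K * ‖f‖ * (s * Real.exp (-(μ * s))) := fun s hs => by
    rw [norm_smul, Real.norm_of_nonneg (Real.exp_pos _).le]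
    have := h.norm_integral_le hs f
    calc _ ≤ Real.exp (-(μ * s)) * (K * ‖f‖ * s) := by gcongr
      _ = _ := by ring
  have h0 : Tendsto (fun s => Real.exp (-(μ * s)) • V s) (𝓝[>] 0) (𝓝 0) := by
    refine squeeze_zero_norm' (a := fun s => K * ‖f‖ * s) ?_ ?_
    · filter_upwards [self_mem_nhdsWithin] with s hs using hb s hs
    · have : Tendsto (fun s : ℝ => K * ‖f‖ * s) (𝓝 0) (𝓝 (K * ‖f‖ * 0)) :=
        (continuous_const.mul continuous_id).tendsto _
      rw [mul_zero] at this
      exact this.mono_left nhdsWithin_le_nhds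
  have hT : Tendsto (fun s => Real.exp (-(μ * s)) • V s) atTop (𝓝 0) := by
    refine squeeze_zero_norm' (a := fun s => K * ‖f‖ * (s * Real.exp (-(μ * s)))) ?_ ?_
    · filter_upwards [eventually_gt_atTop 0] with s hs using hb2 s hs
    · have h1 := Real.tendsto_pow_mul_exp_neg_atTop_nhds_zero 1
      have h2 := (h1.comp (tendsto_id.const_mul_atTop hμ)).const_mul (K * ‖f‖ * μ⁻¹)
      rw [mul_zero] at h2
      refine h2.congr fun s => ?_
      simp only [Function.comp, id, pow_one]
      field_simp
  have hi : IntegrableOn (fun s => μ • Real.exp (-(μ * s)) • V s) (Set.Ioi 0) :=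
    (h.integrableOn_exp_smul_integral hμ f).smul μ
  have hI := integral_Ioi_zero_of_hasDerivAt hd ((h.integrableOn_exp_smul hμ f).sub hi) h0 hT
  rw [integral_sub (h.integrableOn_exp_smul hμ f) hi, integral_smul, h.laplace μ hμ, sub_zero,
    sub_eq_zero] at hI
  rw [hI, smul_smul, inv_mul_cancel₀ hμ.ne', one_smul]

/-- Both sides have the same Laplace transform, since `R μ x = μ⁻¹ (x + R μ (A x))` by the left
inverse property and integration over `(0, s)` multiplies transforms by `μ⁻¹`. -/
theorem apply_eq_add_integral [CompleteSpace X] (h : IsLaplaceFamily A R T T' K) (x : A.domain)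
    {s : ℝ}
    (hs : 0 < s) : T s x = x + ∫ r in (0 : ℝ)..s, T r (A x) := by
  have hc : ContinuousOn (fun s => T s x - (x : X) - ∫ r in (0 : ℝ)..s, T r (A x)) (Set.Ioi 0) :=
    ((h.continuousOn _).sub continuousOn_const).sub fun s hs =>
      (h.hasDerivAt_integral hs _).continuousAt.continuousWithinAt
  have he : ∀ μ : ℝ, 0 < μ → IntegrableOn (fun s => Real.exp (-(μ * s)) • (x : X)) (Set.Ioi 0) :=
    fun μ hμ => Integrable.smul_const (integrableOn_exp_neg_mul hμ) _
  have heq : ∀ μ : ℝ, (fun s : ℝ => Real.exp (-(μ * s)) •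
      (T s x - (x : X) - ∫ r in (0 : ℝ)..s, T r (A x))) = fun s => Real.exp (-(μ * s)) • T s x -
      Real.exp (-(μ * s)) • (x : X) - Real.exp (-(μ * s)) • ∫ r in (0 : ℝ)..s, T r (A x) := by
    intro μ; ext s; simp only [smul_sub]
  have := eq_zero_of_laplace_eq_zero hc (fun μ hμ => ?_) (fun μ hμ => ?_) hs
  · rw [sub_sub, sub_eq_zero] at this
    exact this
  · rw [heq]
    exact ((h.integrableOn_exp_smul hμ _).sub (he μ hμ)).sub (h.integrableOn_exp_smul_integral hμ _)
  · have hl := h.left μ hμ x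
    rw [map_sub, map_smul, Complex.coe_smul, sub_eq_iff_eq_add] at hl
    have hi : IntegrableOn (fun s => Real.exp (-(μ * s)) • T s x - Real.exp (-(μ * s)) • (x : X))
      (Set.Ioi 0) := (h.integrableOn_exp_smul hμ _).sub (he μ hμ)
    rw [heq, integral_sub hi
      (h.integrableOn_exp_smul_integral hμ _), integral_sub (h.integrableOn_exp_smul hμ _)
        (he μ hμ),
      h.laplace μ hμ, h.laplace_integral hμ, integral_smul_const,
      show ∫ s in Set.Ioi (0 : ℝ), Real.exp (-(μ * s)) = μ⁻¹ by
        have := integral_exp_mul_Ioi (a := -μ) (by linarith) 0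
        simpa [neg_mul, one_div, inv_neg] using this,
      sub_sub, ← smul_add, ← hl, smul_smul, inv_mul_cancel₀ hμ.ne', one_smul, sub_self]

theorem deriv_apply_domain [CompleteSpace X] (h : IsLaplaceFamily A R T T' K) (x : A.domain)
    {s : ℝ} (hs : 0 < s) :
    T' s x = T s (A x) := by
  have h1 : HasDerivAt (fun s => T s x) (T s (A x)) s := by
    refine ((h.hasDerivAt_integral hs (A x)).const_add (x : X)).congr_of_eventuallyEq ?_
    filter_upwards [lt_mem_nhds hs] with r hr using h.apply_eq_add_integral x hr
  exact (h.hasDeriv s hs x).unique h1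

/-- `T s (A x) = T' s x`, so the bound on `T'` becomes decay of order `1/s`. This makes the
integrals with weight `s^(-σ)` converge at infinity. -/
theorem norm_apply_map_le [CompleteSpace X] (h : IsLaplaceFamily A R T T' K) (x : A.domain) {s : ℝ}
    (hs : 0 < s) :
    ‖T s (A x)‖ ≤ K / s * ‖(x : X)‖ := by
  rw [← h.deriv_apply_domain x hs]
  exact (T' s).le_of_opNorm_le (h.bound' s hs) _

/-- With `w = R ν (R μ f)`, the vector `(μ - A)w` lies in `D(A)`, because `A w = ν w - R μ f`. The
operator `ν - A` maps it to `(μ - A)(R μ f) = f`. Hence `R ν f = (μ - A)w`, and applying `R μ` gives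
`w`. -/
theorem resolvent_comm (h : IsLaplaceFamily A R T T' K) {μ ν : ℝ} (hμ : 0 < μ) (hν : 0 < ν)
    (f : X) : R μ (R ν f) = R ν (R μ f) := by
  obtain ⟨x, hx, hxf⟩ := h.right μ hμ f
  obtain ⟨y, hy, hyf⟩ := h.right ν hν f
  obtain ⟨w, hw, hwf⟩ := h.right ν hν x
  have hAw : A w = (ν : ℂ) • (w : X) - x := by rw [← hwf]; abel
  have h1 : R ν f = (μ : ℂ) • (w : X) - A w := by
    have e : f = (ν : ℂ) • ((μ : ℂ) • w - ((ν : ℂ) • w - x) : A.domain) -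
        A ((μ : ℂ) • w - ((ν : ℂ) • w - x)) := by
      rw [A.map_sub, A.map_sub, A.map_smul, A.map_smul, hAw, ← hxf]
      simp only [Submodule.coe_sub, Submodule.coe_smul, smul_sub]
      rw [smul_comm (μ : ℂ) (ν : ℂ) (w : X)]
      abel
    calc R ν f = R ν ((ν : ℂ) • ((μ : ℂ) • w - ((ν : ℂ) • w - x) : A.domain) -
        A ((μ : ℂ) • w - ((ν : ℂ) • w - x))) := by rw [← e]
      _ = _ := by rw [h.left ν hν, hAw]; simp
  rw [h1, h.left μ hμ, ← hx, hw]

/-- The commutation of resolvents is the Laplace transform of this identity. -/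
theorem resolvent_apply [CompleteSpace X] (h : IsLaplaceFamily A R T T' K) {ν s : ℝ} (hν : 0 < ν)
    (hs : 0 < s)
    (f : X) : R ν (T s f) = T s (R ν f) := by
  have hc : ContinuousOn (fun s => R ν (T s f) - T s (R ν f)) (Set.Ioi 0) :=
    ((R ν).continuous.comp_continuousOn (h.continuousOn f)).sub (h.continuousOn _)
  have heq : ∀ μ : ℝ, (fun s : ℝ => Real.exp (-(μ * s)) • (R ν (T s f) - T s (R ν f))) =
      fun s => R ν (Real.exp (-(μ * s)) • T s f) - Real.exp (-(μ * s)) • T s (R ν f) := by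
    intro μ; ext s; simp only [smul_sub, ContinuousLinearMap.map_smul_of_tower]
  refine sub_eq_zero.1 (eq_zero_of_laplace_eq_zero hc (fun μ hμ => ?_) (fun μ hμ => ?_) hs)
  · rw [heq]
    exact ((R ν).integrable_comp (h.integrableOn_exp_smul hμ f)).sub (h.integrableOn_exp_smul hμ _)
  · rw [heq, integral_sub ((R ν).integrable_comp (h.integrableOn_exp_smul hμ f))
      (h.integrableOn_exp_smul hμ _), (R ν).integral_comp_comm (h.integrableOn_exp_smul hμ f),
      h.laplace μ hμ, h.laplace μ hμ, h.resolvent_comm hν hμ, sub_self]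

/-- Expresses that `T s f` lies in `D(A)` with `A (T s f) = T' s f` for arbitrary `f`. Writing it
with the bounded operator `R ν` allows it to be used under integrals. -/
theorem resolvent_sub_deriv [CompleteSpace X] (h : IsLaplaceFamily A R T T' K) {ν s : ℝ}
    (hν : 0 < ν) (hs : 0 < s)
    (f : X) : R ν ((ν : ℂ) • T s f - T' s f) = T s f := by
  obtain ⟨x, hx, hxf⟩ := h.right ν hν f
  have h1 : HasDerivAt (fun s => R ν (T s f)) (R ν (T' s f)) s :=
    (R ν).hasFDerivAt.restrictScalars ℝ |>.comp_hasDerivAt s (h.hasDeriv s hs f)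
  have h2 : HasDerivAt (fun s => R ν (T s f)) (T' s x) s := by
    refine (h.hasDeriv s hs x).congr_of_eventuallyEq ?_
    filter_upwards [lt_mem_nhds hs] with r hr
    rw [h.resolvent_apply hν hr, hx]
  have hA : A x = (ν : ℂ) • (x : X) - f := by rw [← hxf]; abel
  rw [map_sub, h1.unique h2, h.deriv_apply_domain x hs, hA, map_sub, map_smul, map_smul,
    h.resolvent_apply hν hs, hx]
  abel

/-- For `x = R μ f`, the derivative of `e^(-μr) T(r)x` is `-e^(-μr) T(r)f`; integrate it from `s` to
infinity. -/
theorem exp_smul_apply_resolvent [CompleteSpace X] (h : IsLaplaceFamily A R T T' K) {μ s : ℝ}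
    (hμ : 0 < μ)
    (hs : 0 < s) (f : X) :
    Real.exp (-(μ * s)) • T s (R μ f) = ∫ r in Set.Ioi s, Real.exp (-(μ * r)) • T r f := by
  obtain ⟨x, hx, hxf⟩ := h.right μ hμ f
  have hA : A x = (μ : ℂ) • (x : X) - f := by rw [← hxf]; abel
  have hd : ∀ r ∈ Set.Ici s, HasDerivAt (fun r => Real.exp (-(μ * r)) • T r (x : X))
      (-(Real.exp (-(μ * r)) • T r f)) r := by
    intro r hr
    have hr0 : 0 < r := lt_of_lt_of_le hs hr
    have h1 := hasDerivAt_exp_neg_mul μ r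
    refine (h1.smul (h.hasDeriv r hr0 x)).congr_deriv ?_
    rw [h.deriv_apply_domain x hr0, hA, map_sub, map_smul, Complex.coe_smul, smul_sub, smul_smul,
      mul_neg, neg_smul]
    abel
  have hT : Tendsto (fun r => Real.exp (-(μ * r)) • T r (x : X)) atTop (𝓝 0) := by
    refine squeeze_zero_norm' (a := fun r => Real.exp (-(μ * r)) * (K * ‖(x : X)‖)) ?_ ?_
    · filter_upwards [eventually_gt_atTop 0] with r hr
      rw [norm_smul, Real.norm_of_nonneg (Real.exp_pos _).le]
      gcongr
      exact h.norm_apply_le hr _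
    · have h2 := (Real.tendsto_exp_neg_atTop_nhds_zero.comp
        (tendsto_id.const_mul_atTop hμ)).mul_const (K * ‖(x : X)‖)
      rw [zero_mul] at h2
      exact h2
  have hi : IntegrableOn (fun r => Real.exp (-(μ * r)) • T r f) (Set.Ioi s) :=
    (h.integrableOn_exp_smul hμ f).mono_set (Set.Ioi_subset_Ioi hs.le)
  have hI := integral_Ioi_of_hasDerivAt_of_tendsto' hd hi.neg hT
  rw [integral_neg, zero_sub, neg_inj] at hI
  rw [hI, hx]

/-- Compare Laplace transforms in `r`: that of `T s (T r f)` is `T s (R μ f)`, and that of the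
translate is the tail integral computed in `exp_smul_apply_resolvent`. -/
theorem semigroup [CompleteSpace X] (h : IsLaplaceFamily A R T T' K) {s r : ℝ} (hs : 0 < s)
    (hr : 0 < r) (f : X) :
    T s (T r f) = T (s + r) f := by
  have hsh : ContinuousOn (fun r => T (s + r) f) (Set.Ioi 0) :=
    (h.continuousOn f).comp (by fun_prop) fun r hr => add_pos hs hr
  have hc : ContinuousOn (fun r => T s (T r f) - T (s + r) f) (Set.Ioi 0) :=
    ((T s).continuous.comp_continuousOn (h.continuousOn f)).sub hsh
  have heq : ∀ μ : ℝ, (fun r : ℝ => Real.exp (-(μ * r)) • (T s (T r f) - T (s + r) f)) =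
      fun r => T s (Real.exp (-(μ * r)) • T r f) - Real.exp (-(μ * r)) • T (s + r) f := by
    intro μ; ext s; simp only [smul_sub, ContinuousLinearMap.map_smul_of_tower]
  have hi2 : ∀ μ : ℝ, 0 < μ → IntegrableOn (fun r => Real.exp (-(μ * r)) • T (s + r) f)
      (Set.Ioi 0) := by
    intro μ hμ
    have he : IntegrableOn (fun r : ℝ => Real.exp (-(μ * r)) * (K * ‖f‖)) (Set.Ioi 0) :=
      Integrable.mul_const (integrableOn_exp_neg_mul hμ) _
    have hce : ContinuousOn (fun s : ℝ => Real.exp (-(μ * s))) (Set.Ioi 0) := by fun_prop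
    refine Integrable.mono' he ((hce.smul hsh).aestronglyMeasurable measurableSet_Ioi) ?_
    filter_upwards [ae_restrict_mem measurableSet_Ioi] with r hr
    rw [norm_smul, Real.norm_of_nonneg (Real.exp_pos _).le]
    gcongr
    exact h.norm_apply_le (add_pos hs hr) f
  refine sub_eq_zero.1 (eq_zero_of_laplace_eq_zero hc (fun μ hμ => ?_) (fun μ hμ => ?_) hr)
  · rw [heq]
    exact ((T s).integrable_comp (h.integrableOn_exp_smul hμ f)).sub (hi2 μ hμ)
  · rw [heq, integral_sub ((T s).integrable_comp (h.integrableOn_exp_smul hμ f)) (hi2 μ hμ),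
      (T s).integral_comp_comm (h.integrableOn_exp_smul hμ f), h.laplace μ hμ, sub_eq_zero]
    have h1 := h.exp_smul_apply_resolvent hμ hs f
    have h2 : ∫ r in Set.Ioi s, Real.exp (-(μ * r)) • T r f =
        Real.exp (-(μ * s)) • ∫ r in Set.Ioi (0 : ℝ), Real.exp (-(μ * r)) • T (s + r) f := by
      rw [← integral_smul, ← integral_indicator measurableSet_Ioi,
        ← integral_indicator measurableSet_Ioi,
        ← integral_add_left_eq_self _ s]
      refine integral_congr_ae (Eventually.of_forall fun r => ?_)
      by_cases hr : 0 < r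
      · simp only [Set.indicator, Set.mem_Ioi, hr, lt_add_iff_pos_right, if_true, smul_smul,
          ← Real.exp_add]
        congr 2; ring
      · simp only [Set.indicator, Set.mem_Ioi, hr, lt_add_iff_pos_right, if_false]
    rw [h2] at h1
    exact smul_right_injective X (Real.exp_pos _).ne' h1

end IsLaplaceFamily

/-! ### A convolution identity by iterated substitution. -/

theorem aestronglyMeasurable_prod_Ioi {E : Type*} [NormedAddCommGroup E] {F : ℝ × ℝ → E}
    (hF : ContinuousOn F (Set.Ioi 0 ×ˢ Set.Ioi 0)) : AEStronglyMeasurable F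
      ((volume.restrict (Set.Ioi 0)).prod (volume.restrict (Set.Ioi 0))) := by
  rw [Measure.prod_restrict]
  exact hF.aestronglyMeasurable (measurableSet_Ioi.prod measurableSet_Ioi)

theorem integrableOn_rpow_mul_exp_neg_mul {a r : ℝ} (ha : 0 < a) (hr : 0 < r) :
    IntegrableOn (fun t : ℝ => t ^ (a - 1) * Real.exp (-(r * t))) (Set.Ioi 0) := by
  have h := integrableOn_rpow_mul_exp_neg_mul_rpow (p := 1) (s := a - 1) (b := r)
    (by linarith) one_pos hr
  exact h.congr_fun (fun q _ => by simp) measurableSet_Ioi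

section Convolution

variable {E : Type*} [NormedAddCommGroup E] [NormedSpace ℝ E] {G : ℝ → E} {C σ y : ℝ}

/-- The substitution `r = s v`. -/
theorem integral_rpow_smul_comp_add {s : ℝ} (hs : 0 < s) :
    (s ^ (σ - 2) * Real.exp (-(y / s))) • ∫ r in Set.Ioi (0 : ℝ), r ^ (-σ) • G (s + r) =
      ∫ v in Set.Ioi (0 : ℝ), ((s ^ (-1 : ℝ) * Real.exp (-(y / s))) * v ^ (-σ)) •
        G (s * (1 + v)) := by
  have h := integral_comp_mul_left_Ioi (fun r => r ^ (-σ) • G (s + r)) 0 hs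
  rw [mul_zero, eq_inv_smul_iff₀ hs.ne'] at h
  rw [← h, smul_smul, ← integral_smul]
  refine setIntegral_congr_fun measurableSet_Ioi fun v hv => ?_
  have hv : (0 : ℝ) < v := hv
  rw [smul_smul, Real.mul_rpow hs.le hv.le, mul_one_add]
  congr 1
  have e : s ^ (-1 : ℝ) = s ^ (σ - 2) * s * s ^ (-σ) := by
    nth_rewrite 3 [← Real.rpow_one s]
    rw [← Real.rpow_add hs, ← Real.rpow_add hs]; congr 1; ring
  rw [e]; ring

/-- The substitution `p = s (1 + v)` for fixed `v`. -/
theorem integral_exp_smul_comp_mul {v : ℝ} (hv : 0 < v) :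
    ∫ s in Set.Ioi (0 : ℝ), ((s ^ (-1 : ℝ) * Real.exp (-(y / s))) * v ^ (-σ)) • G (s * (1 + v)) =
      ∫ p in Set.Ioi (0 : ℝ), (v ^ (-σ) * (p ^ (-1 : ℝ) * Real.exp (-(y * (1 + v) / p)))) • G p :=
        by
  have hv1 : 0 < 1 + v := by linarith
  have h := integral_comp_mul_left_Ioi (fun p : ℝ =>
    (v ^ (-σ) * (p ^ (-1 : ℝ) * Real.exp (-(y * (1 + v) / p)))) • G p) 0 hv1
  rw [mul_zero, eq_inv_smul_iff₀ hv1.ne'] at h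
  rw [← h, ← integral_smul]
  refine setIntegral_congr_fun measurableSet_Ioi fun s hs => ?_
  have hs : (0 : ℝ) < s := hs
  rw [smul_smul, mul_comm s (1 + v)]
  congr 1
  have e : y * (1 + v) / ((1 + v) * s) = y / s := by field_simp
  rw [e, Real.rpow_neg_one, Real.rpow_neg_one]
  field_simp

/-- The Beta-type convolution identity behind the composition of a fractional integral with the
subordination formula. -/
theorem integral_convolution_eq [CompleteSpace E] (hc : ContinuousOn G (Set.Ioi 0))
    (hG : ∀ p : ℝ, 0 < p → ‖G p‖ ≤ C / p) (hσ0 : 0 < σ) (hσ1 : σ < 1) (hy : 0 < y) :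
    ∫ s in Set.Ioi (0 : ℝ), (s ^ (σ - 2) * Real.exp (-(y / s))) •
        ∫ r in Set.Ioi (0 : ℝ), r ^ (-σ) • G (s + r) =
      (Real.Gamma (1 - σ) * y ^ (σ - 1)) •
        ∫ p in Set.Ioi (0 : ℝ), (p ^ (-σ) * Real.exp (-(y / p))) • G p := by
  have hrp : ∀ a : ℝ, ContinuousOn (fun q : ℝ => q ^ a) (Set.Ioi 0) := fun a =>
    continuousOn_id.rpow_const fun q hq => Or.inl (ne_of_gt hq)
  have hfst : Set.MapsTo (Prod.fst : ℝ × ℝ → ℝ) (Set.Ioi 0 ×ˢ Set.Ioi 0) (Set.Ioi 0) :=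
    fun q hq => hq.1
  have hsnd : Set.MapsTo (Prod.snd : ℝ × ℝ → ℝ) (Set.Ioi 0 ×ˢ Set.Ioi 0) (Set.Ioi 0) :=
    fun q hq => hq.2
  -- The bound `‖G p‖ ≤ C / p` at `p = s (1 + v)` gives a majorant that is a product of a function
  -- of `s` and a function of `v`.
  have hi1 : Integrable (Function.uncurry fun s v : ℝ =>
      ((s ^ (-1 : ℝ) * Real.exp (-(y / s))) * v ^ (-σ)) • G (s * (1 + v)))
      ((volume.restrict (Set.Ioi 0)).prod (volume.restrict (Set.Ioi 0))) := by
    have hb := ((integrableOn_rpow_mul_exp_neg_div (b := 1) one_pos hy).mul_prod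
      (integrableOn_rpow_mul_one_add_rpow (p := -σ) (q := 1) (by linarith)
        (by linarith))).const_mul C
    refine Integrable.mono' hb (aestronglyMeasurable_prod_Ioi ?_) ?_
    · refine ContinuousOn.smul (ContinuousOn.mul (ContinuousOn.mul
        ((hrp _).comp continuousOn_fst hfst) ?_) ((hrp _).comp continuousOn_snd hsnd))
        (hc.comp (by fun_prop) fun q hq =>
          Set.mem_Ioi.2 (mul_pos hq.1 (add_pos one_pos hq.2)))
      exact (continuousOn_const.div continuousOn_fst fun q hq => ne_of_gt hq.1).neg.rexp
    · rw [Measure.prod_restrict]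
      filter_upwards [ae_restrict_mem (measurableSet_Ioi.prod measurableSet_Ioi)] with q hq
      obtain ⟨s, v⟩ := q
      have hs : (0 : ℝ) < s := hq.1
      have hv : (0 : ℝ) < v := hq.2
      simp only [Function.uncurry]
      rw [norm_smul, Real.norm_of_nonneg (by positivity)]
      calc _ ≤ ((s ^ (-1 : ℝ) * Real.exp (-(y / s))) * v ^ (-σ)) * (C / (s * (1 + v))) := by
            gcongr
            exact hG _ (by positivity)
        _ = _ := by
            rw [show (-1 : ℝ) - 1 = -1 + -1 by norm_num, Real.rpow_add hs, Real.rpow_neg_one,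
              Real.rpow_neg_one]
            field_simp
  have hexp : ∀ v p : ℝ, Real.exp (-(y * (1 + v) / p)) =
      Real.exp (-(y / p)) * Real.exp (-(y / p * v)) := by
    intro v p; rw [← Real.exp_add]; congr 1; ring
  -- The `v`-integral is a Gamma integral of order `1 - σ` and rate `y/p`; it is the source of the
  -- constant and of the new weight `p^(-σ) e^(-y/p)`.
  have hsc : ∀ p : ℝ, 0 < p → ∫ v in Set.Ioi (0 : ℝ),
      v ^ (-σ) * (p ^ (-1 : ℝ) * Real.exp (-(y * (1 + v) / p))) =
      Real.Gamma (1 - σ) * y ^ (σ - 1) * (p ^ (-σ) * Real.exp (-(y / p))) := by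
    intro p hp
    have h1 := Real.integral_rpow_mul_exp_neg_mul_Ioi (a := 1 - σ) (by linarith) (div_pos hy hp)
    have h2 : ∀ v : ℝ, v ^ (-σ) * (p ^ (-1 : ℝ) * Real.exp (-(y * (1 + v) / p))) =
        p ^ (-1 : ℝ) * Real.exp (-(y / p)) * (v ^ (1 - σ - 1) * Real.exp (-(y / p * v))) := by
      intro v; rw [hexp, show 1 - σ - 1 = -σ by ring]; ring
    simp_rw [h2]
    rw [integral_const_mul, h1, one_div_div, Real.div_rpow hp.le hy.le, ← neg_sub 1 σ,
      Real.rpow_neg hy.le, show -σ = -1 + (1 - σ) by ring, Real.rpow_add hp (-1)]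
    field_simp
  have hi2 : Integrable (Function.uncurry fun v p : ℝ =>
      (v ^ (-σ) * (p ^ (-1 : ℝ) * Real.exp (-(y * (1 + v) / p)))) • G p)
      ((volume.restrict (Set.Ioi 0)).prod (volume.restrict (Set.Ioi 0))) := by
    refine (integrable_prod_iff' (aestronglyMeasurable_prod_Ioi ?_)).2 ⟨?_, ?_⟩
    · refine ContinuousOn.smul (ContinuousOn.mul ((hrp _).comp continuousOn_fst hfst)
        (ContinuousOn.mul ((hrp _).comp continuousOn_snd hsnd) ?_)) (hc.comp continuousOn_snd hsnd)
      exact (ContinuousOn.div (by fun_prop) continuousOn_snd fun q hq => ne_of_gt hq.2).neg.rexp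
    · filter_upwards [ae_restrict_mem measurableSet_Ioi] with p hp
      have hp : (0 : ℝ) < p := hp
      simp only [Function.uncurry_apply_pair]
      refine Integrable.smul_const (f := fun v : ℝ =>
        v ^ (-σ) * (p ^ (-1 : ℝ) * Real.exp (-(y * (1 + v) / p)))) ?_ _
      have := (integrableOn_rpow_mul_exp_neg_mul (a := 1 - σ) (by linarith)
        (div_pos hy hp)).mul_const (p ^ (-1 : ℝ) * Real.exp (-(y / p)))
      refine this.congr (Eventually.of_forall fun v => ?_)
      simp only [hexp]
      rw [show 1 - σ - 1 = -σ by ring]; ring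
    · have hb := (integrableOn_rpow_mul_exp_neg_div (b := σ) hσ0 hy).mul_const
        (Real.Gamma (1 - σ) * y ^ (σ - 1) * C)
      refine Integrable.congr (f := fun p => (Real.Gamma (1 - σ) * y ^ (σ - 1)) *
          (p ^ (-σ) * Real.exp (-(y / p))) * ‖G p‖) ?_ ?_
      · refine Integrable.mono' hb (ContinuousOn.aestronglyMeasurable ?_ measurableSet_Ioi) ?_
        · refine (continuousOn_const.mul ((hrp _).mul ?_)).mul hc.norm
          exact (continuousOn_const.div continuousOn_id fun q hq => ne_of_gt hq).neg.rexp
        · filter_upwards [ae_restrict_mem measurableSet_Ioi] with p hp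
          have hp : (0 : ℝ) < p := hp
          have hg : 0 < Real.Gamma (1 - σ) := Real.Gamma_pos_of_pos (by linarith)
          rw [Real.norm_of_nonneg (by positivity)]
          calc _ ≤ (Real.Gamma (1 - σ) * y ^ (σ - 1)) * (p ^ (-σ) * Real.exp (-(y / p))) *
                (C / p) := by gcongr; exact hG p hp
            _ = _ := by
              rw [sub_eq_add_neg (-σ) 1, Real.rpow_add hp, Real.rpow_neg_one]
              field_simp
      · filter_upwards [ae_restrict_mem measurableSet_Ioi] with p hp
        have hp : (0 : ℝ) < p := hp
        rw [← hsc p hp, ← integral_mul_const]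
        refine setIntegral_congr_fun measurableSet_Ioi fun v hv => ?_
        have hv : (0 : ℝ) < v := hv
        simp only [Function.uncurry]
        rw [norm_smul, Real.norm_of_nonneg (by positivity)]
  rw [setIntegral_congr_fun measurableSet_Ioi
    (fun s hs => integral_rpow_smul_comp_add (G := G) (y := y) hs), integral_integral_swap hi1,
    setIntegral_congr_fun measurableSet_Ioi
    (fun v hv => integral_exp_smul_comp_mul (G := G) (σ := σ) (y := y) hv),
    integral_integral_swap hi2, ← integral_smul]
  refine setIntegral_congr_fun measurableSet_Ioi fun p hp => ?_
  have hp : (0 : ℝ) < p := hp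
  rw [integral_smul_const, smul_smul, hsc p hp]

end Convolution

/-! ### Fractional powers and subordination in terms of the family `T`. -/

namespace IsLaplaceFamily

variable {X : Type*} [NormedAddCommGroup X] [NormedSpace ℂ X]
  {A : X →ₗ.[ℂ] X} {R T T' : ℝ → X →L[ℂ] X} {K σ : ℝ}

theorem norm_apply_map_le_rpow [CompleteSpace X] (h : IsLaplaceFamily A R T T' K) (x : A.domain)
    {s : ℝ} (hs : 0 < s) :
    ‖T s (A x)‖ ≤ K * (‖(x : X)‖ + ‖A x‖) * (1 + s) ^ (-1 : ℝ) := by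
  have h1 := h.norm_apply_le hs (A x)
  have h2 := h.norm_apply_map_le x hs
  rw [div_mul_eq_mul_div, le_div_iff₀ hs] at h2
  rw [Real.rpow_neg_one, ← div_eq_mul_inv, le_div_iff₀ (by linarith)]
  linarith

theorem integrableOn_rpow_smul_apply_map [CompleteSpace X] (h : IsLaplaceFamily A R T T' K)
    (hσ0 : 0 < σ) (hσ1 : σ < 1) (x : A.domain) :
    IntegrableOn (fun s => s ^ (-σ) • T s (A x)) (Set.Ioi 0) := by
  have hb := (integrableOn_rpow_mul_one_add_rpow (p := -σ) (q := 1) (by linarith)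
    (by linarith)).mul_const (K * (‖(x : X)‖ + ‖A x‖))
  refine Integrable.mono' hb (ContinuousOn.aestronglyMeasurable ?_ measurableSet_Ioi) ?_
  · exact (continuousOn_id.rpow_const fun q hq => Or.inl (ne_of_gt hq)).smul (h.continuousOn _)
  · filter_upwards [ae_restrict_mem measurableSet_Ioi] with s hs
    have hs : (0 : ℝ) < s := hs
    rw [norm_smul, Real.norm_of_nonneg (by positivity), mul_assoc, mul_comm ((1 + s) ^ _)]
    gcongr
    exact h.norm_apply_map_le_rpow x hs

/-- Insert `R μ = ∫ e^(-μs) T(s) ds` and integrate in `μ` first: `∫ μ^(σ-1) e^(-μs) dμ = Γ(σ)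
s^(-σ)`. This rewrites the Balakrishnan integral by means of `T`. -/
theorem integral_rpow_smul_resolvent [CompleteSpace X] (h : IsLaplaceFamily A R T T' K)
    (hσ0 : 0 < σ) (hσ1 : σ < 1) (x : A.domain) :
    ∫ μ in Set.Ioi (0 : ℝ), μ ^ (σ - 1) • R μ (A x) =
      Real.Gamma σ • ∫ s in Set.Ioi (0 : ℝ), s ^ (-σ) • T s (A x) := by
  have hg := Real.Gamma_pos_of_pos hσ0
  have hsc : ∀ s : ℝ, 0 < s → ∫ μ in Set.Ioi (0 : ℝ), μ ^ (σ - 1) * Real.exp (-(μ * s)) =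
      Real.Gamma σ * s ^ (-σ) := by
    intro s hs
    have h1 := Real.integral_rpow_mul_exp_neg_mul_Ioi hσ0 hs
    simp_rw [mul_comm s] at h1
    rw [h1, one_div, Real.inv_rpow hs.le, Real.rpow_neg hs.le, mul_comm]
  have hi : Integrable (Function.uncurry fun μ s : ℝ =>
      (μ ^ (σ - 1) * Real.exp (-(μ * s))) • T s (A x))
      ((volume.restrict (Set.Ioi 0)).prod (volume.restrict (Set.Ioi 0))) := by
    refine (integrable_prod_iff' (aestronglyMeasurable_prod_Ioi ?_)).2 ⟨?_, ?_⟩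
    · have hw : ContinuousOn (fun q : ℝ × ℝ => q.1 ^ (σ - 1) * Real.exp (-(q.1 * q.2)))
          (Set.Ioi 0 ×ˢ Set.Ioi 0) :=
        (continuousOn_fst.rpow_const fun q hq => Or.inl (ne_of_gt hq.1)).mul (by fun_prop)
      exact hw.smul ((h.continuousOn _).comp continuousOn_snd fun q hq => hq.2)
    · filter_upwards [ae_restrict_mem measurableSet_Ioi] with s hs
      simp only [Function.uncurry_apply_pair]
      refine Integrable.smul_const (f := fun μ : ℝ => μ ^ (σ - 1) * Real.exp (-(μ * s))) ?_ _
      have h1 := integrableOn_rpow_mul_exp_neg_mul hσ0 hs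
      simp only [mul_comm s] at h1
      exact h1
    · refine ((h.integrableOn_rpow_smul_apply_map hσ0 hσ1 x).norm.const_mul (Real.Gamma σ)).congr ?_
      filter_upwards [ae_restrict_mem measurableSet_Ioi] with s hs
      have hs : (0 : ℝ) < s := hs
      rw [norm_smul, Real.norm_of_nonneg (by positivity), ← mul_assoc, ← hsc s hs,
        ← integral_mul_const]
      refine setIntegral_congr_fun measurableSet_Ioi fun μ hμ => ?_
      have hμ : (0 : ℝ) < μ := hμ
      simp only [Function.uncurry]
      rw [norm_smul, Real.norm_of_nonneg (by positivity)]
  calc ∫ μ in Set.Ioi (0 : ℝ), μ ^ (σ - 1) • R μ (A x)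
      = ∫ μ in Set.Ioi (0 : ℝ), ∫ s in Set.Ioi (0 : ℝ),
          (μ ^ (σ - 1) * Real.exp (-(μ * s))) • T s (A x) := by
        refine setIntegral_congr_fun measurableSet_Ioi fun μ hμ => ?_
        simp only [← h.laplace μ hμ, ← smul_smul]
        rw [integral_smul]
    _ = _ := by
        rw [integral_integral_swap hi, ← integral_smul]
        refine setIntegral_congr_fun measurableSet_Ioi fun s hs => ?_
        simp only [integral_smul_const, hsc s hs, smul_smul]

/-- By the semigroup law `T s` acts on the inner integral as a translation, so this is the
convolution identity for `G = T(·)(A x)`. -/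
theorem integral_exp_smul_apply_integral [CompleteSpace X] (h : IsLaplaceFamily A R T T' K)
    (hσ0 : 0 < σ) (hσ1 : σ < 1) (x : A.domain) {y : ℝ} (hy : 0 < y) :
    ∫ s in Set.Ioi (0 : ℝ), (s ^ (σ - 2) * Real.exp (-(y / s))) •
        T s (∫ r in Set.Ioi (0 : ℝ), r ^ (-σ) • T r (A x)) =
      (Real.Gamma (1 - σ) * y ^ (σ - 1)) •
        ∫ p in Set.Ioi (0 : ℝ), (p ^ (-σ) * Real.exp (-(y / p))) • T p (A x) := by
  rw [← integral_convolution_eq (C := K * ‖(x : X)‖) (h.continuousOn (A x)) (fun p hp => ?_)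
    hσ0 hσ1 hy]
  · refine setIntegral_congr_fun measurableSet_Ioi fun s hs => ?_
    rw [← (T s).integral_comp_comm (h.integrableOn_rpow_smul_apply_map hσ0 hσ1 x)]
    congr 1
    refine setIntegral_congr_fun measurableSet_Ioi fun r hr => ?_
    simp only [ContinuousLinearMap.map_smul_of_tower]
    rw [h.semigroup hs hr]
  · rw [← div_mul_eq_mul_div]
    exact h.norm_apply_map_le x hp

theorem apply_eq_add_integral_unit [CompleteSpace X] (h : IsLaplaceFamily A R T T' K)
    (x : A.domain) {s : ℝ} (hs : 0 < s) :
    T s x = x + s • ∫ r in Set.Ioc (0 : ℝ) 1, T (r * s) (A x) := by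
  rw [h.apply_eq_add_integral x hs, ← intervalIntegral.integral_of_le zero_le_one,
    intervalIntegral.smul_integral_comp_mul_right (fun r => T r (A x)) s, zero_mul, one_mul]

/-- The subordinated family started at `x ∈ D(A)`. -/
theorem integral_subordination_eq [CompleteSpace X] (h : IsLaplaceFamily A R T T' K)
    (hσ0 : 0 < σ) (hσ1 : σ < 1) (x : A.domain) {c : ℝ} (hc : 0 < c) :
    ∫ s in Set.Ioi (0 : ℝ), (s ^ (-σ - 1) * Real.exp (-(c / s))) • T s x =
      (Real.Gamma σ * c ^ (-σ)) • (x : X) + ∫ r in Set.Ioc (0 : ℝ) 1, r ^ (σ - 1) •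
        ∫ p in Set.Ioi (0 : ℝ), (p ^ (-σ) * Real.exp (-(r * c / p))) • T p (A x) := by
  set D := K * (‖(x : X)‖ + ‖A x‖) with hD
  have hi : Integrable (Function.uncurry fun s r : ℝ =>
      (s ^ (-σ) * Real.exp (-(c / s))) • T (r * s) (A x))
      ((volume.restrict (Set.Ioi 0)).prod (volume.restrict (Set.Ioc 0 1))) := by
    -- In the estimate `(1 + rs)^(-1) ≤ (rs)^(-θ)`, any `θ` strictly between `1 - σ` and `1` makes
    -- the majorant integrable both in `r` near `0` and in `s` near infinity; `θ = 1 - σ/2` is one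
    -- choice.
    have hr : IntegrableOn (fun r : ℝ => r ^ (-(1 - σ / 2))) (Set.Ioc 0 1) :=
      (intervalIntegrable_iff_integrableOn_Ioc_of_le zero_le_one).1
        (intervalIntegral.intervalIntegrable_rpow' (by linarith))
    have hb := ((integrableOn_rpow_mul_exp_neg_div (b := σ / 2) (by linarith) hc).mul_prod
      hr).const_mul D
    refine Integrable.mono' hb ?_ ?_
    · rw [Measure.prod_restrict]
      refine ContinuousOn.aestronglyMeasurable ?_ (measurableSet_Ioi.prod measurableSet_Ioc)
      have hw : ContinuousOn (fun q : ℝ × ℝ => q.1 ^ (-σ) * Real.exp (-(c / q.1)))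
          (Set.Ioi 0 ×ˢ Set.Ioc 0 1) :=
        (continuousOn_fst.rpow_const fun q hq => Or.inl (ne_of_gt hq.1)).mul
          (continuousOn_const.div continuousOn_fst fun q hq => ne_of_gt hq.1).neg.rexp
      exact hw.smul ((h.continuousOn _).comp (by fun_prop)
        fun q hq => Set.mem_Ioi.2 (mul_pos hq.2.1 hq.1))
    · rw [Measure.prod_restrict]
      filter_upwards [ae_restrict_mem (measurableSet_Ioi.prod measurableSet_Ioc)] with q hq
      obtain ⟨s, r⟩ := q
      have hs : (0 : ℝ) < s := hq.1
      have hr : (0 : ℝ) < r := hq.2.1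
      have hD0 : 0 ≤ D := by
        have h1 := (norm_nonneg _).trans (h.norm_apply_map_le_rpow x hs)
        exact nonneg_of_mul_nonneg_left h1 (by positivity)
      have h2 : (1 + r * s) ^ (-1 : ℝ) ≤ (r * s) ^ (-(1 - σ / 2)) :=
        calc (1 + r * s) ^ (-1 : ℝ) ≤ (1 + r * s) ^ (-(1 - σ / 2)) :=
              Real.rpow_le_rpow_of_exponent_le (by nlinarith [mul_pos hr hs]) (by linarith)
          _ ≤ _ := Real.rpow_le_rpow_of_nonpos (by positivity) (by linarith) (by linarith)
      simp only [Function.uncurry]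
      rw [norm_smul, Real.norm_of_nonneg (by positivity)]
      calc _ ≤ (s ^ (-σ) * Real.exp (-(c / s))) * (D * (1 + r * s) ^ (-1 : ℝ)) := by
            gcongr
            exact h.norm_apply_map_le_rpow x (mul_pos hr hs)
        _ ≤ (s ^ (-σ) * Real.exp (-(c / s))) * (D * (r * s) ^ (-(1 - σ / 2))) := by gcongr
        _ = _ := by
            rw [Real.mul_rpow hr.le hs.le, show -(σ / 2) - 1 = -σ + -(1 - σ / 2) by ring,
              Real.rpow_add hs]
            ring
  have hb0 := integrableOn_rpow_mul_exp_neg_div hσ0 hc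
  have hi' : IntegrableOn (fun s : ℝ => ∫ r in Set.Ioc (0 : ℝ) 1,
      (s ^ (-σ) * Real.exp (-(c / s))) • T (r * s) (A x)) (Set.Ioi 0) := hi.integral_prod_left
  calc ∫ s in Set.Ioi (0 : ℝ), (s ^ (-σ - 1) * Real.exp (-(c / s))) • T s x
      = ∫ s in Set.Ioi (0 : ℝ), ((s ^ (-σ - 1) * Real.exp (-(c / s))) • (x : X) +
          ∫ r in Set.Ioc (0 : ℝ) 1, (s ^ (-σ) * Real.exp (-(c / s))) • T (r * s) (A x)) := by
        refine setIntegral_congr_fun measurableSet_Ioi fun s hs => ?_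
        have hs : (0 : ℝ) < s := hs
        rw [h.apply_eq_add_integral_unit x hs, smul_add, smul_smul, integral_smul, sub_eq_add_neg,
          Real.rpow_add hs, Real.rpow_neg_one]
        congr 2
        field_simp
    _ = _ := by
        rw [integral_add (hb0.smul_const _) hi', integral_smul_const,
          integral_rpow_mul_exp_neg_div hσ0 hc, integral_integral_swap hi]
        congr 1
        refine setIntegral_congr_fun measurableSet_Ioc fun r hr => ?_
        have hr : (0 : ℝ) < r := hr.1
        have h1 := integral_comp_mul_left_Ioi (fun p : ℝ =>
          (p ^ (-σ) * Real.exp (-(r * c / p))) • T p (A x)) 0 hr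
        rw [mul_zero, eq_inv_smul_iff₀ hr.ne'] at h1
        rw [← h1, smul_smul, ← integral_smul]
        refine setIntegral_congr_fun measurableSet_Ioi fun s hs => ?_
        have hs : (0 : ℝ) < s := hs
        rw [smul_smul, Real.mul_rpow hr.le hs.le, mul_div_mul_left _ _ hr.ne',
          show r ^ (σ - 1) * r * (r ^ (-σ) * s ^ (-σ) * Real.exp (-(c / s))) =
            (r ^ (σ - 1) * r * r ^ (-σ)) * (s ^ (-σ) * Real.exp (-(c / s))) by ring,
          show r ^ (σ - 1) * r * r ^ (-σ) = 1 by
            nth_rewrite 2 [← Real.rpow_one r]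
            rw [← Real.rpow_add hr, ← Real.rpow_add hr]; simp, one_mul]

end IsLaplaceFamily

/-! ### Differentiation of Weyl integrals. -/

theorem integral_comp_add_left_Ioi {E : Type*} [NormedAddCommGroup E] [NormedSpace ℝ E]
    (g : ℝ → E) (s : ℝ) : ∫ r in Set.Ioi (0 : ℝ), g (s + r) = ∫ t in Set.Ioi s, g t := by
  rw [← integral_indicator measurableSet_Ioi, ← integral_indicator measurableSet_Ioi,
    ← integral_add_left_eq_self ((Set.Ioi s).indicator g) s]
  refine integral_congr_ae (Eventually.of_forall fun r => ?_)
  simp only [Set.indicator, Set.mem_Ioi, lt_add_iff_pos_right]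

section Weyl

variable {φ : ℕ → ℝ → ℂ} {n : ℕ} {b β : ℝ}

theorem integrableOn_rpow_mul_comp_add (hβ0 : 0 < β) (hβ1 : β ≤ 1) (hb : 1 < b) {ψ : ℝ → ℂ}
    (hc : ContinuousOn ψ (Set.Ioi 0))
    (hψ : ∀ δ : ℝ, 0 < δ → ∃ K : ℝ, ∀ t : ℝ, δ ≤ t → ‖ψ t‖ ≤ K * t ^ (-b)) {s : ℝ} (hs : 0 < s) :
    IntegrableOn (fun r : ℝ => ((r ^ (β - 1) : ℝ) : ℂ) * ψ (s + r)) (Set.Ioi 0) := by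
  obtain ⟨K, hK⟩ := hψ s hs
  refine Integrable.mono' ((integrableOn_rpow_mul_add_rpow (p := β - 1) (q := b) hs (by linarith)
    (by linarith)).const_mul K) ?_ ?_
  · refine ContinuousOn.aestronglyMeasurable (ContinuousOn.mul ?_ ?_) measurableSet_Ioi
    · exact Complex.continuous_ofReal.comp_continuousOn
        (continuousOn_id.rpow_const fun q hq => Or.inl (ne_of_gt hq))
    · exact hc.comp (by fun_prop) fun r hr => add_pos hs hr
  · filter_upwards [ae_restrict_mem measurableSet_Ioi] with r hr
    have hr : (0 : ℝ) < r := hr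
    rw [norm_mul, Complex.norm_real, Real.norm_of_nonneg (by positivity), mul_left_comm]
    gcongr
    exact hK _ (by linarith)

theorem hasDerivAt_integral_rpow_mul_comp_add (hβ0 : 0 < β) (hβ1 : β ≤ 1) (hb : 1 < b)
    {ψ ψ' : ℝ → ℂ} (hd : ∀ t : ℝ, 0 < t → HasDerivAt ψ (ψ' t) t)
    (hc : ContinuousOn ψ' (Set.Ioi 0))
    (hψ : ∀ δ : ℝ, 0 < δ → ∃ K : ℝ, ∀ t : ℝ, δ ≤ t → ‖ψ t‖ ≤ K * t ^ (-b))
    (hψ' : ∀ δ : ℝ, 0 < δ → ∃ K : ℝ, ∀ t : ℝ, δ ≤ t → ‖ψ' t‖ ≤ K * t ^ (-b))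
    {s : ℝ} (hs : 0 < s) :
    HasDerivAt (fun s : ℝ => ∫ r in Set.Ioi (0 : ℝ), ((r ^ (β - 1) : ℝ) : ℂ) * ψ (s + r))
      (∫ r in Set.Ioi (0 : ℝ), ((r ^ (β - 1) : ℝ) : ℂ) * ψ' (s + r)) s := by
  have hcψ : ContinuousOn ψ (Set.Ioi 0) := fun t ht => (hd t ht).continuousAt.continuousWithinAt
  obtain ⟨K, hK⟩ := hψ' (s / 2) (half_pos hs)
  refine (hasDerivAt_integral_of_dominated_loc_of_deriv_le
    (F := fun s r => ((r ^ (β - 1) : ℝ) : ℂ) * ψ (s + r))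
    (F' := fun s r => ((r ^ (β - 1) : ℝ) : ℂ) * ψ' (s + r)) (x₀ := s)
    (bound := fun r => K * (r ^ (β - 1) * (s / 2 + r) ^ (-b))) (s := Set.Ioi (s / 2))
    (Ioi_mem_nhds (by linarith)) ?_ (integrableOn_rpow_mul_comp_add hβ0 hβ1 hb hcψ hψ hs)
    (integrableOn_rpow_mul_comp_add hβ0 hβ1 hb hc hψ' hs).aestronglyMeasurable ?_
    ((integrableOn_rpow_mul_add_rpow (p := β - 1) (q := b) (half_pos hs) (by linarith)
    (by linarith)).const_mul K) ?_).2
  · filter_upwards [lt_mem_nhds hs] with x hx using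
      (integrableOn_rpow_mul_comp_add hβ0 hβ1 hb hcψ hψ hx).aestronglyMeasurable
  · filter_upwards [ae_restrict_mem measurableSet_Ioi] with r hr x hx
    have hr : (0 : ℝ) < r := hr
    have hx : s / 2 < x := hx
    have hK0 : 0 ≤ K := by
      have := (norm_nonneg _).trans (hK (s / 2) le_rfl)
      exact nonneg_of_mul_nonneg_left this (by positivity)
    rw [norm_mul, Complex.norm_real, Real.norm_of_nonneg (by positivity), mul_left_comm]
    gcongr
    refine (hK _ (by linarith)).trans ?_
    gcongr K * ?_
    exact Real.rpow_le_rpow_of_nonpos (by positivity) (by linarith) (by linarith)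
  · filter_upwards [ae_restrict_mem measurableSet_Ioi] with r hr x hx
    have hr : (0 : ℝ) < r := hr
    have hx : s / 2 < x := hx
    have h1 := (hd (x + r) (by linarith)).comp_add_const x r
    exact h1.const_mul _

/-- After the shift `t = s + r` the variable `s` occurs only in the argument of the function, so
derivatives pass under the integral. Only bounds on `t ≥ δ` are needed, and `β ≤ 1 < b` gives
convergence at infinity. -/
theorem iteratedDeriv_weylIntegral (hβ0 : 0 < β) (hβ1 : β ≤ 1) (hb : 1 < b)
    (hd : ∀ j < n, ∀ t : ℝ, 0 < t → HasDerivAt (φ j) (φ (j + 1) t) t)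
    (hc : ContinuousOn (φ n) (Set.Ioi 0))
    (hφ : ∀ j ≤ n, ∀ δ : ℝ, 0 < δ → ∃ K : ℝ, ∀ t : ℝ, δ ≤ t → ‖φ j t‖ ≤ K * t ^ (-b))
    {φ₀ : ℝ → ℂ} (h0 : ∀ t : ℝ, 0 < t → φ₀ t = φ 0 t) {j : ℕ} (hj : j ≤ n) {s : ℝ} (hs : 0 < s) :
    iteratedDeriv j (weylIntegral β φ₀) s = ((1 / Real.Gamma β : ℝ) : ℂ) *
      ∫ r in Set.Ioi (0 : ℝ), ((r ^ (β - 1) : ℝ) : ℂ) * φ j (s + r) := by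
  induction j generalizing s with
  | zero =>
    rw [iteratedDeriv_zero, weylIntegral, ← integral_comp_add_left_Ioi]
    congr 1
    refine setIntegral_congr_fun measurableSet_Ioi fun r hr => ?_
    rw [add_sub_cancel_left, h0 _ (add_pos hs hr)]
  | succ j ih =>
    have hcj : ContinuousOn (φ (j + 1)) (Set.Ioi 0) := by
      rcases hj.eq_or_lt with h | h
      · rwa [h]
      · exact fun t ht => (hd (j + 1) h t ht).continuousAt.continuousWithinAt
    rw [iteratedDeriv_succ]
    have h1 := (hasDerivAt_integral_rpow_mul_comp_add hβ0 hβ1 hb (hd j hj) hcj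
      (hφ j (by omega)) (hφ (j + 1) hj) hs).const_mul ((1 / Real.Gamma β : ℝ) : ℂ)
    refine (h1.congr_of_eventuallyEq ?_).deriv
    filter_upwards [lt_mem_nhds hs] with x hx using ih (by omega) hx

end Weyl

/-! ### Transfer of the fractional integral from the kernel to the family. -/

section Average

variable {X : Type*} [NormedAddCommGroup X] [NormedSpace ℂ X]

/-- Kernel average: `C` is replaced by the bounded family `p^{-(α+β)}` times its fractional
integral of order `β`. -/
theorem exists_average [CompleteSpace X] {α β M : ℝ} (hα : 0 ≤ α) (hβ0 : 0 < β)
    {C : ℝ → X →L[ℂ] X} (hC : ∀ f : X, ContinuousOn (fun t => C t f) (Set.Ioi 0))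
    (hM : ∀ t : ℝ, 0 < t → ‖C t‖ ≤ M * t ^ α) :
    ∃ (B : ℝ → X →L[ℂ] X) (N : ℝ), (∀ p : ℝ, 0 < p → ‖B p‖ ≤ N) ∧
      (∀ f : X, AEStronglyMeasurable (fun p => B p f) (volume.restrict (Set.Ioi 0))) ∧
      ∀ ψ : ℝ → ℂ, ContinuousOn ψ (Set.Ioi 0) →
        IntegrableOn (fun p : ℝ => p ^ (α + β) * ‖ψ p‖) (Set.Ioi 0) → ∀ f : X,
        IntegrableOn (fun s : ℝ => (((1 / Real.Gamma β : ℝ) : ℂ) *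
          ∫ r in Set.Ioi (0 : ℝ), ((r ^ (β - 1) : ℝ) : ℂ) * ψ (s + r)) • C s f) (Set.Ioi 0) ∧
        ∫ s in Set.Ioi (0 : ℝ), (((1 / Real.Gamma β : ℝ) : ℂ) *
          ∫ r in Set.Ioi (0 : ℝ), ((r ^ (β - 1) : ℝ) : ℂ) * ψ (s + r)) • C s f =
          ∫ p in Set.Ioi (0 : ℝ), (((p ^ (α + β) : ℝ) : ℂ) * ψ p) • B p f := by
  have hg := Real.Gamma_pos_of_pos hβ0
  have hM0 : 0 ≤ M := by
    have := (norm_nonneg _).trans (hM 1 one_pos)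
    simpa using this
  -- The substitutions `r = s v`, then `p = s (1 + v)`, turn `r^(β-1) dr ds` into `p^β w(v) dv dp`
  -- with `s = p/(1+v)`. Temperedness adds the factor `p^α (1+v)^(-α)`, so `p^(α+β)` can be split
  -- off with a bounded remainder.
  set w : ℝ → ℝ := fun v => v ^ (β - 1) * (1 + v) ^ (-(β + 1)) with hw
  have hw0 : ∀ v : ℝ, 0 < v → 0 ≤ w v := fun v hv => by positivity
  have hwc : ContinuousOn w (Set.Ioi 0) := by
    refine ContinuousOn.mul (continuousOn_id.rpow_const fun q hq => Or.inl (ne_of_gt hq)) ?_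
    exact ContinuousOn.rpow_const (by fun_prop) fun q hq => Or.inl (by
      have : (0 : ℝ) < q := hq
      positivity)
  have hwi : IntegrableOn (fun v => w v * (1 + v) ^ (-α)) (Set.Ioi 0) := by
    refine (integrableOn_rpow_mul_one_add_rpow (p := β - 1) (q := α + β + 1) (by linarith)
      (by linarith)).congr_fun (fun v hv => ?_) measurableSet_Ioi
    have hv : (0 : ℝ) < v := hv
    simp only [hw]
    rw [mul_assoc, ← Real.rpow_add (by linarith)]
    congr 2; ring
  have hwi1 : IntegrableOn w (Set.Ioi 0) :=
    integrableOn_rpow_mul_one_add_rpow (p := β - 1) (q := β + 1) (by linarith) (by linarith)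
  have hCb : ∀ (f : X) (p v : ℝ), 0 < p → 0 < v →
      ‖C (p / (1 + v)) f‖ ≤ M * p ^ α * (1 + v) ^ (-α) * ‖f‖ := by
    intro f p v hp hv
    refine (C _).le_of_opNorm_le ((hM _ (by positivity)).trans (le_of_eq ?_)) f
    rw [Real.div_rpow hp.le (by positivity), Real.rpow_neg (by positivity)]
    ring
  have hCc : ∀ f : X, ContinuousOn (fun q : ℝ × ℝ => C (q.1 / (1 + q.2)) f)
      (Set.Ioi 0 ×ˢ Set.Ioi 0) := by
    intro f
    refine (hC f).comp (ContinuousOn.div (by fun_prop) (by fun_prop) fun q hq => ?_)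
      fun q hq => ?_
    · have : (0 : ℝ) < q.2 := hq.2
      positivity
    · have h1 : (0 : ℝ) < q.1 := hq.1
      have h2 : (0 : ℝ) < q.2 := hq.2
      exact Set.mem_Ioi.2 (by positivity)
  have hin : ∀ (f : X) (p : ℝ), 0 < p → IntegrableOn (fun v => w v • C (p / (1 + v)) f)
      (Set.Ioi 0) := by
    intro f p hp
    refine Integrable.mono' (hwi.mul_const (M * p ^ α * ‖f‖)) ?_ ?_
    · refine (hwc.smul ?_).aestronglyMeasurable measurableSet_Ioi
      exact (hCc f).comp (f := fun v : ℝ => (p, v)) (by fun_prop) fun v hv => ⟨hp, hv⟩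
    · filter_upwards [ae_restrict_mem measurableSet_Ioi] with v hv
      rw [norm_smul, Real.norm_of_nonneg (hw0 v hv)]
      calc _ ≤ w v * (M * p ^ α * (1 + v) ^ (-α) * ‖f‖) :=
            mul_le_mul_of_nonneg_left (hCb f p v hp hv) (hw0 v hv)
        _ = _ := by ring
  set J := ∫ v in Set.Ioi (0 : ℝ), w v * (1 + v) ^ (-α) with hJ
  have hJ0 : 0 ≤ J := setIntegral_nonneg measurableSet_Ioi fun v hv => by
    have hv : (0 : ℝ) < v := hv
    positivity
  have hex : ∀ p : ℝ, ∃ L : X →L[ℂ] X, 0 < p → (‖L‖ ≤ (1 / Real.Gamma β) * (M * J) ∧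
      ∀ f, L f = (p ^ (-α) * (1 / Real.Gamma β)) •
        ∫ v in Set.Ioi (0 : ℝ), w v • C (p / (1 + v)) f) := by
    intro p
    by_cases hp : 0 < p
    swap
    · exact ⟨0, fun h => absurd h hp⟩
    let L : X →ₗ[ℂ] X :=
      { toFun := fun f => (p ^ (-α) * (1 / Real.Gamma β)) •
          ∫ v in Set.Ioi (0 : ℝ), w v • C (p / (1 + v)) f
        map_add' := fun f g => by
          simp only [map_add, smul_add]
          rw [integral_add (hin f p hp) (hin g p hp), smul_add]
        map_smul' := fun c f => by
          simp only [map_smul, RingHom.id_apply]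
          simp_rw [smul_comm _ c]
          rw [integral_smul, smul_comm] }
    have hL : ∀ f, ‖L f‖ ≤ (1 / Real.Gamma β) * (M * J) * ‖f‖ := by
      intro f
      change ‖(p ^ (-α) * (1 / Real.Gamma β)) •
        ∫ v in Set.Ioi (0 : ℝ), w v • C (p / (1 + v)) f‖ ≤ _
      rw [norm_smul, Real.norm_of_nonneg (by positivity)]
      have h1 : ‖∫ v in Set.Ioi (0 : ℝ), w v • C (p / (1 + v)) f‖ ≤ J * (M * p ^ α * ‖f‖) := by
        rw [hJ, ← integral_mul_const]
        refine norm_integral_le_of_norm_le (hwi.mul_const _) ?_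
        filter_upwards [ae_restrict_mem measurableSet_Ioi] with v hv
        rw [norm_smul, Real.norm_of_nonneg (hw0 v hv)]
        calc _ ≤ w v * (M * p ^ α * (1 + v) ^ (-α) * ‖f‖) :=
              mul_le_mul_of_nonneg_left (hCb f p v hp hv) (hw0 v hv)
          _ = _ := by ring
      calc _ ≤ p ^ (-α) * (1 / Real.Gamma β) * (J * (M * p ^ α * ‖f‖)) := by gcongr
        _ = (p ^ (-α) * p ^ α) * ((1 / Real.Gamma β) * (M * J) * ‖f‖) := by ring
        _ = _ := by rw [← Real.rpow_add hp]; simp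
    exact ⟨L.mkContinuous _ hL, fun _ => ⟨L.mkContinuous_norm_le (by positivity) hL,
      fun f => rfl⟩⟩
  choose B hB using hex
  refine ⟨B, _, fun p hp => (hB p hp).1, fun f => ?_, fun ψ hψc hψ f => ?_⟩
  · have h1 : AEStronglyMeasurable (fun q : ℝ × ℝ => w q.2 • C (q.1 / (1 + q.2)) f)
        ((volume.restrict (Set.Ioi 0)).prod (volume.restrict (Set.Ioi 0))) :=
      aestronglyMeasurable_prod_Ioi
        ((hwc.comp continuousOn_snd fun q hq => hq.2).smul (hCc f))
    have h2 : AEStronglyMeasurable (fun p : ℝ => (p ^ (-α) * (1 / Real.Gamma β)) •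
        ∫ v in Set.Ioi (0 : ℝ), w v • C (p / (1 + v)) f) (volume.restrict (Set.Ioi 0)) := by
      have h2 : ContinuousOn (fun p : ℝ => p ^ (-α) * (1 / Real.Gamma β)) (Set.Ioi 0) :=
        (continuousOn_id.rpow_const fun q hq => Or.inl (ne_of_gt hq)).mul continuousOn_const
      exact (h2.aestronglyMeasurable measurableSet_Ioi).smul h1.integral_prod_right'
    refine h2.congr ?_
    filter_upwards [ae_restrict_mem measurableSet_Ioi] with p hp
    rw [(hB p hp).2]
  set I := ∫ p in Set.Ioi (0 : ℝ), p ^ (α + β) * ‖ψ p‖ with hI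
  have hsc : ∀ v : ℝ, 0 < v → ∀ s : ℝ, 0 < s → s ^ (α + β) * ‖ψ (s * (1 + v))‖ =
      (1 + v) ^ (-(α + β)) * (((1 + v) * s) ^ (α + β) * ‖ψ ((1 + v) * s)‖) := by
    intro v hv s hs
    have hv1 : 0 < 1 + v := by linarith
    rw [Real.mul_rpow hv1.le hs.le, mul_comm s (1 + v), ← mul_assoc, ← mul_assoc,
      ← Real.rpow_add hv1]
    simp
  have hsi : ∀ v : ℝ, 0 < v → IntegrableOn (fun s => s ^ (α + β) * ‖ψ (s * (1 + v))‖)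
      (Set.Ioi 0) := by
    intro v hv
    have hv1 : 0 < 1 + v := by linarith
    have h1 := (integrableOn_Ioi_comp_mul_left_iff (fun p : ℝ => p ^ (α + β) * ‖ψ p‖) 0 hv1).2
      (by simpa using hψ)
    exact IntegrableOn.congr_fun (h1.const_mul ((1 + v) ^ (-(α + β))))
      (fun s hs => (hsc v hv s hs).symm) measurableSet_Ioi
  have hsI : ∀ v : ℝ, 0 < v → ∫ s in Set.Ioi (0 : ℝ), s ^ (α + β) * ‖ψ (s * (1 + v))‖ =
      (1 + v) ^ (-(α + β + 1)) * I := by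
    intro v hv
    have hv1 : 0 < 1 + v := by linarith
    rw [setIntegral_congr_fun measurableSet_Ioi (hsc v hv), integral_const_mul,
      integral_comp_mul_left_Ioi (fun p : ℝ => p ^ (α + β) * ‖ψ p‖) 0 hv1, mul_zero, smul_eq_mul,
      ← mul_assoc, neg_add (α + β) 1, Real.rpow_add hv1, Real.rpow_neg_one]
  have hψp : ContinuousOn (fun q : ℝ × ℝ => ψ (q.1 * (1 + q.2))) (Set.Ioi 0 ×ˢ Set.Ioi 0) :=
    hψc.comp (by fun_prop) fun q hq => Set.mem_Ioi.2 (mul_pos hq.1 (add_pos one_pos hq.2))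
  have hfst : ∀ a : ℝ, ContinuousOn (fun q : ℝ × ℝ => q.1 ^ a) (Set.Ioi 0 ×ˢ Set.Ioi 0) :=
    fun a => continuousOn_fst.rpow_const fun q hq => Or.inl (ne_of_gt hq.1)
  have hsnd : ∀ a : ℝ, ContinuousOn (fun q : ℝ × ℝ => q.2 ^ a) (Set.Ioi 0 ×ˢ Set.Ioi 0) :=
    fun a => continuousOn_snd.rpow_const fun q hq => Or.inl (ne_of_gt hq.2)
  -- Scaling in `s` for fixed `v` yields `(1 + v)^(-(α+β+1))` times a constant, which is integrable
  -- against `v^(β-1)`.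
  have hH : Integrable (Function.uncurry fun s v : ℝ =>
      v ^ (β - 1) * (s ^ (α + β) * ‖ψ (s * (1 + v))‖))
      ((volume.restrict (Set.Ioi 0)).prod (volume.restrict (Set.Ioi 0))) := by
    have hHc : ContinuousOn (Function.uncurry fun s v : ℝ =>
        v ^ (β - 1) * (s ^ (α + β) * ‖ψ (s * (1 + v))‖)) (Set.Ioi 0 ×ˢ Set.Ioi 0) :=
      (hsnd _).mul ((hfst _).mul hψp.norm)
    refine (integrable_prod_iff' (aestronglyMeasurable_prod_Ioi hHc)).2 ⟨?_, ?_⟩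
    · filter_upwards [ae_restrict_mem measurableSet_Ioi] with v hv
      simp only [Function.uncurry_apply_pair]
      exact (hsi v hv).const_mul _
    · refine (((integrableOn_rpow_mul_one_add_rpow (p := β - 1) (q := α + β + 1) (by linarith)
        (by linarith)).mul_const I)).congr ?_
      filter_upwards [ae_restrict_mem measurableSet_Ioi] with v hv
      rw [mul_assoc, ← hsI v hv, ← integral_const_mul]
      refine setIntegral_congr_fun measurableSet_Ioi fun s hs => ?_
      have hs : (0 : ℝ) < s := hs
      have hv : (0 : ℝ) < v := hv
      exact (Real.norm_of_nonneg (by positivity)).symm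
  have hF : Integrable (Function.uncurry fun s v : ℝ =>
      (((s ^ β * v ^ (β - 1) : ℝ) : ℂ) * ψ (s * (1 + v))) • C s f)
      ((volume.restrict (Set.Ioi 0)).prod (volume.restrict (Set.Ioi 0))) := by
    refine Integrable.mono' (hH.const_mul (M * ‖f‖)) (aestronglyMeasurable_prod_Ioi ?_) ?_
    · exact (ContinuousOn.mul (Complex.continuous_ofReal.comp_continuousOn
        ((hfst _).mul (hsnd _))) hψp).smul ((hC f).comp continuousOn_fst fun q hq => hq.1)
    · rw [Measure.prod_restrict]
      filter_upwards [ae_restrict_mem (measurableSet_Ioi.prod measurableSet_Ioi)] with q hq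
      obtain ⟨s, v⟩ := q
      have hs : (0 : ℝ) < s := hq.1
      have hv : (0 : ℝ) < v := hq.2
      simp only [Function.uncurry]
      rw [norm_smul, norm_mul, Complex.norm_real, Real.norm_of_nonneg (by positivity)]
      calc _ ≤ s ^ β * v ^ (β - 1) * ‖ψ (s * (1 + v))‖ * (M * s ^ α * ‖f‖) := by
            gcongr
            exact (C s).le_of_opNorm_le (hM s hs) f
        _ = _ := by rw [Real.rpow_add hs]; ring
  have hF2 : Integrable (Function.uncurry fun v p : ℝ =>
      (((p ^ β * w v : ℝ) : ℂ) * ψ p) • C (p / (1 + v)) f)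
      ((volume.restrict (Set.Ioi 0)).prod (volume.restrict (Set.Ioi 0))) := by
    refine Integrable.mono' ((hwi.mul_prod hψ).const_mul (M * ‖f‖))
      (aestronglyMeasurable_prod_Ioi ?_) ?_
    · refine (ContinuousOn.mul (Complex.continuous_ofReal.comp_continuousOn
        ((hsnd _).mul (hwc.comp continuousOn_fst fun q hq => hq.1)))
        (hψc.comp continuousOn_snd fun q hq => hq.2)).smul ?_
      exact (hCc f).comp (f := Prod.swap) continuous_swap.continuousOn fun q hq => ⟨hq.2, hq.1⟩
    · rw [Measure.prod_restrict]
      filter_upwards [ae_restrict_mem (measurableSet_Ioi.prod measurableSet_Ioi)] with q hq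
      obtain ⟨v, p⟩ := q
      have hv : (0 : ℝ) < v := hq.1
      have hp : (0 : ℝ) < p := hq.2
      have hwv := hw0 v hv
      simp only [Function.uncurry]
      rw [norm_smul, norm_mul, Complex.norm_real, Real.norm_of_nonneg (by positivity)]
      calc _ ≤ p ^ β * w v * ‖ψ p‖ * (M * p ^ α * (1 + v) ^ (-α) * ‖f‖) := by
            gcongr
            exact hCb f p v hp hv
        _ = _ := by rw [Real.rpow_add hp]; ring
  have hinner : ∀ s : ℝ, 0 < s → (((1 / Real.Gamma β : ℝ) : ℂ) *
      ∫ r in Set.Ioi (0 : ℝ), ((r ^ (β - 1) : ℝ) : ℂ) * ψ (s + r)) • C s f =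
      ((1 / Real.Gamma β : ℝ) : ℂ) • ∫ v in Set.Ioi (0 : ℝ),
        (((s ^ β * v ^ (β - 1) : ℝ) : ℂ) * ψ (s * (1 + v))) • C s f := by
    intro s hs
    have h1 := integral_comp_mul_left_Ioi (fun r => ((r ^ (β - 1) : ℝ) : ℂ) * ψ (s + r)) 0 hs
    rw [mul_zero, eq_inv_smul_iff₀ hs.ne', ← integral_smul] at h1
    rw [integral_smul_const, smul_smul, ← h1]
    congr 2
    refine setIntegral_congr_fun measurableSet_Ioi fun v hv => ?_
    have hv : (0 : ℝ) < v := hv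
    rw [mul_one_add, Real.mul_rpow hs.le hv.le, ← Complex.coe_smul, smul_eq_mul, ← mul_assoc,
      ← Complex.ofReal_mul, ← mul_assoc]
    congr 3
    nth_rewrite 1 [← Real.rpow_one s]
    rw [← Real.rpow_add hs]; congr 1; ring
  have hint : IntegrableOn (fun s : ℝ => ((1 / Real.Gamma β : ℝ) : ℂ) •
      ∫ v in Set.Ioi (0 : ℝ), (((s ^ β * v ^ (β - 1) : ℝ) : ℂ) * ψ (s * (1 + v))) • C s f)
      (Set.Ioi 0) := hF.integral_prod_left.smul ((1 / Real.Gamma β : ℝ) : ℂ)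
  refine ⟨hint.congr_fun (fun s hs => (hinner s hs).symm) measurableSet_Ioi, ?_⟩
  rw [setIntegral_congr_fun measurableSet_Ioi hinner, integral_smul, integral_integral_swap hF]
  have hsub : ∀ v : ℝ, 0 < v → ∫ s in Set.Ioi (0 : ℝ),
      (((s ^ β * v ^ (β - 1) : ℝ) : ℂ) * ψ (s * (1 + v))) • C s f =
      ∫ p in Set.Ioi (0 : ℝ), (((p ^ β * w v : ℝ) : ℂ) * ψ p) • C (p / (1 + v)) f := by
    intro v hv
    have hv1 : 0 < 1 + v := by linarith
    have h1 := integral_comp_mul_left_Ioi (fun p : ℝ =>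
      (((p ^ β * w v : ℝ) : ℂ) * ψ p) • C (p / (1 + v)) f) 0 hv1
    rw [mul_zero, eq_inv_smul_iff₀ hv1.ne', ← integral_smul] at h1
    rw [← h1]
    refine setIntegral_congr_fun measurableSet_Ioi fun s hs => ?_
    have hs : (0 : ℝ) < s := hs
    rw [mul_div_cancel_left₀ _ hv1.ne', mul_comm (1 + v) s, ← Complex.coe_smul, smul_smul,
      ← mul_assoc, ← Complex.ofReal_mul, Real.mul_rpow hs.le hv1.le]
    congr 3
    simp only [hw]
    rw [neg_add, Real.rpow_add hv1, Real.rpow_neg_one, Real.rpow_neg hv1.le]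
    field_simp
  rw [setIntegral_congr_fun measurableSet_Ioi hsub, integral_integral_swap hF2, ← integral_smul]
  refine setIntegral_congr_fun measurableSet_Ioi fun p hp => ?_
  have hp : (0 : ℝ) < p := hp
  rw [(hB p hp).2, ← Complex.coe_smul (p ^ (-α) * (1 / Real.Gamma β)), smul_smul]
  have h1 : ∀ v : ℝ, (((p ^ β * w v : ℝ) : ℂ) * ψ p) • C (p / (1 + v)) f =
      (((p ^ β : ℝ) : ℂ) * ψ p) • w v • C (p / (1 + v)) f := by
    intro v
    rw [← Complex.coe_smul (w v), smul_smul]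
    congr 1; push_cast; ring
  simp_rw [h1]
  rw [integral_smul, smul_smul]
  congr 1
  rw [mul_right_comm, ← Complex.ofReal_mul, ← mul_assoc, ← Complex.ofReal_mul]
  congr 2
  rw [show p ^ (α + β) * (p ^ (-α) * (1 / Real.Gamma β)) =
    p ^ (α + β) * p ^ (-α) * (1 / Real.Gamma β) by ring, ← Real.rpow_add hp]
  rw [mul_comm]; congr 2; ring

end Average

/-! ### Derivatives of functions of `t²`. -/

/-- The coefficients of `d^j/dt^j F(t²) = t^{-j} ∑ᵢ c(j, i) t^{2i} F^{(i)}(t²)`. -/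
def towerCoeff : ℕ → ℕ → ℝ
  | 0, 0 => 1
  | 0, _ + 1 => 0
  | j + 1, 0 => -(j : ℝ) * towerCoeff j 0
  | j + 1, i + 1 => (2 * ((i : ℝ) + 1) - j) * towerCoeff j (i + 1) + 2 * towerCoeff j i

theorem towerCoeff_eq_zero {j i : ℕ} (h : j < i) : towerCoeff j i = 0 := by
  induction j generalizing i with
  | zero =>
    obtain ⟨i, rfl⟩ := Nat.exists_eq_succ_of_ne_zero (by omega : i ≠ 0)
    rfl
  | succ j ih =>
    obtain ⟨i, rfl⟩ := Nat.exists_eq_succ_of_ne_zero (by omega : i ≠ 0)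
    rw [Nat.succ_eq_add_one, towerCoeff, ih (by omega), ih (by omega)]
    simp

/-- `t^j` times the `j`-th derivative of `t ↦ F 0 (t²)`, for a sequence of successive derivatives
`F`. -/
def towerSum (F : ℕ → ℝ → ℂ) (j : ℕ) (t : ℝ) : ℂ :=
  ∑ i ∈ Finset.range (j + 1), (towerCoeff j i : ℂ) * ((t : ℂ) ^ (2 * i) * F i (t ^ 2))

/-- `F` is a sequence of successive derivatives on `(0, ∞)`, with decay of order `a`. -/
structure IsTower (F : ℕ → ℝ → ℂ) (a : ℝ) : Prop where
  hasDeriv : ∀ i : ℕ, ∀ x : ℝ, 0 < x → HasDerivAt (F i) (F (i + 1) x) x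
  decay : ∀ i : ℕ, ∀ δ : ℝ, 0 < δ → ∃ K : ℝ, ∀ x : ℝ, δ ≤ x → ‖F i x‖ ≤ K * x ^ (-a - i)
  integrable : ∀ i : ℕ, IntegrableOn (fun t : ℝ => (t : ℂ) ^ (2 * i) * F i (t ^ 2)) (Set.Ioi 0)

/-- Differentiating `t^(2i-j) F i (t²)` gives the factor `2i - j` on the same term and `2 t^2` times
the next derivative; this is the recursion of `towerCoeff`. -/
theorem hasDerivAt_towerSum {F : ℕ → ℝ → ℂ}
    (hF : ∀ i : ℕ, ∀ x : ℝ, 0 < x → HasDerivAt (F i) (F (i + 1) x) x) (j : ℕ) {t : ℝ}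
    (ht : 0 < t) : HasDerivAt (fun t : ℝ => ((t : ℂ) ^ j)⁻¹ * towerSum F j t)
      (((t : ℂ) ^ (j + 1))⁻¹ * towerSum F (j + 1) t) t := by
  have ht0 : (t : ℂ) ≠ 0 := by exact_mod_cast ht.ne'
  have hpow : ∀ k : ℕ, HasDerivAt (fun t : ℝ => (t : ℂ) ^ k) (k * (t : ℂ) ^ (k - 1)) t := by
    intro k
    have := (hasDerivAt_pow k (t : ℂ)).comp_ofReal
    simpa using this
  have hterm : ∀ i : ℕ, HasDerivAt (fun t : ℝ => (towerCoeff j i : ℂ) *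
      ((t : ℂ) ^ (2 * i) * F i (t ^ 2))) ((t : ℂ)⁻¹ * ((towerCoeff j i : ℂ) *
        (2 * i * (t : ℂ) ^ (2 * i) * F i (t ^ 2) + 2 * (t : ℂ) ^ (2 * (i + 1)) *
          F (i + 1) (t ^ 2)))) t := by
    intro i
    have hsq : HasDerivAt (fun t : ℝ => t ^ 2) (2 * t) t := by
      simpa using hasDerivAt_pow 2 t
    have h1 := (hF i (t ^ 2) (by positivity)).scomp t hsq
    refine (((hpow (2 * i)).mul h1).const_mul _).congr_deriv ?_
    simp only [Function.comp, Complex.real_smul]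
    have h2 : ((2 * i : ℕ) : ℂ) * (t : ℂ) ^ (2 * i - 1) = (t : ℂ)⁻¹ *
      (2 * i * (t : ℂ) ^ (2 * i)) := by
      rcases Nat.eq_zero_or_pos i with rfl | hi
      · simp
      · obtain ⟨k, hk⟩ : ∃ k, 2 * i = k + 1 := ⟨2 * i - 1, by omega⟩
        have : (2 : ℂ) * i = ((2 * i : ℕ) : ℂ) := by push_cast; ring
        rw [this, hk, Nat.add_sub_cancel, pow_succ]
        field_simp
    rw [h2]
    push_cast
    field_simp
    ring
  have hsum := HasDerivAt.fun_sum (u := Finset.range (j + 1)) fun i _ => hterm i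
  have hinv := (hpow j).inv (pow_ne_zero j ht0)
  refine (hinv.mul hsum).congr_deriv ?_
  have hj : (j : ℂ) * (t : ℂ) ^ (j - 1) = (t : ℂ)⁻¹ * (j * (t : ℂ) ^ j) := by
    rcases Nat.eq_zero_or_pos j with rfl | hi
    · simp
    · obtain ⟨k, rfl⟩ : ∃ k, j = k + 1 := ⟨j - 1, by omega⟩
      rw [Nat.add_sub_cancel, pow_succ]
      field_simp
  rw [hj]
  have key : towerSum F (j + 1) t = -(j : ℂ) * towerSum F j t +
      ∑ i ∈ Finset.range (j + 1), (towerCoeff j i : ℂ) *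
        (2 * i * (t : ℂ) ^ (2 * i) * F i (t ^ 2) + 2 * (t : ℂ) ^ (2 * (i + 1)) *
          F (i + 1) (t ^ 2)) := by
    -- The coefficients vanish above the diagonal, so the sum may be lengthened by one term to match
    -- the range of the next level.
    have e1 : -(j : ℂ) * towerSum F j t = ∑ i ∈ Finset.range (j + 2), -(j : ℂ) *
        ((towerCoeff j i : ℂ) * ((t : ℂ) ^ (2 * i) * F i (t ^ 2))) := by
      rw [Finset.sum_range_succ, towerCoeff_eq_zero (Nat.lt_succ_self j), towerSum, Finset.mul_sum]
      simp
    have e2 : ∑ i ∈ Finset.range (j + 1), (towerCoeff j i : ℂ) *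
        (2 * i * (t : ℂ) ^ (2 * i) * F i (t ^ 2) + 2 * (t : ℂ) ^ (2 * (i + 1)) *
          F (i + 1) (t ^ 2)) = ∑ i ∈ Finset.range (j + 2), (towerCoeff j i : ℂ) *
          (2 * i * (t : ℂ) ^ (2 * i) * F i (t ^ 2)) + ∑ i ∈ Finset.range (j + 1),
          (towerCoeff j i : ℂ) * (2 * (t : ℂ) ^ (2 * (i + 1)) * F (i + 1) (t ^ 2)) := by
      rw [Finset.sum_range_succ _ (j + 1), towerCoeff_eq_zero (Nat.lt_succ_self j)]
      simp only [mul_add, Finset.sum_add_distrib]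
      simp
    rw [e1, e2, towerSum, Finset.sum_range_succ' _ (j + 1), Finset.sum_range_succ' _ (j + 1),
      Finset.sum_range_succ' _ (j + 1)]
    simp only [towerCoeff]
    have e3 : ∀ i : ℕ, ((((2 * ((i : ℝ) + 1) - j) * towerCoeff j (i + 1) +
        2 * towerCoeff j i : ℝ)) : ℂ) * ((t : ℂ) ^ (2 * (i + 1)) * F (i + 1) (t ^ 2)) =
        -(j : ℂ) * ((towerCoeff j (i + 1) : ℂ) * ((t : ℂ) ^ (2 * (i + 1)) * F (i + 1) (t ^ 2))) +
        (towerCoeff j (i + 1) : ℂ) * (2 * ((i + 1 : ℕ) : ℂ) * (t : ℂ) ^ (2 * (i + 1)) *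
          F (i + 1) (t ^ 2)) + (towerCoeff j i : ℂ) * (2 * (t : ℂ) ^ (2 * (i + 1)) *
          F (i + 1) (t ^ 2)) := by
      intro i; push_cast; ring
    simp_rw [e3, Finset.sum_add_distrib]
    push_cast
    ring
  have e0 : ∑ i ∈ Finset.range (j + 1), (towerCoeff j i : ℂ) * ((t : ℂ) ^ (2 * i) * F i (t ^ 2)) =
    towerSum F j t := rfl
  rw [key, ← Finset.mul_sum, Pi.inv_apply, e0, pow_succ]
  generalize (∑ i ∈ Finset.range (j + 1), (towerCoeff j i : ℂ) *
    (2 * i * (t : ℂ) ^ (2 * i) * F i (t ^ 2) + 2 * (t : ℂ) ^ (2 * (i + 1)) *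
      F (i + 1) (t ^ 2))) = S
  field_simp
  ring

namespace IsTower

variable {F : ℕ → ℝ → ℂ} {a : ℝ}

theorem integrableOn_towerSum (hF : IsTower F a) (j : ℕ) :
    IntegrableOn (towerSum F j) (Set.Ioi 0) :=
  integrable_finsetSum _ fun i _ => (hF.integrable i).const_mul _

/-- Each factor `t^(2i)` offsets the extra decay of the `i`-th derivative in `t²`, so all terms are
of order `t^(-2a)`. On `t ≥ δ` the factor `t^(-j)` is bounded. -/
theorem exists_norm_le (hF : IsTower F a) (j : ℕ) {δ : ℝ} (hδ : 0 < δ) :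
    ∃ K : ℝ, ∀ t : ℝ, δ ≤ t → ‖((t : ℂ) ^ j)⁻¹ * towerSum F j t‖ ≤ K * t ^ (-(2 * a)) := by
  choose K hK using fun i => hF.decay i (δ ^ 2) (by positivity)
  refine ⟨(δ ^ j)⁻¹ * ∑ i ∈ Finset.range (j + 1), |towerCoeff j i| * K i, fun t ht => ?_⟩
  have ht0 : 0 < t := hδ.trans_le ht
  rw [norm_mul, norm_inv, norm_pow, Complex.norm_real, Real.norm_of_nonneg ht0.le, mul_assoc]
  have h1 : ‖towerSum F j t‖ ≤ (∑ i ∈ Finset.range (j + 1), |towerCoeff j i| * K i) *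
      t ^ (-(2 * a)) := by
    rw [Finset.sum_mul]
    refine norm_sum_le_of_le _ fun i _ => ?_
    rw [norm_mul, norm_mul, Complex.norm_real, norm_pow, Complex.norm_real, Real.norm_eq_abs,
      Real.norm_of_nonneg ht0.le, mul_assoc]
    refine mul_le_mul_of_nonneg_left ?_ (abs_nonneg _)
    calc t ^ (2 * i) * ‖F i (t ^ 2)‖ ≤ t ^ (2 * i) * (K i * (t ^ 2) ^ (-a - i)) := by
          gcongr
          exact hK i _ (by gcongr)
      _ = K i * t ^ (-(2 * a)) := by
          rw [← Real.rpow_natCast t 2, ← Real.rpow_mul ht0.le, ← Real.rpow_natCast t (2 * i),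
            mul_left_comm, ← Real.rpow_add ht0]
          congr 2; push_cast; ring
  have h2 : (t ^ j)⁻¹ ≤ (δ ^ j)⁻¹ := by gcongr
  exact mul_le_mul h2 h1 (norm_nonneg _) (by positivity)

theorem continuousOn_inv_mul_towerSum (hF : IsTower F a) (j : ℕ) :
    ContinuousOn (fun t : ℝ => ((t : ℂ) ^ j)⁻¹ * towerSum F j t) (Set.Ioi 0) :=
  fun _ ht => (hasDerivAt_towerSum hF.hasDeriv j ht).continuousAt.continuousWithinAt

theorem weylDeriv_eq (hF : IsTower F a) (ha : 1 / 2 < a) {α : ℝ} (hα : 0 ≤ α) {φ : ℝ → ℂ}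
    (hφ : ∀ t : ℝ, 0 < t → φ t = F 0 (t ^ 2)) {s : ℝ} (hs : 0 < s) :
    weylDeriv α φ s = (((1 / Real.Gamma (((⌊α⌋₊ + 1 : ℕ) : ℝ) - α) : ℝ)) : ℂ) *
      ∫ r in Set.Ioi (0 : ℝ), ((r ^ (((⌊α⌋₊ + 1 : ℕ) : ℝ) - α - 1) : ℝ) : ℂ) *
        ((-1) ^ (⌊α⌋₊ + 1) * ((((s + r : ℝ) : ℂ) ^ (⌊α⌋₊ + 1))⁻¹ *
          towerSum F (⌊α⌋₊ + 1) (s + r))) := by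
  set n := ⌊α⌋₊ + 1 with hn
  have h1 : α < n := by rw [hn]; push_cast; exact Nat.lt_floor_add_one α
  have h2 : (n : ℝ) ≤ α + 1 := by rw [hn]; push_cast; linarith [Nat.floor_le hα]
  rw [weylDeriv, iteratedDeriv_weylIntegral (n := n) (b := 2 * a)
    (φ := fun j t => ((t : ℂ) ^ j)⁻¹ * towerSum F j t) (by linarith) (by linarith) (by linarith)
    (fun j _ t ht => hasDerivAt_towerSum hF.hasDeriv j ht) (hF.continuousOn_inv_mul_towerSum n)
    (fun j _ δ hδ => hF.exists_norm_le j hδ)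
    (fun t ht => by simp [towerSum, towerCoeff, hφ t ht]) le_rfl hs, mul_left_comm,
    ← integral_const_mul]
  congr 2
  ext r
  ring

end IsTower

/-! ### Operators given by integrable kernels against a bounded family. -/

/-- A uniformly bounded, strongly measurable family of operators on `(0, ∞)`. -/
structure IsBoundedFamily {X : Type*} [NormedAddCommGroup X] [NormedSpace ℂ X]
    (B : ℝ → X →L[ℂ] X) (N : ℝ) : Prop where
  bound : ∀ p : ℝ, 0 < p → ‖B p‖ ≤ N
  meas : ∀ f : X, AEStronglyMeasurable (fun p => B p f) (volume.restrict (Set.Ioi 0))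

/-- The kernel of the `n`-th Weyl derivative of `t ↦ F 0 (t²)`, multiplied by `t^n`. -/
def weylKernel (n : ℕ) (F : ℕ → ℝ → ℂ) (t : ℝ) : ℂ := (-1) ^ n * towerSum F n t

theorem IsTower.integrableOn_weylKernel {F : ℕ → ℝ → ℂ} {a : ℝ} (hF : IsTower F a) (n : ℕ) :
    IntegrableOn (weylKernel n F) (Set.Ioi 0) :=
  Integrable.const_mul (hF.integrableOn_towerSum n) _

section Operator

variable {X : Type*} [NormedAddCommGroup X] [NormedSpace ℂ X]
  {B : ℝ → X →L[ℂ] X} {N : ℝ} {k : ℝ → ℂ}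

theorem IsBoundedFamily.nonneg (hB : IsBoundedFamily B N) : 0 ≤ N :=
  (norm_nonneg _).trans (hB.bound 1 one_pos)

theorem IsBoundedFamily.norm_smul_le (hB : IsBoundedFamily B N) (k : ℝ → ℂ) (f : X) :
    ∀ᵐ t ∂(volume.restrict (Set.Ioi (0 : ℝ))), ‖k t • B t f‖ ≤ ‖k t‖ * (N * ‖f‖) := by
  filter_upwards [ae_restrict_mem measurableSet_Ioi] with t ht
  rw [norm_smul]
  exact mul_le_mul_of_nonneg_left ((B t).le_of_opNorm_le (hB.bound t ht) f) (norm_nonneg _)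

theorem IsBoundedFamily.integrableOn_smul (hB : IsBoundedFamily B N)
    (hk : IntegrableOn k (Set.Ioi 0)) (f : X) :
    IntegrableOn (fun t => k t • B t f) (Set.Ioi 0) :=
  Integrable.mono' (hk.norm.mul_const (N * ‖f‖))
    (hk.aestronglyMeasurable.smul (hB.meas f)) (hB.norm_smul_le k f)

theorem IsBoundedFamily.norm_integral_smul_le (hB : IsBoundedFamily B N)
    (hk : IntegrableOn k (Set.Ioi 0)) (f : X) :
    ‖∫ t in Set.Ioi (0 : ℝ), k t • B t f‖ ≤ N * (∫ t in Set.Ioi (0 : ℝ), ‖k t‖) * ‖f‖ := by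
  calc _ ≤ ∫ t in Set.Ioi (0 : ℝ), ‖k t‖ * (N * ‖f‖) :=
        norm_integral_le_of_norm_le (hk.norm.mul_const _) (hB.norm_smul_le k f)
    _ = _ := by rw [integral_mul_const]; ring

open Classical in
/-- The operator `f ↦ ∫_0^∞ k(t) B(t) f dt`. -/
def kernelOp (B : ℝ → X →L[ℂ] X) (N : ℝ) (k : ℝ → ℂ) : X →L[ℂ] X :=
  if h : IsBoundedFamily B N ∧ IntegrableOn k (Set.Ioi 0) then
    LinearMap.mkContinuous
      { toFun := fun f => ∫ t in Set.Ioi (0 : ℝ), k t • B t f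
        map_add' := fun f g => by
          simp only [map_add, smul_add]
          exact integral_add (h.1.integrableOn_smul h.2 f) (h.1.integrableOn_smul h.2 g)
        map_smul' := fun c f => by
          simp only [map_smul, RingHom.id_apply]
          simp_rw [smul_comm _ c]
          exact integral_smul c _ }
      (N * ∫ t in Set.Ioi (0 : ℝ), ‖k t‖) (h.1.norm_integral_smul_le h.2)
  else 0

theorem kernelOp_apply (hB : IsBoundedFamily B N) (hk : IntegrableOn k (Set.Ioi 0)) (f : X) :
    kernelOp B N k f = ∫ t in Set.Ioi (0 : ℝ), k t • B t f := by
  rw [kernelOp, dif_pos ⟨hB, hk⟩]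
  rfl

theorem norm_kernelOp_le (hB : IsBoundedFamily B N) (hk : IntegrableOn k (Set.Ioi 0)) :
    ‖kernelOp B N k‖ ≤ N * ∫ t in Set.Ioi (0 : ℝ), ‖k t‖ := by
  refine ContinuousLinearMap.opNorm_le_bound _
    (mul_nonneg hB.nonneg (integral_nonneg fun _ => norm_nonneg _)) fun f => ?_
  rw [kernelOp_apply hB hk]
  exact hB.norm_integral_smul_le hk f

end Operator

/-- Exponentials are eigenfunctions of the Weyl integral. This lets the resolvent formula pass
through the averaging. -/
theorem integral_exp_weyl {β l s : ℝ} (hβ : 0 < β) (hl : 0 < l) :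
    ∫ r in Set.Ioi (0 : ℝ), ((r ^ (β - 1) : ℝ) : ℂ) * ((Real.exp (-(l * (s + r))) : ℝ) : ℂ) =
      ((Real.Gamma β * l ^ (-β) * Real.exp (-(l * s)) : ℝ) : ℂ) := by
  have h := Real.integral_rpow_mul_exp_neg_mul_Ioi hβ hl
  rw [one_div, Real.inv_rpow hl.le, ← Real.rpow_neg hl.le, mul_comm] at h
  rw [← h, ← integral_mul_const, ← integral_complex_ofReal]
  congr 1
  ext r
  rw [mul_add, neg_add, Real.exp_add]
  push_cast
  ring

/-- Reduction of the integrated cosine family to a bounded family, with the Weyl derivative and the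
resolvent expressed through it. -/
theorem IsTemperedIntegratedCosine.exists_boundedFamily {X : Type*} [NormedAddCommGroup X]
    [NormedSpace ℂ X] [CompleteSpace X] {α : ℝ} (hα : 0 ≤ α) {C : ℝ → X →L[ℂ] X}
    {A : X →ₗ.[ℂ] X} (hA : IsTemperedIntegratedCosine α C A) :
    ∃ (B : ℝ → X →L[ℂ] X) (N : ℝ), IsBoundedFamily B N ∧
      (∀ (F : ℕ → ℝ → ℂ) (a : ℝ) (φ : ℝ → ℂ), IsTower F a → 1 / 2 < a →
        (∀ t : ℝ, 0 < t → φ t = F 0 (t ^ 2)) → ∀ f : X,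
        IntegrableOn (fun t : ℝ => weylDeriv α φ t • C t f) (Set.Ioi 0) ∧
        ∫ t in Set.Ioi (0 : ℝ), weylDeriv α φ t • C t f =
          kernelOp B N (weylKernel (⌊α⌋₊ + 1) F) f) ∧
      ∀ l : ℝ, 0 < l → ∀ f : X, (l : ℂ) ^ ((α : ℂ) - 1) •
        ∫ t in Set.Ioi (0 : ℝ), Complex.exp (-(l : ℂ) * t) • C t f =
          ∫ p in Set.Ioi (0 : ℝ),
            ((l ^ ⌊α⌋₊ * Real.exp (-(l * p)) * p ^ (⌊α⌋₊ + 1) : ℝ) : ℂ) • B p f := by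
  set n := ⌊α⌋₊ + 1 with hn
  set β : ℝ := (n : ℝ) - α with hβ
  have hβ0 : 0 < β := by
    have := Nat.lt_floor_add_one α
    rw [hβ, hn]; push_cast; linarith
  have hαβ : α + β = n := by rw [hβ]; ring
  obtain ⟨M, hM⟩ := hA.tempered
  obtain ⟨B, N, hBb, hBm, hB⟩ := exists_average hα hβ0
    (fun f => (hA.strongly_continuous f).mono Set.Ioi_subset_Ici_self) hM
  have hBF : IsBoundedFamily B N := ⟨hBb, hBm⟩
  have hg := Real.Gamma_pos_of_pos hβ0
  refine ⟨B, N, hBF, fun F a φ hF ha hφ f => ?_, fun l hl f => ?_⟩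
  -- Since `α + β = n`, the weight `p^(α+β)` cancels the factor `p^(-n)` of the `n`-th derivative.
  · have hn1 : ∀ p : ℝ, 0 < p → ((p ^ (α + β) : ℝ) : ℂ) * ((-1) ^ n * (((p : ℂ) ^ n)⁻¹ *
        towerSum F n p)) = weylKernel n F p := by
      intro p hp
      have hp0 : (p : ℂ) ^ n ≠ 0 := pow_ne_zero _ (by exact_mod_cast hp.ne')
      rw [hαβ, Real.rpow_natCast, weylKernel]
      push_cast
      field_simp
    have h1 := hB (fun t => (-1) ^ n * (((t : ℂ) ^ n)⁻¹ * towerSum F n t))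
      (continuousOn_const.mul (hF.continuousOn_inv_mul_towerSum n))
      (IntegrableOn.congr_fun (hF.integrableOn_weylKernel n).norm (fun p hp => by
        have hp : (0 : ℝ) < p := hp
        rw [← hn1 p hp, norm_mul, Complex.norm_real, Real.norm_of_nonneg (by positivity)])
        measurableSet_Ioi) f
    have h2 : ∀ t ∈ Set.Ioi (0 : ℝ), weylDeriv α φ t • C t f = (((1 / Real.Gamma β : ℝ) : ℂ) *
          ∫ r in Set.Ioi (0 : ℝ), ((r ^ (β - 1) : ℝ) : ℂ) *
            ((-1) ^ n * ((((t + r : ℝ) : ℂ) ^ n)⁻¹ * towerSum F n (t + r)))) • C t f := by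
      intro t ht
      rw [hF.weylDeriv_eq ha hα hφ ht]
    refine ⟨h1.1.congr_fun (fun t ht => (h2 t ht).symm) measurableSet_Ioi, ?_⟩
    rw [setIntegral_congr_fun measurableSet_Ioi h2, h1.2,
      kernelOp_apply hBF (hF.integrableOn_weylKernel n)]
    refine setIntegral_congr_fun measurableSet_Ioi fun p hp => ?_
    rw [hn1 p hp]
  · have hexp := integrableOn_rpow_mul_exp_neg_mul (a := (n : ℝ) + 1) (by positivity) hl
    -- The power `l^⌊α⌋` is chosen so that, with the factor `l^(-β)` of the Weyl integral, it gives
    -- `l^(α-1)`.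
    have h1 := hB (fun t => ((l ^ ⌊α⌋₊ : ℝ) : ℂ) * ((Real.exp (-(l * t)) : ℝ) : ℂ))
      (by fun_prop) (IntegrableOn.congr_fun (hexp.const_mul (l ^ ⌊α⌋₊)) (fun p hp => by
        rw [hαβ, norm_mul, Complex.norm_real, Complex.norm_real,
          Real.norm_of_nonneg (by positivity), Real.norm_of_nonneg (by positivity),
          add_sub_cancel_right]
        ring) measurableSet_Ioi) f
    rw [← integral_smul]
    refine Eq.trans ?_ (h1.2.trans ?_)
    · refine setIntegral_congr_fun measurableSet_Ioi fun t _ => ?_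
      simp only [mul_left_comm _ ((l ^ ⌊α⌋₊ : ℝ) : ℂ)]
      rw [integral_const_mul, integral_exp_weyl hβ0 hl, smul_smul]
      congr 1
      have e1 : (l : ℂ) ^ ((α : ℂ) - 1) = ((l ^ (α - 1) : ℝ) : ℂ) := by
        rw [Complex.ofReal_cpow hl.le]; push_cast; rfl
      have e2 : Complex.exp (-(l : ℂ) * t) = ((Real.exp (-(l * t)) : ℝ) : ℂ) := by
        push_cast; ring_nf
      rw [e1, e2, ← Complex.ofReal_mul, ← Complex.ofReal_mul, ← Complex.ofReal_mul]
      congr 1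
      have e3 : l ^ (α - 1) = l ^ ⌊α⌋₊ * l ^ (-β) := by
        rw [← Real.rpow_natCast, ← Real.rpow_add hl]
        congr 1
        rw [hβ, hn]; push_cast; ring
      rw [e3]
      field_simp
    · refine setIntegral_congr_fun measurableSet_Ioi fun p _ => ?_
      rw [hαβ, Real.rpow_natCast]
      congr 1
      push_cast
      ring

/-! ### The kernels `Γ(a) (z² + t²)^(-a)` in the right half-plane. -/

theorem sq_add_mem_slitPlane {z : ℂ} (hz : 0 < z.re) {x : ℝ} (hx : 0 ≤ x) :
    z ^ 2 + x ∈ Complex.slitPlane := by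
  rw [Complex.mem_slitPlane_iff]
  by_cases h : z.im = 0
  · left
    simp only [pow_two, Complex.add_re, Complex.mul_re, Complex.ofReal_re, h]
    nlinarith [mul_pos hz hz]
  · right
    simp only [pow_two, Complex.add_im, Complex.mul_im, Complex.ofReal_im]
    have : z.re * z.im ≠ 0 := mul_ne_zero hz.ne' h
    intro h2
    apply this
    linarith

/-- The difference of the squares of the two sides is `(Im z)² (|z|² - x)²`. The quotient `Re z /
|z|`, the cosine of the argument, is thus the only loss against the real case. -/
theorem re_mul_le_norm_mul (z : ℂ) (x : ℝ) :
    z.re * (‖z‖ ^ 2 + x) ≤ ‖z‖ * ‖z ^ 2 + x‖ := by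
  refine le_of_sq_le_sq ?_ (by positivity)
  rw [mul_pow, mul_pow, ← Complex.normSq_eq_norm_sq, ← Complex.normSq_eq_norm_sq]
  simp only [Complex.normSq_apply, pow_two, Complex.add_re, Complex.mul_re, Complex.ofReal_re,
    Complex.add_im, Complex.mul_im, Complex.ofReal_im]
  nlinarith [sq_nonneg (z.im * (z.re * z.re + z.im * z.im - x))]

theorem norm_sq_add_cpow_le {z : ℂ} (hz : 0 < z.re) {x b : ℝ} (hx : 0 ≤ x) (hb : 0 ≤ b) :
    ‖(z ^ 2 + x) ^ (-(b : ℂ))‖ ≤ (z.re / ‖z‖) ^ (-b) * (‖z‖ ^ 2 + x) ^ (-b) := by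
  have hz0 : 0 < ‖z‖ := norm_pos_iff.2 (by rintro rfl; simp at hz)
  rw [← Complex.ofReal_neg, Complex.norm_cpow_real, ← Real.mul_rpow (by positivity) (by positivity)]
  refine Real.rpow_le_rpow_of_nonpos (by positivity) ?_ (by linarith)
  rw [div_mul_eq_mul_div, div_le_iff₀ hz0, mul_comm ‖_‖]
  exact re_mul_le_norm_mul z x

/-- The successive derivatives of `x ↦ Γ(a) (z² + x)^{-a}`. -/
def mainTower (a : ℝ) (z : ℂ) (i : ℕ) (x : ℝ) : ℂ :=
  (-1) ^ i * (Real.Gamma (a + i) : ℂ) * (z ^ 2 + x) ^ (-((a + i : ℝ) : ℂ))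

theorem Gamma_cast_succ {a : ℝ} (ha : 0 < a) :
    ((Real.Gamma (a + 1) : ℝ) : ℂ) = (a : ℂ) * (Real.Gamma a : ℂ) := by
  rw [Real.Gamma_add_one ha.ne']; push_cast; rfl

theorem hasDerivAt_mainTower {a : ℝ} (ha : 0 < a) {z : ℂ} (hz : 0 < z.re) (i : ℕ) {x : ℝ}
    (hx : 0 ≤ x) : HasDerivAt (mainTower a z i) (mainTower a z (i + 1) x) x := by
  have h1 : HasDerivAt (fun w : ℂ => z ^ 2 + w) 1 (x : ℂ) := (hasDerivAt_id _).const_add (z ^ 2)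
  have h2 := (h1.cpow_const (c := -((a + i : ℝ) : ℂ))
    (sq_add_mem_slitPlane hz hx)).const_mul ((-1) ^ i * (Real.Gamma (a + i) : ℂ))
  refine h2.comp_ofReal.congr_deriv ?_
  have e1 : a + ((i + 1 : ℕ) : ℝ) = a + i + 1 := by push_cast; ring
  rw [mainTower, e1, Gamma_cast_succ (by positivity)]
  push_cast
  ring_nf

/-- The normalising factor `Γ(a + i)` absorbs the exponent, so differentiation in `z` just raises
`a` by one and multiplies by `-2z`. -/
theorem hasDerivAt_mainTower_left {a : ℝ} (ha : 0 < a) {z : ℂ} (hz : 0 < z.re) (i : ℕ) {x : ℝ}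
    (hx : 0 ≤ x) :
    HasDerivAt (fun z => mainTower a z i x) (-2 * z * mainTower (a + 1) z i x) z := by
  have h1 : HasDerivAt (fun z : ℂ => z ^ 2 + (x : ℂ)) (2 * z) z := by
    simpa using (hasDerivAt_pow 2 z).add_const (x : ℂ)
  have h2 := (h1.cpow_const (c := -((a + i : ℝ) : ℂ))
    (sq_add_mem_slitPlane hz hx)).const_mul ((-1) ^ i * (Real.Gamma (a + i) : ℂ))
  refine h2.congr_deriv ?_
  have e1 : a + 1 + (i : ℝ) = a + i + 1 := by ring
  rw [mainTower, e1, Gamma_cast_succ (by positivity)]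
  push_cast
  ring_nf

theorem norm_mainTower_le {a : ℝ} (ha : 0 < a) {z : ℂ} (hz : 0 < z.re) (i : ℕ) {x : ℝ}
    (hx : 0 ≤ x) : ‖mainTower a z i x‖ ≤ Real.Gamma (a + i) * ((z.re / ‖z‖) ^ (-(a + i)) *
      (‖z‖ ^ 2 + x) ^ (-(a + i))) := by
  have hg : 0 < Real.Gamma (a + i) := Real.Gamma_pos_of_pos (by positivity)
  rw [mainTower, norm_mul, norm_mul, norm_pow, norm_neg, norm_one, one_pow, one_mul,
    Complex.norm_real, Real.norm_of_nonneg hg.le]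
  gcongr
  exact norm_sq_add_cpow_le hz hx (by positivity)

theorem re_div_norm_le_one {z : ℂ} : z.re / ‖z‖ ≤ 1 :=
  div_le_one_of_le₀ (Complex.re_le_norm z) (norm_nonneg _)

/-- `t^(2i) ≤ (|z|² + t²)^i` compensates the `i` extra powers. The cosine is at most `1`, so its
power `-(a+n)` serves for all `i ≤ n`. -/
theorem norm_pow_mul_mainTower_le {a : ℝ} (ha : 0 < a) {z : ℂ} (hz : 0 < z.re) {i n : ℕ}
    (hi : i ≤ n) (t : ℝ) : ‖(t : ℂ) ^ (2 * i) * mainTower a z i (t ^ 2)‖ ≤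
      Real.Gamma (a + i) * (z.re / ‖z‖) ^ (-(a + n)) * (‖z‖ ^ 2 + t ^ 2) ^ (-a) := by
  have hz0 : 0 < ‖z‖ := norm_pos_iff.2 (by rintro rfl; simp at hz)
  have hg : 0 < Real.Gamma (a + i) := Real.Gamma_pos_of_pos (by positivity)
  have h1 := norm_mainTower_le ha hz i (sq_nonneg t)
  have hpos : 0 < ‖z‖ ^ 2 + t ^ 2 := by positivity
  have h2 : ‖(t : ℂ) ^ (2 * i)‖ ≤ (‖z‖ ^ 2 + t ^ 2) ^ (i : ℝ) := by
    rw [norm_pow, Complex.norm_real, pow_mul, Real.norm_eq_abs, sq_abs, Real.rpow_natCast]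
    gcongr
    nlinarith
  have h3 : (z.re / ‖z‖) ^ (-(a + i)) ≤ (z.re / ‖z‖) ^ (-(a + n)) := by
    refine Real.rpow_le_rpow_of_exponent_ge (by positivity) re_div_norm_le_one ?_
    have : (i : ℝ) ≤ n := by exact_mod_cast hi
    linarith
  rw [norm_mul]
  calc _ ≤ (‖z‖ ^ 2 + t ^ 2) ^ (i : ℝ) * (Real.Gamma (a + i) * ((z.re / ‖z‖) ^ (-(a + n)) *
      (‖z‖ ^ 2 + t ^ 2) ^ (-(a + i)))) := by
        refine mul_le_mul h2 (h1.trans ?_) (norm_nonneg _) (by positivity)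
        gcongr
    _ = Real.Gamma (a + i) * (z.re / ‖z‖) ^ (-(a + n)) * ((‖z‖ ^ 2 + t ^ 2) ^ (i : ℝ) *
      (‖z‖ ^ 2 + t ^ 2) ^ (-(a + i))) := by ring
    _ = _ := by
      rw [← Real.rpow_add hpos]; congr 2; ring

theorem continuous_mainTower {a : ℝ} {z : ℂ} (hz : 0 < z.re) (i : ℕ) :
    Continuous fun t : ℝ => mainTower a z i (t ^ 2) := by
  refine continuous_const.mul (Continuous.cpow (by fun_prop) continuous_const fun t => ?_)
  exact sq_add_mem_slitPlane hz (sq_nonneg t)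

theorem isTower_mainTower {a : ℝ} (ha : 1 / 2 < a) {z : ℂ} (hz : 0 < z.re) :
    IsTower (mainTower a z) a := by
  have ha0 : 0 < a := by linarith
  have hz0 : 0 < ‖z‖ := norm_pos_iff.2 (by rintro rfl; simp at hz)
  refine ⟨fun i x hx => hasDerivAt_mainTower ha0 hz i hx.le, fun i δ hδ => ?_, fun i => ?_⟩
  · refine ⟨Real.Gamma (a + i) * (z.re / ‖z‖) ^ (-(a + i)), fun x hx => ?_⟩
    have hx0 : 0 < x := hδ.trans_le hx
    have hg : 0 < Real.Gamma (a + i) := Real.Gamma_pos_of_pos (by positivity)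
    refine (norm_mainTower_le ha0 hz i hx0.le).trans ?_
    rw [mul_assoc, ← neg_add' a]
    gcongr ?_ * (?_ * ?_)
    refine Real.rpow_le_rpow_of_nonpos hx0 (by nlinarith) ?_
    have : (0 : ℝ) ≤ i := by positivity
    linarith
  · refine Integrable.mono' ((integrableOn_sq_add_sq_rpow ha hz0).const_mul
      (Real.Gamma (a + i) * (z.re / ‖z‖) ^ (-(a + i)))) ?_ (Eventually.of_forall fun t =>
        norm_pow_mul_mainTower_le ha0 hz le_rfl t)
    exact (Continuous.mul (by fun_prop) (continuous_mainTower hz i)).aestronglyMeasurable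

/-- The constant in the bound for the Weyl kernels. -/
def weylConst (n : ℕ) (a : ℝ) : ℝ :=
  ∑ i ∈ Finset.range (n + 1), |towerCoeff n i| * Real.Gamma (a + i)

theorem weylConst_nonneg {n : ℕ} {a : ℝ} (ha : 0 < a) : 0 ≤ weylConst n a :=
  Finset.sum_nonneg fun _ _ => mul_nonneg (abs_nonneg _) (Real.Gamma_pos_of_pos (by positivity)).le

theorem norm_weylKernel_mainTower_le {a : ℝ} (ha : 0 < a) {z : ℂ} (hz : 0 < z.re) (n : ℕ) (t : ℝ) :
    ‖weylKernel n (mainTower a z) t‖ ≤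
      weylConst n a * (z.re / ‖z‖) ^ (-(a + n)) * (‖z‖ ^ 2 + t ^ 2) ^ (-a) := by
  rw [weylKernel, norm_mul, norm_pow, norm_neg, norm_one, one_pow, one_mul, weylConst,
    Finset.sum_mul, Finset.sum_mul]
  refine norm_sum_le_of_le _ fun i hi => ?_
  rw [norm_mul, Complex.norm_real, Real.norm_eq_abs, mul_assoc, mul_assoc]
  refine mul_le_mul_of_nonneg_left ?_ (abs_nonneg _)
  rw [← mul_assoc]
  exact norm_pow_mul_mainTower_le ha hz (Finset.mem_range_succ_iff.1 hi) t

theorem hasDerivAt_weylKernel_mainTower {a : ℝ} (ha : 0 < a) {z : ℂ} (hz : 0 < z.re) (n : ℕ)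
    (t : ℝ) : HasDerivAt (fun z => weylKernel n (mainTower a z) t)
      (-2 * z * weylKernel n (mainTower (a + 1) z) t) z := by
  have h1 := (HasDerivAt.fun_sum (u := Finset.range (n + 1)) fun i _ =>
    ((hasDerivAt_mainTower_left ha hz i (sq_nonneg t)).const_mul
      ((t : ℂ) ^ (2 * i))).const_mul (towerCoeff n i : ℂ)).const_mul ((-1 : ℂ) ^ n)
  refine h1.congr_deriv ?_
  rw [weylKernel, towerSum, mul_left_comm, Finset.mul_sum _ _ (-2 * z)]
  congr 1
  refine Finset.sum_congr rfl fun i _ => ?_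
  ring

/-! ### The operators `mainOp` and their holomorphy in operator norm. -/

section Family

variable {X : Type*} [NormedAddCommGroup X] [NormedSpace ℂ X] {B : ℝ → X →L[ℂ] X} {N : ℝ}

/-- The operator with Weyl kernel generated by `Γ(a) (z² + t²)^{-a}`. -/
def mainOp (B : ℝ → X →L[ℂ] X) (N : ℝ) (n : ℕ) (a : ℝ) (z : ℂ) : X →L[ℂ] X :=
  kernelOp B N (weylKernel n (mainTower a z))

/-- The dilation `t ↦ |z| t` extracts the power `|z|^(1-2a)` from the `L¹` norm of the kernel; the
remaining dependence on `z` is through the aperture only. -/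
theorem norm_mainOp_le (hB : IsBoundedFamily B N) (n : ℕ) {a : ℝ} (ha : 1 / 2 < a) {z : ℂ}
    (hz : 0 < z.re) : ‖mainOp B N n a z‖ ≤
      N * (weylConst n a * ∫ t in Set.Ioi (0 : ℝ), (1 + t ^ 2) ^ (-a)) *
        (z.re / ‖z‖) ^ (-(a + n)) * ‖z‖ ^ (1 - 2 * a) := by
  have hz0 : 0 < ‖z‖ := norm_pos_iff.2 (by rintro rfl; simp at hz)
  refine (norm_kernelOp_le hB ((isTower_mainTower ha hz).integrableOn_weylKernel n)).trans ?_
  have h1 : ∫ t in Set.Ioi (0 : ℝ), ‖weylKernel n (mainTower a z) t‖ ≤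
      ∫ t in Set.Ioi (0 : ℝ), weylConst n a * (z.re / ‖z‖) ^ (-(a + n)) *
        (‖z‖ ^ 2 + t ^ 2) ^ (-a) :=
    integral_mono ((isTower_mainTower ha hz).integrableOn_weylKernel n).norm
      ((integrableOn_sq_add_sq_rpow ha hz0).const_mul _)
      fun t => norm_weylKernel_mainTower_le (by linarith) hz n t
  rw [integral_const_mul, integral_sq_add_sq_rpow hz0] at h1
  calc _ ≤ N * _ := mul_le_mul_of_nonneg_left h1 hB.nonneg
    _ = _ := by ring

theorem hasDerivAt_mainOp_apply (hB : IsBoundedFamily B N) (n : ℕ) {a : ℝ} (ha : 1 / 2 < a) {z₀ : ℂ}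
    (hz₀ : 0 < z₀.re) (f : X) :
    HasDerivAt (fun z => mainOp B N n a z f) ((-2 * z₀) • mainOp B N n (a + 1) z₀ f) z₀ := by
  have ha0 : 0 < a := by linarith
  have hn0 : 0 < ‖z₀‖ := norm_pos_iff.2 (by rintro rfl; simp at hz₀)
  -- On `S` both `|z|` and `Re z / |z|` stay away from `0`, the latter above `m`, so one majorant in
  -- `t` serves for all `z` in `S`.
  set S : Set ℂ := {z | z₀.re / 2 < z.re ∧ ‖z‖ < 2 * ‖z₀‖} with hS
  have hSo : S ∈ 𝓝 z₀ := by
    refine IsOpen.mem_nhds ((isOpen_lt continuous_const Complex.continuous_re).inter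
      (isOpen_lt continuous_norm continuous_const)) ⟨?_, ?_⟩
    · exact half_lt_self hz₀
    · exact (lt_mul_iff_one_lt_left hn0).2 one_lt_two
  have hint : ∀ b : ℝ, 1 / 2 < b → ∀ z : ℂ, 0 < z.re →
      IntegrableOn (weylKernel n (mainTower b z)) (Set.Ioi 0) :=
    fun b hb z hz => (isTower_mainTower hb hz).integrableOn_weylKernel n
  set m := z₀.re / 2 / (2 * ‖z₀‖) with hm
  have hm0 : 0 < m := by positivity
  have hr0 : 0 < z₀.re / 2 := by positivity
  have h1 := (hasDerivAt_integral_of_dominated_loc_of_deriv_le (𝕜 := ℂ) (x₀ := z₀)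
    (F := fun z t => weylKernel n (mainTower a z) t • B t f)
    (F' := fun z t => (-2 * z * weylKernel n (mainTower (a + 1) z) t) • B t f)
    (bound := fun t => 4 * ‖z₀‖ * (weylConst n (a + 1) * m ^ (-(a + 1 + n))) * (N * ‖f‖) *
      ((z₀.re / 2) ^ 2 + t ^ 2) ^ (-(a + 1)))
    hSo ?_ (hB.integrableOn_smul (hint a ha z₀ hz₀) f) ?_ ?_ ?_ ?_).2
  · have e2 : ∫ t in Set.Ioi (0 : ℝ), (-2 * z₀ * weylKernel n (mainTower (a + 1) z₀) t) • B t f =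
        (-2 * z₀) • mainOp B N n (a + 1) z₀ f := by
      simp_rw [← smul_smul (-2 * z₀)]
      rw [integral_smul, mainOp, kernelOp_apply hB (hint (a + 1) (by linarith) z₀ hz₀)]
    rw [← e2]
    refine h1.congr_of_eventuallyEq ?_
    filter_upwards [hSo] with z hz
    rw [mainOp, kernelOp_apply hB (hint a ha z (hr0.trans hz.1))]
  · filter_upwards [hSo] with z hz using
      (hB.integrableOn_smul (hint a ha z (hr0.trans hz.1)) f).aestronglyMeasurable
  · exact (hB.integrableOn_smul ((hint (a + 1) (by linarith) z₀ hz₀).const_mul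
      (-2 * z₀)) f).aestronglyMeasurable
  · filter_upwards [ae_restrict_mem measurableSet_Ioi] with t ht z hz
    have hzr : 0 < z.re := hr0.trans hz.1
    have hz0 : 0 < ‖z‖ := norm_pos_iff.2 (by rintro rfl; simp at hzr)
    have hw := weylConst_nonneg (n := n) (a := a + 1) (by linarith)
    have hk := norm_weylKernel_mainTower_le (a := a + 1) (by linarith) hzr n t
    have hB1 := (B t).le_of_opNorm_le (hB.bound t ht) f
    have hN := hB.nonneg
    have hmz : m ≤ z.re / ‖z‖ := by
      rw [hm]
      exact div_le_div₀ hzr.le hz.1.le hz0 hz.2.le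
    have h3 : (z.re / ‖z‖) ^ (-(a + 1 + n)) ≤ m ^ (-(a + 1 + n)) :=
      Real.rpow_le_rpow_of_nonpos hm0 hmz (by
        have : (0 : ℝ) ≤ n := by positivity
        linarith)
    have h4 : (‖z‖ ^ 2 + t ^ 2) ^ (-(a + 1)) ≤ ((z₀.re / 2) ^ 2 + t ^ 2) ^ (-(a + 1)) := by
      refine Real.rpow_le_rpow_of_nonpos (by positivity) ?_ (by linarith)
      have : z₀.re / 2 ≤ ‖z‖ := hz.1.le.trans (Complex.re_le_norm z)
      gcongr
    have h5 : ‖(-2 : ℂ) * z‖ ≤ 4 * ‖z₀‖ := by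
      rw [norm_mul, norm_neg, Complex.norm_ofNat]
      linarith [hz.2]
    rw [norm_smul, norm_mul]
    calc _ ≤ 4 * ‖z₀‖ * (weylConst n (a + 1) * m ^ (-(a + 1 + n)) *
          ((z₀.re / 2) ^ 2 + t ^ 2) ^ (-(a + 1))) * (N * ‖f‖) := by
          refine mul_le_mul (mul_le_mul h5 (hk.trans ?_) (norm_nonneg _) (by positivity)) hB1
            (norm_nonneg _) (by positivity)
          gcongr
      _ = _ := by ring
  · exact (integrableOn_sq_add_sq_rpow (by linarith) hr0).const_mul _
  · refine Eventually.of_forall fun t z hz => ?_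
    exact (hasDerivAt_weylKernel_mainTower ha0 (hr0.trans hz.1) n t).smul_const _

end Family

/-- Strong differentiability, with a second strong derivative that is locally bounded, implies
differentiability in the operator norm. -/
theorem hasDerivAt_of_forall_apply {X : Type*} [NormedAddCommGroup X] [NormedSpace ℂ X]
    {V V' V'' : ℂ → X →L[ℂ] X} {z₀ : ℂ} {K : ℝ}
    (h1 : ∀ᶠ z in 𝓝 z₀, ∀ f, HasDerivAt (fun z => V z f) (V' z f) z)
    (h2 : ∀ᶠ z in 𝓝 z₀, ∀ f, HasDerivAt (fun z => V' z f) (V'' z f) z)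
    (h3 : ∀ᶠ z in 𝓝 z₀, ‖V'' z‖ ≤ K) : HasDerivAt V (V' z₀) z₀ := by
  obtain ⟨r, hr, hball⟩ := Metric.eventually_nhds_iff_ball.1 (h1.and (h2.and h3))
  have hK : 0 ≤ K := (norm_nonneg _).trans (hball z₀ (Metric.mem_ball_self hr)).2.2
  -- Two applications of the mean value inequality, first to `V' f` and then to `V f` minus its
  -- linear part, give a quadratic remainder proportional to `‖f‖`, hence an operator-norm estimate.
  have key : ∀ z ∈ Metric.ball z₀ r, ‖V z - V z₀ - (z - z₀) • V' z₀‖ ≤ K * ‖z - z₀‖ ^ 2 := by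
    intro z hz
    refine ContinuousLinearMap.opNorm_le_bound _ (by positivity) fun f => ?_
    set s := ‖z - z₀‖ with hs
    have hsub : Metric.closedBall z₀ s ⊆ Metric.ball z₀ r := by
      refine Metric.closedBall_subset_ball ?_
      rwa [hs, ← dist_eq_norm]
    have hz₀ : z₀ ∈ Metric.closedBall z₀ s := Metric.mem_closedBall_self (norm_nonneg _)
    have hz' : z ∈ Metric.closedBall z₀ s := by rw [Metric.mem_closedBall, dist_eq_norm]
    have hd' : ∀ y ∈ Metric.closedBall z₀ s, ‖V' y f - V' z₀ f‖ ≤ K * ‖f‖ * s := by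
      intro y hy
      refine ((convex_closedBall z₀ s).norm_image_sub_le_of_norm_hasDerivWithin_le
        (fun w hw => ((hball w (hsub hw)).2.1 f).hasDerivWithinAt)
        (fun w hw => (V'' w).le_of_opNorm_le (hball w (hsub hw)).2.2 f) hz₀ hy).trans ?_
      gcongr
      rwa [← dist_eq_norm]
    have hd : ∀ y ∈ Metric.closedBall z₀ s, HasDerivWithinAt (fun y => V y f - y • V' z₀ f)
        (V' y f - V' z₀ f) (Metric.closedBall z₀ s) y := by
      intro y hy
      have h := ((hball y (hsub hy)).1 f).sub ((hasDerivAt_id y).smul_const (V' z₀ f))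
      rw [one_smul] at h
      exact h.hasDerivWithinAt
    have := (convex_closedBall z₀ s).norm_image_sub_le_of_norm_hasDerivWithin_le hd hd' hz₀ hz'
    calc ‖(V z - V z₀ - (z - z₀) • V' z₀) f‖
        = ‖V z f - z • V' z₀ f - (V z₀ f - z₀ • V' z₀ f)‖ := by
          congr 1
          simp only [sub_apply, smul_apply, sub_smul]
          abel
      _ ≤ _ := this
      _ = _ := by ring
  rw [hasDerivAt_iff_isLittleO]
  have hO : (fun z => V z - V z₀ - (z - z₀) • V' z₀) =O[𝓝 z₀] fun z => (z - z₀) ^ 2 := by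
    refine Asymptotics.IsBigO.of_bound K ?_
    filter_upwards [Metric.ball_mem_nhds z₀ hr] with z hz
    rw [norm_pow]
    exact key z hz
  refine hO.trans_isLittleO ?_
  have h4 : Tendsto (fun z : ℂ => z - z₀) (𝓝 z₀) (𝓝 0) := by
    have : Tendsto (fun z : ℂ => z - z₀) (𝓝 z₀) (𝓝 (z₀ - z₀)) := tendsto_id.sub_const z₀
    rwa [sub_self] at this
  exact (Asymptotics.isLittleO_pow_id (𝕜 := ℂ) one_lt_two).comp_tendsto h4

section Family

variable {X : Type*} [NormedAddCommGroup X] [NormedSpace ℂ X] {B : ℝ → X →L[ℂ] X} {N : ℝ}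

theorem hasDerivAt_mainOp (hB : IsBoundedFamily B N) (n : ℕ) {a : ℝ} (ha : 1 / 2 < a) {z₀ : ℂ}
    (hz₀ : 0 < z₀.re) :
    HasDerivAt (mainOp B N n a) ((-2 * z₀) • mainOp B N n (a + 1) z₀) z₀ := by
  have hpos : ∀ᶠ z : ℂ in 𝓝 z₀, 0 < z.re :=
    (isOpen_lt continuous_const Complex.continuous_re).mem_nhds hz₀
  obtain ⟨g, hg⟩ : ∃ g : ℂ → ℝ, g = fun z : ℂ => 2 * (N * (weylConst n (a + 1) *
      ∫ t in Set.Ioi (0 : ℝ), (1 + t ^ 2) ^ (-(a + 1))) * (z.re / ‖z‖) ^ (-(a + 1 + n)) *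
      ‖z‖ ^ (1 - 2 * (a + 1))) + 4 * ‖z‖ ^ 2 * (N * (weylConst n (a + 2) *
      ∫ t in Set.Ioi (0 : ℝ), (1 + t ^ 2) ^ (-(a + 2))) * (z.re / ‖z‖) ^ (-(a + 2 + n)) *
      ‖z‖ ^ (1 - 2 * (a + 2))) := ⟨_, rfl⟩
  have hcont : ContinuousAt g z₀ := by
    rw [hg]
    have hn0 : 0 < ‖z₀‖ := norm_pos_iff.2 (by rintro rfl; simp at hz₀)
    have hq : ContinuousAt (fun z : ℂ => z.re / ‖z‖) z₀ :=
      Complex.continuous_re.continuousAt.div continuous_norm.continuousAt hn0.ne'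
    have hp : ∀ b : ℝ, ContinuousAt (fun z : ℂ => (z.re / ‖z‖) ^ b) z₀ := fun b =>
      hq.rpow_const (Or.inl (by positivity))
    have hp' : ∀ b : ℝ, ContinuousAt (fun z : ℂ => ‖z‖ ^ b) z₀ := fun b =>
      continuous_norm.continuousAt.rpow_const (Or.inl hn0.ne')
    exact (continuousAt_const.mul ((continuousAt_const.mul (hp _)).mul (hp' _))).add
      ((continuousAt_const.mul (continuous_norm.continuousAt.pow 2)).mul
        ((continuousAt_const.mul (hp _)).mul (hp' _)))
  refine hasDerivAt_of_forall_apply (V' := fun z => (-2 * z) • mainOp B N n (a + 1) z)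
    (V'' := fun z => (-2 : ℂ) • mainOp B N n (a + 1) z + (4 * z ^ 2) • mainOp B N n (a + 2) z)
    (K := g z₀ + 1) ?_ ?_ ?_
  · filter_upwards [hpos] with z hz f using hasDerivAt_mainOp_apply hB n ha hz f
  · filter_upwards [hpos] with z hz f
    have h1 := hasDerivAt_mainOp_apply hB n (a := a + 1) (by linarith) hz f
    have h2 : HasDerivAt (fun z : ℂ => -2 * z) (-2) z := by
      simpa using (hasDerivAt_id z).const_mul (-2 : ℂ)
    refine (h2.smul h1).congr_deriv ?_
    simp only [add_apply, smul_apply]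
    rw [smul_smul, add_comm, show a + 1 + 1 = a + 2 by ring]
    congr 2; ring
  · filter_upwards [hpos, hcont.eventually (eventually_lt_nhds (lt_add_one _))] with z hz hlt
    refine le_trans ?_ hlt.le
    rw [hg]
    refine (norm_add_le _ _).trans (add_le_add ?_ ?_)
    · rw [norm_smul, norm_neg, Complex.norm_ofNat]
      gcongr
      exact norm_mainOp_le hB n (by linarith) hz
    · rw [norm_smul, norm_mul, norm_pow, Complex.norm_ofNat]
      gcongr
      exact norm_mainOp_le hB n (by linarith) hz

/-! ### Kernels and operators integrated over the dilations `√r z` with `0 < r ≤ 1`. -/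

theorem sqrt_mul_re_pos {z : ℂ} (hz : 0 < z.re) {r : ℝ} (hr : 0 < r) : 0 < ((√r : ℂ) * z).re := by
  rw [Complex.re_ofReal_mul]
  exact mul_pos (Real.sqrt_pos.2 hr) hz

theorem sqrt_mul_re_div_norm (z : ℂ) {r : ℝ} (hr : 0 < r) :
    ((√r : ℂ) * z).re / ‖(√r : ℂ) * z‖ = z.re / ‖z‖ := by
  rw [Complex.re_ofReal_mul, norm_mul, Complex.norm_real, Real.norm_of_nonneg (Real.sqrt_nonneg r),
    mul_div_mul_left _ _ (Real.sqrt_pos.2 hr).ne']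

theorem norm_sqrt_mul_sq (z : ℂ) (r : ℝ) : ‖(√r : ℂ) * z‖ ^ 2 = (√r * ‖z‖) ^ 2 := by
  rw [norm_mul, Complex.norm_real, Real.norm_of_nonneg (Real.sqrt_nonneg r)]

theorem continuousOn_mainTower_sqrt {a : ℝ} {z : ℂ} (hz : 0 < z.re) (i : ℕ) {x : ℝ} (hx : 0 ≤ x) :
    ContinuousOn (fun r : ℝ => mainTower a ((√r : ℂ) * z) i x) (Set.Ioi 0) := by
  refine continuousOn_const.mul (ContinuousOn.cpow (Continuous.continuousOn ?_)
    continuousOn_const fun r hr => sq_add_mem_slitPlane (sqrt_mul_re_pos hz hr) hx)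
  have := Complex.continuous_ofReal.comp Real.continuous_sqrt
  exact ((this.mul continuous_const).pow 2).add continuous_const

/-- The successive derivatives of `x ↦ Γ(a) ∫_0^1 z² (r z² + x)^{-a} dr`. -/
def diffTower (a : ℝ) (z : ℂ) (i : ℕ) (x : ℝ) : ℂ :=
  ∫ r in Set.Ioc (0 : ℝ) 1, z ^ 2 * mainTower a ((√r : ℂ) * z) i x

theorem norm_mainTower_sqrt_le {a : ℝ} (ha : 0 < a) {z : ℂ} (hz : 0 < z.re) (i : ℕ) {x δ r : ℝ}
    (hδ : 0 < δ) (hx : δ ≤ x) (hr : 0 < r) : ‖z ^ 2 * mainTower a ((√r : ℂ) * z) i x‖ ≤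
      ‖z‖ ^ 2 * (Real.Gamma (a + i) * ((z.re / ‖z‖) ^ (-(a + i)) * δ ^ (-(a + i)))) := by
  have hz0 : 0 < ‖z‖ := norm_pos_iff.2 (by rintro rfl; simp at hz)
  have hg : 0 < Real.Gamma (a + i) := Real.Gamma_pos_of_pos (by positivity)
  rw [norm_mul, norm_pow]
  have h1 := norm_mainTower_le ha (sqrt_mul_re_pos hz hr) i (hδ.le.trans hx)
  rw [sqrt_mul_re_div_norm z hr] at h1
  refine mul_le_mul_of_nonneg_left (h1.trans ?_) (by positivity)
  gcongr ?_ * (?_ * ?_)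
  exact Real.rpow_le_rpow_of_nonpos hδ (by nlinarith [sq_nonneg ‖(√r : ℂ) * z‖])
    (by rw [neg_nonpos]; positivity)

theorem hasDerivAt_diffTower {a : ℝ} (ha : 0 < a) {z : ℂ} (hz : 0 < z.re) (i : ℕ) {x : ℝ}
    (hx : 0 < x) : HasDerivAt (diffTower a z i) (diffTower a z (i + 1) x) x := by
  have hmeas : ∀ (i : ℕ) (x : ℝ), 0 < x → AEStronglyMeasurable
      (fun r : ℝ => z ^ 2 * mainTower a ((√r : ℂ) * z) i x) (volume.restrict (Set.Ioc 0 1)) :=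
    fun i x hx => (continuousOn_const.mul ((continuousOn_mainTower_sqrt hz i hx.le).mono
      Set.Ioc_subset_Ioi_self)).aestronglyMeasurable measurableSet_Ioc
  refine (hasDerivAt_integral_of_dominated_loc_of_deriv_le (𝕜 := ℝ) (x₀ := x)
    (F := fun x r => z ^ 2 * mainTower a ((√r : ℂ) * z) i x)
    (F' := fun x r => z ^ 2 * mainTower a ((√r : ℂ) * z) (i + 1) x) (s := Set.Ioi (x / 2))
    (bound := fun _ => ‖z‖ ^ 2 * (Real.Gamma (a + (i + 1 : ℕ)) *
      ((z.re / ‖z‖) ^ (-(a + (i + 1 : ℕ))) * (x / 2) ^ (-(a + (i + 1 : ℕ))))))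
    (Ioi_mem_nhds (half_lt_self hx)) ?_ ?_ (hmeas _ _ hx) ?_ (integrableOn_const (by simp)) ?_).2
  · filter_upwards [lt_mem_nhds hx] with y hy using hmeas _ _ hy
  · refine Integrable.mono' (integrableOn_const (by simp) (C := ‖z‖ ^ 2 * (Real.Gamma (a + i) *
      ((z.re / ‖z‖) ^ (-(a + i)) * x ^ (-(a + i)))))) (hmeas _ _ hx) ?_
    filter_upwards [ae_restrict_mem measurableSet_Ioc] with r hr
    exact norm_mainTower_sqrt_le ha hz i hx le_rfl hr.1
  · filter_upwards [ae_restrict_mem measurableSet_Ioc] with r hr y hy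
    exact norm_mainTower_sqrt_le ha hz (i + 1) (half_pos hx) (le_of_lt hy) hr.1
  · filter_upwards [ae_restrict_mem measurableSet_Ioc] with r hr y hy
    exact (hasDerivAt_mainTower ha (sqrt_mul_re_pos hz hr.1) i
      ((half_pos hx).le.trans (le_of_lt hy))).const_mul _

/-- The `t`-integral converges because `a > 1/2` and is a multiple of `r^(1/2-a)`, which is
integrable at `0` because `a < 3/2`. -/
theorem integrable_mul_sq_add_sq_rpow {a ρ : ℝ} (ha : 1 / 2 < a) (ha' : a < 3 / 2) (hρ : 0 < ρ) :
    Integrable (Function.uncurry fun r t : ℝ => ((√r * ρ) ^ 2 + t ^ 2) ^ (-a))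
      ((volume.restrict (Set.Ioc 0 1)).prod (volume.restrict (Set.Ioi 0))) := by
  have hc : ContinuousOn (Function.uncurry fun r t : ℝ => ((√r * ρ) ^ 2 + t ^ 2) ^ (-a))
      (Set.Ioc 0 1 ×ˢ Set.Ioi 0) := by
    refine ContinuousOn.rpow_const (by fun_prop) fun q hq => Or.inl ?_
    have : (0 : ℝ) < q.2 := hq.2
    positivity
  have hm : AEStronglyMeasurable (Function.uncurry fun r t : ℝ => ((√r * ρ) ^ 2 + t ^ 2) ^ (-a))
      ((volume.restrict (Set.Ioc 0 1)).prod (volume.restrict (Set.Ioi 0))) := by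
    rw [Measure.prod_restrict]
    exact hc.aestronglyMeasurable (measurableSet_Ioc.prod measurableSet_Ioi)
  refine (integrable_prod_iff hm).2 ⟨?_, ?_⟩
  · filter_upwards [ae_restrict_mem measurableSet_Ioc] with r hr
    simp only [Function.uncurry_apply_pair]
    exact integrableOn_sq_add_sq_rpow ha (mul_pos (Real.sqrt_pos.2 hr.1) hρ)
  · have h1 : IntegrableOn (fun r : ℝ => r ^ (1 / 2 - a)) (Set.Ioc 0 1) :=
      (intervalIntegrable_iff_integrableOn_Ioc_of_le zero_le_one).1
        (intervalIntegral.intervalIntegrable_rpow' (by linarith))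
    refine (h1.mul_const (ρ ^ (1 - 2 * a) *
      ∫ t in Set.Ioi (0 : ℝ), (1 + t ^ 2) ^ (-a))).congr ?_
    filter_upwards [ae_restrict_mem measurableSet_Ioc] with r hr
    have h2 : ∀ t : ℝ, ‖((√r * ρ) ^ 2 + t ^ 2) ^ (-a)‖ = ((√r * ρ) ^ 2 + t ^ 2) ^ (-a) :=
      fun t => Real.norm_of_nonneg (by positivity)
    simp only [Function.uncurry, h2]
    rw [integral_sq_add_sq_rpow (mul_pos (Real.sqrt_pos.2 hr.1) hρ),
      Real.mul_rpow (Real.sqrt_nonneg r) hρ.le, Real.sqrt_eq_rpow, ← Real.rpow_mul hr.1.le]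
    ring_nf

theorem continuousOn_uncurry_mainTower_sqrt {a : ℝ} {z : ℂ} (hz : 0 < z.re) (i : ℕ) :
    ContinuousOn (Function.uncurry fun r t : ℝ => mainTower a ((√r : ℂ) * z) i (t ^ 2))
      (Set.Ioc 0 1 ×ˢ Set.Ioi 0) := by
  refine continuousOn_const.mul (ContinuousOn.cpow (Continuous.continuousOn ?_)
    continuousOn_const fun q hq => sq_add_mem_slitPlane (sqrt_mul_re_pos hz hq.1.1) (sq_nonneg _))
  have := Complex.continuous_ofReal.comp
    (Real.continuous_sqrt.comp (continuous_fst (X := ℝ) (Y := ℝ)))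
  exact ((this.mul continuous_const).pow 2).add (by fun_prop)

theorem integrable_mainTower_sqrt {a : ℝ} (ha : 1 / 2 < a) (ha' : a < 3 / 2) {z : ℂ}
    (hz : 0 < z.re) (i : ℕ) :
    Integrable (Function.uncurry fun r t : ℝ =>
      z ^ 2 * ((t : ℂ) ^ (2 * i) * mainTower a ((√r : ℂ) * z) i (t ^ 2)))
      ((volume.restrict (Set.Ioc 0 1)).prod (volume.restrict (Set.Ioi 0))) := by
  have hz0 : 0 < ‖z‖ := norm_pos_iff.2 (by rintro rfl; simp at hz)
  refine Integrable.mono' ((integrable_mul_sq_add_sq_rpow ha ha' hz0).const_mul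
    (‖z‖ ^ 2 * (Real.Gamma (a + i) * (z.re / ‖z‖) ^ (-(a + i))))) ?_ ?_
  · rw [Measure.prod_restrict]
    refine ContinuousOn.aestronglyMeasurable ?_ (measurableSet_Ioc.prod measurableSet_Ioi)
    exact continuousOn_const.mul (ContinuousOn.mul (by fun_prop)
      (continuousOn_uncurry_mainTower_sqrt hz i))
  · rw [Measure.prod_restrict]
    filter_upwards [ae_restrict_mem (measurableSet_Ioc.prod measurableSet_Ioi)] with q hq
    obtain ⟨r, t⟩ := q
    have h1 := norm_pow_mul_mainTower_le (a := a) (by linarith)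
      (sqrt_mul_re_pos hz hq.1.1) (le_refl i) t
    rw [sqrt_mul_re_div_norm z hq.1.1, norm_sqrt_mul_sq z r] at h1
    simp only [Function.uncurry]
    rw [norm_mul, norm_pow, mul_assoc]
    exact mul_le_mul_of_nonneg_left h1 (by positivity)

theorem isTower_diffTower {a : ℝ} (ha : 1 / 2 < a) (ha' : a < 3 / 2) {z : ℂ} (hz : 0 < z.re) :
    IsTower (diffTower a z) a := by
  have ha0 : 0 < a := by linarith
  refine ⟨fun i x hx => hasDerivAt_diffTower ha0 hz i hx, fun i δ hδ => ?_, fun i => ?_⟩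
  · refine ⟨‖z‖ ^ 2 * (Real.Gamma (a + i) * (z.re / ‖z‖) ^ (-(a + i))), fun x hx => ?_⟩
    have hx0 : 0 < x := hδ.trans_le hx
    refine (norm_setIntegral_le_of_norm_le_const (C := ‖z‖ ^ 2 * (Real.Gamma (a + i) *
      ((z.re / ‖z‖) ^ (-(a + i)) * x ^ (-(a + i))))) (by simp)
      (fun r hr => norm_mainTower_sqrt_le ha0 hz i hx0 le_rfl hr.1)).trans (le_of_eq ?_)
    simp only [Measure.real, Real.volume_Ioc]
    rw [← neg_add' a]
    simp
    ring
  · refine Integrable.congr (integrable_mainTower_sqrt ha ha' hz i).integral_prod_right ?_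
    refine Eventually.of_forall fun t => ?_
    simp only [Function.uncurry, diffTower]
    rw [← integral_const_mul]
    congr 1
    ext r
    ring

theorem weylKernel_diffTower {a : ℝ} (ha : 0 < a) {z : ℂ} (hz : 0 < z.re) (n : ℕ) {t : ℝ}
    (ht : 0 < t) : weylKernel n (diffTower a z) t =
      ∫ r in Set.Ioc (0 : ℝ) 1, z ^ 2 * weylKernel n (mainTower a ((√r : ℂ) * z)) t := by
  have hi : ∀ i ∈ Finset.range (n + 1), IntegrableOn (fun r : ℝ => (towerCoeff n i : ℂ) *
      ((t : ℂ) ^ (2 * i) * (z ^ 2 * mainTower a ((√r : ℂ) * z) i (t ^ 2)))) (Set.Ioc 0 1) := by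
    intro i _
    refine Integrable.const_mul (Integrable.const_mul ?_ _) _
    refine Integrable.mono' (integrableOn_const (by simp) (C := ‖z‖ ^ 2 * (Real.Gamma (a + i) *
      ((z.re / ‖z‖) ^ (-(a + i)) * (t ^ 2) ^ (-(a + i))))))
      ((continuousOn_const.mul ((continuousOn_mainTower_sqrt hz i (sq_nonneg t)).mono
      Set.Ioc_subset_Ioi_self)).aestronglyMeasurable measurableSet_Ioc) ?_
    filter_upwards [ae_restrict_mem measurableSet_Ioc] with r hr
    exact norm_mainTower_sqrt_le ha hz i (pow_pos ht 2) le_rfl hr.1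
  have h1 : ∀ r : ℝ, z ^ 2 * weylKernel n (mainTower a ((√r : ℂ) * z)) t = (-1) ^ n *
      ∑ i ∈ Finset.range (n + 1), (towerCoeff n i : ℂ) *
        ((t : ℂ) ^ (2 * i) * (z ^ 2 * mainTower a ((√r : ℂ) * z) i (t ^ 2))) := by
    intro r
    rw [weylKernel, towerSum, mul_left_comm, Finset.mul_sum _ _ (z ^ 2)]
    congr 1
    refine Finset.sum_congr rfl fun i _ => by ring
  simp_rw [h1]
  rw [integral_const_mul, integral_finsetSum _ hi, weylKernel, towerSum]
  congr 1
  refine Finset.sum_congr rfl fun i _ => ?_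
  rw [integral_const_mul, integral_const_mul, diffTower]

/-- Fubini in `(t, r)`; the aperture of `√r z` does not depend on `r`, so the kernel bounds are
uniform up to scaling. -/
theorem kernelOp_diffTower [CompleteSpace X] (hB : IsBoundedFamily B N) (n : ℕ) {a : ℝ}
    (ha : 1 / 2 < a)
    (ha' : a < 3 / 2) {z : ℂ} (hz : 0 < z.re) (f : X) :
    kernelOp B N (weylKernel n (diffTower a z)) f =
      ∫ r in Set.Ioc (0 : ℝ) 1, z ^ 2 • mainOp B N n a ((√r : ℂ) * z) f := by
  have hz0 : 0 < ‖z‖ := norm_pos_iff.2 (by rintro rfl; simp at hz)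
  have ha0 : 0 < a := by linarith
  have hi : Integrable (Function.uncurry fun t r : ℝ =>
      (z ^ 2 * weylKernel n (mainTower a ((√r : ℂ) * z)) t) • B t f)
      ((volume.restrict (Set.Ioi 0)).prod (volume.restrict (Set.Ioc 0 1))) := by
    have hb := ((integrable_mul_sq_add_sq_rpow ha ha' hz0).swap.const_mul
      (‖z‖ ^ 2 * (weylConst n a * (z.re / ‖z‖) ^ (-(a + n))) * (N * ‖f‖)))
    refine Integrable.mono' hb ?_ ?_
    · refine AEStronglyMeasurable.smul ?_ (hB.meas f).comp_fst
      rw [Measure.prod_restrict]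
      refine ContinuousOn.aestronglyMeasurable ?_ (measurableSet_Ioi.prod measurableSet_Ioc)
      refine continuousOn_const.mul (continuousOn_const.mul (continuousOn_finsetSum _ fun i _ =>
        continuousOn_const.mul (ContinuousOn.mul (by fun_prop) ?_)))
      exact (continuousOn_uncurry_mainTower_sqrt hz i).comp (f := Prod.swap)
        continuous_swap.continuousOn fun q hq => ⟨hq.2, hq.1⟩
    · rw [Measure.prod_restrict]
      filter_upwards [ae_restrict_mem (measurableSet_Ioi.prod measurableSet_Ioc)] with q hq
      obtain ⟨t, r⟩ := q
      have hr : 0 < r := hq.2.1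
      have h1 := norm_weylKernel_mainTower_le ha0 (sqrt_mul_re_pos hz hr) n t
      rw [sqrt_mul_re_div_norm z hr, norm_sqrt_mul_sq z r] at h1
      simp only [Function.uncurry, Function.comp, Prod.swap]
      rw [norm_smul, norm_mul, norm_pow]
      have hB1 := (B t).le_of_opNorm_le (hB.bound t hq.1) f
      have hw := weylConst_nonneg (n := n) ha0
      calc _ ≤ ‖z‖ ^ 2 * (weylConst n a * (z.re / ‖z‖) ^ (-(a + n)) *
            ((√r * ‖z‖) ^ 2 + t ^ 2) ^ (-a)) * (N * ‖f‖) := by gcongr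
        _ = _ := by ring
  calc kernelOp B N (weylKernel n (diffTower a z)) f
      = ∫ t in Set.Ioi (0 : ℝ), ∫ r in Set.Ioc (0 : ℝ) 1,
          (z ^ 2 * weylKernel n (mainTower a ((√r : ℂ) * z)) t) • B t f := by
        rw [kernelOp_apply hB ((isTower_diffTower ha ha' hz).integrableOn_weylKernel n)]
        refine setIntegral_congr_fun measurableSet_Ioi fun t ht => ?_
        rw [weylKernel_diffTower ha0 hz n ht, integral_smul_const]
    _ = _ := by
        rw [integral_integral_swap hi]
        refine setIntegral_congr_fun measurableSet_Ioc fun r hr => ?_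
        rw [mainOp, kernelOp_apply hB
          ((isTower_mainTower ha (sqrt_mul_re_pos hz hr.1)).integrableOn_weylKernel n),
          ← integral_smul]
        simp_rw [smul_smul]

end Family

/-! ### Parabolic kernels and the heat kernel. -/

/-- A kernel on `(0, ∞)²` with the parabolic scaling bounds of the heat kernel. -/
structure IsParabolicKernel (k k' : ℝ → ℝ → ℂ) (K : ℝ) : Prop where
  cont : ContinuousOn (Function.uncurry k) (Set.Ioi 0 ×ˢ Set.Ioi 0)
  cont' : ∀ s : ℝ, 0 < s → ContinuousOn (k' s) (Set.Ioi 0)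
  bound : ∀ s : ℝ, 0 < s → ∀ t : ℝ, 0 < t → ‖k s t‖ ≤ K * (√s * (√s ^ 2 + t ^ 2) ^ (-1 : ℝ))
  bound' : ∀ s : ℝ, 0 < s → ∀ t : ℝ, 0 < t →
    ‖k' s t‖ ≤ K / s * (√s * (√s ^ 2 + t ^ 2) ^ (-1 : ℝ))
  hasDeriv : ∀ s : ℝ, 0 < s → ∀ t : ℝ, 0 < t → HasDerivAt (fun s => k s t) (k' s t) s

theorem integrableOn_sqrt_mul_rpow {s : ℝ} (hs : 0 < s) :
    IntegrableOn (fun t : ℝ => √s * (√s ^ 2 + t ^ 2) ^ (-1 : ℝ)) (Set.Ioi 0) :=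
  Integrable.const_mul (integrableOn_sq_add_sq_rpow (by norm_num) (Real.sqrt_pos.2 hs)) _

/-- With `t = √s τ` the `L¹` norm is independent of `s`. This is why the associated operators are
uniformly bounded and their `s`-derivatives are of order `1/s`. -/
theorem integral_sqrt_mul_rpow {s : ℝ} (hs : 0 < s) :
    ∫ t in Set.Ioi (0 : ℝ), √s * (√s ^ 2 + t ^ 2) ^ (-1 : ℝ) =
      ∫ t in Set.Ioi (0 : ℝ), (1 + t ^ 2) ^ (-1 : ℝ) := by
  have hs' := Real.sqrt_pos.2 hs
  rw [integral_const_mul, integral_sq_add_sq_rpow hs', ← mul_assoc,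
    show (1 : ℝ) - 2 * 1 = -1 by norm_num, Real.rpow_neg_one, mul_inv_cancel₀ hs'.ne', one_mul]

namespace IsParabolicKernel

variable {k k' : ℝ → ℝ → ℂ} {K : ℝ}

theorem nonneg (hk : IsParabolicKernel k k' K) : 0 ≤ K := by
  have h := (norm_nonneg _).trans (hk.bound 1 one_pos 1 one_pos)
  refine nonneg_of_mul_nonneg_left h (by positivity)

theorem continuousOn_right (hk : IsParabolicKernel k k' K) {s : ℝ} (hs : 0 < s) :
    ContinuousOn (k s) (Set.Ioi 0) :=
  hk.cont.comp (f := fun t : ℝ => (s, t)) (by fun_prop) fun _ ht => ⟨hs, ht⟩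

theorem integrableOn (hk : IsParabolicKernel k k' K) {s : ℝ} (hs : 0 < s) :
    IntegrableOn (k s) (Set.Ioi 0) := by
  refine Integrable.mono' ((integrableOn_sqrt_mul_rpow hs).const_mul K)
    ((hk.continuousOn_right hs).aestronglyMeasurable measurableSet_Ioi) ?_
  filter_upwards [ae_restrict_mem measurableSet_Ioi] with t ht using hk.bound s hs t ht

theorem integrableOn' (hk : IsParabolicKernel k k' K) {s : ℝ} (hs : 0 < s) :
    IntegrableOn (k' s) (Set.Ioi 0) := by
  refine Integrable.mono' ((integrableOn_sqrt_mul_rpow hs).const_mul (K / s))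
    ((hk.cont' s hs).aestronglyMeasurable measurableSet_Ioi) ?_
  filter_upwards [ae_restrict_mem measurableSet_Ioi] with t ht using hk.bound' s hs t ht

variable {X : Type*} [NormedAddCommGroup X] [NormedSpace ℂ X] {B : ℝ → X →L[ℂ] X} {N : ℝ}

theorem norm_op_le (hk : IsParabolicKernel k k' K) (hB : IsBoundedFamily B N) {s : ℝ} (hs : 0 < s) :
    ‖kernelOp B N (k s)‖ ≤ N * (K * ∫ t in Set.Ioi (0 : ℝ), (1 + t ^ 2) ^ (-1 : ℝ)) := by
  refine (norm_kernelOp_le hB (hk.integrableOn hs)).trans ?_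
  refine mul_le_mul_of_nonneg_left ?_ hB.nonneg
  rw [← integral_sqrt_mul_rpow hs, ← integral_const_mul]
  exact setIntegral_mono_on (hk.integrableOn hs).norm
    ((integrableOn_sqrt_mul_rpow hs).const_mul K) measurableSet_Ioi fun t ht => hk.bound s hs t ht

theorem norm_op_le' (hk : IsParabolicKernel k k' K) (hB : IsBoundedFamily B N) {s : ℝ}
    (hs : 0 < s) : ‖kernelOp B N (k' s)‖ ≤
      N * (K * ∫ t in Set.Ioi (0 : ℝ), (1 + t ^ 2) ^ (-1 : ℝ)) / s := by
  refine (norm_kernelOp_le hB (hk.integrableOn' hs)).trans ?_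
  rw [mul_div_assoc, mul_div_right_comm]
  refine mul_le_mul_of_nonneg_left ?_ hB.nonneg
  rw [← integral_sqrt_mul_rpow hs, ← integral_const_mul]
  exact setIntegral_mono_on (hk.integrableOn' hs).norm
    ((integrableOn_sqrt_mul_rpow hs).const_mul (K / s)) measurableSet_Ioi
    fun t ht => hk.bound' s hs t ht

theorem hasDerivAt_op (hk : IsParabolicKernel k k' K) (hB : IsBoundedFamily B N) {s : ℝ}
    (hs : 0 < s) (f : X) :
    HasDerivAt (fun s => kernelOp B N (k s) f) (kernelOp B N (k' s) f) s := by
  have hsub : ∀ r ∈ Set.Ioo (s / 2) (2 * s), 0 < r := fun r hr => (half_pos hs).trans hr.1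
  have hnhds : Set.Ioo (s / 2) (2 * s) ∈ 𝓝 s := Ioo_mem_nhds (half_lt_self hs) (by linarith)
  have hK := hk.nonneg
  have h1 := (hasDerivAt_integral_of_dominated_loc_of_deriv_le (𝕜 := ℝ) (x₀ := s)
    (μ := volume.restrict (Set.Ioi (0 : ℝ)))
    (F := fun s t => k s t • B t f) (F' := fun s t => k' s t • B t f)
    (bound := fun t => K / (s / 2) * (√(2 * s) * (√(s / 2) ^ 2 + t ^ 2) ^ (-1 : ℝ)) * (N * ‖f‖))
    hnhds ?_ (hB.integrableOn_smul (hk.integrableOn hs) f) ?_ ?_ ?_ ?_).2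
  · rw [kernelOp_apply hB (hk.integrableOn' hs)]
    refine h1.congr_of_eventuallyEq ?_
    filter_upwards [hnhds] with r hr
    rw [kernelOp_apply hB (hk.integrableOn (hsub r hr))]
  · filter_upwards [hnhds] with r hr using
      (hB.integrableOn_smul (hk.integrableOn (hsub r hr)) f).aestronglyMeasurable
  · exact (hB.integrableOn_smul (hk.integrableOn' hs) f).aestronglyMeasurable
  · filter_upwards [ae_restrict_mem measurableSet_Ioi] with t ht r hr
    have ht : (0 : ℝ) < t := ht
    have hr0 := hsub r hr
    have hB1 := (B t).le_of_opNorm_le (hB.bound t ht) f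
    rw [norm_smul]
    refine mul_le_mul ((hk.bound' r hr0 t ht).trans ?_) hB1 (norm_nonneg _) (by positivity)
    have h2 : (√r ^ 2 + t ^ 2) ^ (-1 : ℝ) ≤ (√(s / 2) ^ 2 + t ^ 2) ^ (-1 : ℝ) := by
      refine Real.rpow_le_rpow_of_nonpos (by positivity) ?_ (by norm_num)
      gcongr
      exact hr.1.le
    have h3 : √r ≤ √(2 * s) := Real.sqrt_le_sqrt hr.2.le
    have h4 : K / r ≤ K / (s / 2) := by
      have := hr.1.le
      gcongr
    gcongr
  · have hi := integrableOn_sq_add_sq_rpow (a := 1) (by norm_num) (Real.sqrt_pos.2 (half_pos hs))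
    exact ((hi.const_mul _).const_mul _).mul_const _
  · filter_upwards [ae_restrict_mem measurableSet_Ioi] with t ht r hr
    exact (hk.hasDeriv r (hsub r hr) t ht).smul_const _

/-- The `L¹` bound in `t`, uniform in `s`, makes the double integral absolutely convergent for every
continuous integrable weight `w`. -/
theorem integral_smul_op [CompleteSpace X] (hk : IsParabolicKernel k k' K)
    (hB : IsBoundedFamily B N) {w : ℝ → ℝ} (hw : IntegrableOn w (Set.Ioi 0))
    (hc : ContinuousOn w (Set.Ioi 0)) (f : X) :
    ∫ s in Set.Ioi (0 : ℝ), w s • kernelOp B N (k s) f =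
      ∫ t in Set.Ioi (0 : ℝ), (∫ s in Set.Ioi (0 : ℝ), (w s : ℂ) * k s t) • B t f := by
  have hbm : ContinuousOn (Function.uncurry fun s t : ℝ =>
      |w s| * (K * (√s * (√s ^ 2 + t ^ 2) ^ (-1 : ℝ))) * (N * ‖f‖)) (Set.Ioi 0 ×ˢ Set.Ioi 0) := by
    have h1 : ContinuousOn (fun q : ℝ × ℝ => |w q.1|) (Set.Ioi 0 ×ˢ Set.Ioi 0) :=
      (hc.comp continuousOn_fst fun q hq => hq.1).abs
    have h2 : ContinuousOn (fun q : ℝ × ℝ => (√q.1 ^ 2 + q.2 ^ 2) ^ (-1 : ℝ))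
        (Set.Ioi 0 ×ˢ Set.Ioi 0) := by
      refine ContinuousOn.rpow_const (by fun_prop) fun q hq => Or.inl ?_
      have : (0 : ℝ) < q.2 := hq.2
      positivity
    have h3 : ContinuousOn (fun q : ℝ × ℝ => √q.1) (Set.Ioi 0 ×ˢ Set.Ioi 0) := by fun_prop
    exact (h1.mul (continuousOn_const.mul (h3.mul h2))).mul continuousOn_const
  have hbi : Integrable (Function.uncurry fun s t : ℝ =>
      |w s| * (K * (√s * (√s ^ 2 + t ^ 2) ^ (-1 : ℝ))) * (N * ‖f‖))
      ((volume.restrict (Set.Ioi 0)).prod (volume.restrict (Set.Ioi 0))) := by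
    refine (integrable_prod_iff (aestronglyMeasurable_prod_Ioi hbm)).2 ⟨?_, ?_⟩
    · filter_upwards [ae_restrict_mem measurableSet_Ioi] with s hs
      simp only [Function.uncurry_apply_pair]
      exact (((integrableOn_sqrt_mul_rpow hs).const_mul _).const_mul _).mul_const _
    · refine Integrable.congr (hw.norm.mul_const
        (K * (∫ t in Set.Ioi (0 : ℝ), (1 + t ^ 2) ^ (-1 : ℝ)) * (N * ‖f‖))) ?_
      filter_upwards [ae_restrict_mem measurableSet_Ioi] with s hs
      have hK := hk.nonneg
      have hN := hB.nonneg
      have h2 : ∀ t : ℝ, ‖|w s| * (K * (√s * (√s ^ 2 + t ^ 2) ^ (-1 : ℝ))) * (N * ‖f‖)‖ =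
          |w s| * (K * (√s * (√s ^ 2 + t ^ 2) ^ (-1 : ℝ))) * (N * ‖f‖) :=
        fun t => Real.norm_of_nonneg (by positivity)
      simp only [Function.uncurry_apply_pair, h2]
      rw [integral_mul_const, integral_const_mul, integral_const_mul, integral_sqrt_mul_rpow hs,
        Real.norm_eq_abs]
      ring
  have hi : Integrable (Function.uncurry fun s t : ℝ => ((w s : ℂ) * k s t) • B t f)
      ((volume.restrict (Set.Ioi 0)).prod (volume.restrict (Set.Ioi 0))) := by
    have hwc : ContinuousOn (fun q : ℝ × ℝ => (w q.1 : ℂ) * k q.1 q.2)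
        (Set.Ioi 0 ×ˢ Set.Ioi 0) :=
      (Complex.continuous_ofReal.comp_continuousOn
        (hc.comp continuousOn_fst fun q hq => hq.1)).mul hk.cont
    refine Integrable.mono' hbi ((aestronglyMeasurable_prod_Ioi hwc).smul (hB.meas f).comp_snd) ?_
    rw [Measure.prod_restrict]
    filter_upwards [ae_restrict_mem (measurableSet_Ioi.prod measurableSet_Ioi)] with q hq
    obtain ⟨s, t⟩ := q
    simp only [Function.uncurry_apply_pair]
    rw [norm_smul, norm_mul, Complex.norm_real, Real.norm_eq_abs]
    have hB1 := (B t).le_of_opNorm_le (hB.bound t hq.2) f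
    have hb1 := hk.bound s hq.1 t hq.2
    have hK := hk.nonneg
    gcongr
  calc ∫ s in Set.Ioi (0 : ℝ), w s • kernelOp B N (k s) f
      = ∫ s in Set.Ioi (0 : ℝ), ∫ t in Set.Ioi (0 : ℝ), ((w s : ℂ) * k s t) • B t f := by
        refine setIntegral_congr_fun measurableSet_Ioi fun s hs => ?_
        rw [kernelOp_apply hB (hk.integrableOn hs), ← integral_smul]
        simp only [mul_smul, Complex.coe_smul]
    _ = _ := by
        rw [integral_integral_swap hi]
        simp only [integral_smul_const]

end IsParabolicKernel

/-- The successive derivatives of `x ↦ (π s)^{-1/2} e^{-x / (4 s)}`. -/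
def heatTower (s : ℝ) (i : ℕ) (x : ℝ) : ℂ :=
  (((√Real.pi)⁻¹ * (s ^ (-(1 / 2) : ℝ) * (-1 / (4 * s)) ^ i * Real.exp (-(x / (4 * s)))) : ℝ) : ℂ)

/-- The derivative of `heatTower` in the variable `s`. -/
def heatTower' (s : ℝ) (i : ℕ) (x : ℝ) : ℂ :=
  (((-(1 / 2) - i) / s + x / (4 * s ^ 2) : ℝ) : ℂ) * heatTower s i x

theorem hasDerivAt_heatTower {s : ℝ} (hs : 0 < s) (i : ℕ) (x : ℝ) :
    HasDerivAt (fun s => heatTower s i x) (heatTower' s i x) s := by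
  have h1 : HasDerivAt (fun s : ℝ => s ^ (-(1 / 2) : ℝ)) (-(1 / 2) / s * s ^ (-(1 / 2) : ℝ)) s := by
    refine (Real.hasDerivAt_rpow_const (Or.inl hs.ne')).congr_deriv ?_
    rw [Real.rpow_sub_one hs.ne']
    ring
  have h2 : HasDerivAt (fun s : ℝ => (-1 / (4 * s)) ^ i) (-i / s * (-1 / (4 * s)) ^ i) s := by
    have h := ((hasDerivAt_id s).const_mul 4).fun_inv (by simpa using hs.ne') |>.const_mul (-1)
    refine (h.fun_pow i).congr_deriv ?_ |>.congr_of_eventuallyEq (Eventually.of_forall fun r => ?_)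
    · rcases i with _ | i
      · simp
      · simp only [id, Nat.add_sub_cancel, pow_succ]
        push_cast
        field_simp
    · simp [div_eq_mul_inv]
  have h3 : HasDerivAt (fun s : ℝ => Real.exp (-(x / (4 * s))))
      (x / (4 * s ^ 2) * Real.exp (-(x / (4 * s)))) s := by
    have h :=
      ((((hasDerivAt_id s).const_mul 4).fun_inv (by simpa using hs.ne')).const_mul x).neg.exp
    refine h.congr_deriv ?_
    simp only [id, Pi.neg_apply, div_eq_mul_inv]
    field_simp
  have h := (((h1.mul h2).mul h3).const_mul (√Real.pi)⁻¹).ofReal_comp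
  refine h.congr_deriv ?_
  rw [heatTower', heatTower, ← Complex.ofReal_mul]
  congr 1
  simp only [Pi.mul_apply]
  ring

theorem exists_one_add_pow_mul_exp_le (m : ℕ) :
    ∃ C : ℝ, 0 < C ∧ ∀ q : ℝ, 0 ≤ q → (1 + q) ^ m * Real.exp (-(q / 4)) ≤ C := by
  -- The constant comes from `x^m / m! ≤ e^x` at `x = (1 + q)/4`.
  refine ⟨4 ^ m * m.factorial * Real.exp (1 / 4), by positivity, fun q hq => ?_⟩
  have h := Real.pow_div_factorial_le_exp ((1 + q) / 4) (by positivity) m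
  rw [div_le_iff₀ (by positivity), div_pow, div_le_iff₀ (by positivity)] at h
  calc (1 + q) ^ m * Real.exp (-(q / 4))
      ≤ (Real.exp ((1 + q) / 4) * m.factorial * 4 ^ m) * Real.exp (-(q / 4)) := by gcongr
    _ = 4 ^ m * m.factorial * (Real.exp ((1 + q) / 4) * Real.exp (-(q / 4))) := by ring
    _ = _ := by rw [← Real.exp_add]; ring_nf

theorem one_le_sqrt_pi : 1 ≤ √Real.pi := by
  rw [Real.one_le_sqrt]
  linarith [Real.pi_gt_three]

theorem norm_heatTower_le {s x : ℝ} (hs : 0 < s) (hx : 0 ≤ x) (i : ℕ) :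
    ‖(x : ℂ) ^ i * heatTower s i x‖ ≤
      s ^ (-(1 / 2) : ℝ) * ((1 + x / s) ^ i * Real.exp (-(x / s / 4))) := by
  rw [norm_mul, norm_pow, heatTower, Complex.norm_real, Complex.norm_real,
    Real.norm_of_nonneg hx, norm_mul, norm_mul, norm_mul, norm_pow, norm_div, norm_neg, norm_one,
    Real.norm_of_nonneg (by positivity), Real.norm_of_nonneg (by positivity),
    Real.norm_of_nonneg (by positivity), Real.norm_of_nonneg (by positivity)]
  have h1 : (√Real.pi)⁻¹ ≤ 1 := inv_le_one_of_one_le₀ one_le_sqrt_pi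
  have h2 : x / (4 * s) ≤ 1 + x / s := by
    have : 0 ≤ x / s := by positivity
    rw [mul_comm, ← div_div]
    linarith
  calc x ^ i * ((√Real.pi)⁻¹ * (s ^ (-(1 / 2) : ℝ) * (1 / (4 * s)) ^ i *
        Real.exp (-(x / (4 * s))))) = (√Real.pi)⁻¹ * (s ^ (-(1 / 2) : ℝ) *
        ((x / (4 * s)) ^ i * Real.exp (-(x / s / 4)))) := by
          rw [div_pow, div_pow, one_pow, div_div, mul_comm s 4]; ring
    _ ≤ 1 * (s ^ (-(1 / 2) : ℝ) * ((1 + x / s) ^ i * Real.exp (-(x / s / 4)))) := by gcongr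
    _ = _ := one_mul _

theorem sqrt_mul_rpow_eq {s : ℝ} (hs : 0 < s) (t : ℝ) :
    √s * (√s ^ 2 + t ^ 2) ^ (-1 : ℝ) = s ^ (-(1 / 2) : ℝ) * (1 + t ^ 2 / s)⁻¹ := by
  have h : s ^ (-(1 / 2) : ℝ) = (√s)⁻¹ := by rw [Real.rpow_neg hs.le, Real.sqrt_eq_rpow]
  have hs' := Real.sqrt_pos.2 hs
  have h2 : s = √s ^ 2 := (Real.sq_sqrt hs.le).symm
  rw [h, Real.rpow_neg_one]
  nth_rewrite 4 [h2]
  have : 0 < √s ^ 2 + t ^ 2 := by positivity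
  field_simp

/-- In the variable `q = t²/s` every term is a polynomial of degree `i` times a Gaussian factor, and
the Gaussian dominates every power of `1 + q`. -/
theorem exists_isParabolicKernel_heat (n : ℕ) : ∃ K : ℝ,
    IsParabolicKernel (fun s => weylKernel n (heatTower s))
      (fun s => weylKernel n (heatTower' s)) K := by
  -- Two powers beyond `i` are kept: one is the factor `(1 + q)⁻¹` of the required bound, the other
  -- pays for the factor `(1 + q)/s` produced by the `s`-derivative.
  choose C hC0 hC using fun i : ℕ => exists_one_add_pow_mul_exp_le (i + 2)
  set K : ℝ := ∑ i ∈ Finset.range (n + 1), |towerCoeff n i| * ((1 + i) * C i) with hK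
  have hterm : ∀ s : ℝ, 0 < s → ∀ t : ℝ, ∀ i : ℕ, ‖(t : ℂ) ^ (2 * i) * heatTower s i (t ^ 2)‖ ≤
      C i * (s ^ (-(1 / 2) : ℝ) * (1 + t ^ 2 / s)⁻¹) * (1 + t ^ 2 / s)⁻¹ := by
    intro s hs t i
    have h1 := norm_heatTower_le hs (sq_nonneg t) i
    have h2 := hC i (t ^ 2 / s) (by positivity)
    have hq : 0 < 1 + t ^ 2 / s := by positivity
    rw [pow_mul, ← Complex.ofReal_pow]
    refine h1.trans ?_
    rw [pow_add] at h2
    calc s ^ (-(1 / 2) : ℝ) * ((1 + t ^ 2 / s) ^ i * Real.exp (-(t ^ 2 / s / 4)))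
        = s ^ (-(1 / 2) : ℝ) * (1 + t ^ 2 / s)⁻¹ * (1 + t ^ 2 / s)⁻¹ *
          ((1 + t ^ 2 / s) ^ i * (1 + t ^ 2 / s) ^ 2 * Real.exp (-(t ^ 2 / s / 4))) := by
            field_simp
      _ ≤ s ^ (-(1 / 2) : ℝ) * (1 + t ^ 2 / s)⁻¹ * (1 + t ^ 2 / s)⁻¹ * C i := by gcongr
      _ = _ := by ring
  refine ⟨K, ?_, ?_, ?_, ?_, ?_⟩
  · refine continuousOn_const.mul (continuousOn_finsetSum _ fun i _ => continuousOn_const.mul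
      (ContinuousOn.mul (by fun_prop) (Complex.continuous_ofReal.comp_continuousOn
        (continuousOn_const.mul (ContinuousOn.mul (ContinuousOn.mul ?_ ?_) ?_)))))
    · exact continuousOn_fst.rpow_const fun q hq => Or.inl (ne_of_gt hq.1)
    · refine ContinuousOn.pow (continuousOn_const.div (by fun_prop) fun q hq => ?_) i
      have : (0 : ℝ) < q.1 := hq.1
      positivity
    · refine Real.continuous_exp.comp_continuousOn (ContinuousOn.neg
        (ContinuousOn.div (by fun_prop) (by fun_prop) fun q hq => ?_))
      have : (0 : ℝ) < q.1 := hq.1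
      positivity
  · intro s hs
    refine Continuous.continuousOn ?_
    unfold weylKernel towerSum heatTower' heatTower
    fun_prop
  · intro s hs t ht
    rw [weylKernel, norm_mul, norm_pow, norm_neg, norm_one, one_pow, one_mul, hK, Finset.sum_mul]
    refine norm_sum_le_of_le _ fun i _ => ?_
    rw [norm_mul, Complex.norm_real, Real.norm_eq_abs, mul_assoc, sqrt_mul_rpow_eq hs]
    refine mul_le_mul_of_nonneg_left ((hterm s hs t i).trans ?_) (abs_nonneg _)
    have h1 : (1 + t ^ 2 / s)⁻¹ ≤ 1 + (i : ℝ) := by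
      have h2 : (1 + t ^ 2 / s)⁻¹ ≤ 1 :=
        inv_le_one_of_one_le₀ (by linarith [show 0 ≤ t ^ 2 / s by positivity])
      linarith [show (0 : ℝ) ≤ i by positivity]
    have hCi := hC0 i
    calc _ ≤ C i * (s ^ (-(1 / 2) : ℝ) * (1 + t ^ 2 / s)⁻¹) * (1 + i) := by gcongr
      _ = _ := by ring
  · intro s hs t ht
    rw [weylKernel, norm_mul, norm_pow, norm_neg, norm_one, one_pow, one_mul, hK, Finset.sum_div,
      Finset.sum_mul]
    refine norm_sum_le_of_le _ fun i _ => ?_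
    rw [norm_mul, Complex.norm_real, Real.norm_eq_abs, mul_div_assoc, mul_assoc,
      sqrt_mul_rpow_eq hs]
    refine mul_le_mul_of_nonneg_left ?_ (abs_nonneg _)
    rw [heatTower', mul_left_comm, norm_mul, Complex.norm_real]
    have hq : 0 ≤ t ^ 2 / s := by positivity
    have h1 : ‖(-(1 / 2) - (i : ℝ)) / s + t ^ 2 / (4 * s ^ 2)‖ ≤
        (1 + i) / s * (1 + t ^ 2 / s) := by
      have e1 : (-(1 / 2) - (i : ℝ)) / s + t ^ 2 / (4 * s ^ 2) =
          (-(1 / 2) - i + t ^ 2 / s / 4) / s := by field_simp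
      have hi : (0 : ℝ) ≤ i := by positivity
      rw [e1, norm_div, Real.norm_of_nonneg hs.le, div_mul_eq_mul_div]
      gcongr
      rw [Real.norm_eq_abs, abs_le]
      constructor <;> nlinarith
    have hCi := hC0 i
    calc _ ≤ ((1 + i) / s * (1 + t ^ 2 / s)) *
          (C i * (s ^ (-(1 / 2) : ℝ) * (1 + t ^ 2 / s)⁻¹) * (1 + t ^ 2 / s)⁻¹) := by
          gcongr
          exact hterm s hs t i
      _ = _ := by field_simp
  · intro s hs t ht
    exact (HasDerivAt.fun_sum fun i _ => ((hasDerivAt_heatTower hs i (t ^ 2)).const_mul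
      ((t : ℂ) ^ (2 * i))).const_mul (towerCoeff n i : ℂ)).const_mul ((-1 : ℂ) ^ n)

/-! ### Laplace transform and subordination at the level of Weyl kernels. -/

theorem integral_mul_weylKernel {w : ℝ → ℂ} {F : ℝ → ℕ → ℝ → ℂ} {t : ℝ} (n : ℕ)
    (hi : ∀ i : ℕ, IntegrableOn (fun s => w s * F s i (t ^ 2)) (Set.Ioi 0)) :
    ∫ s in Set.Ioi (0 : ℝ), w s * weylKernel n (F s) t =
      weylKernel n (fun i x => ∫ s in Set.Ioi (0 : ℝ), w s * F s i x) t := by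
  have h1 : ∀ s : ℝ, w s * weylKernel n (F s) t = (-1) ^ n * ∑ i ∈ Finset.range (n + 1),
      (towerCoeff n i : ℂ) * ((t : ℂ) ^ (2 * i) * (w s * F s i (t ^ 2))) := by
    intro s
    rw [weylKernel, towerSum, mul_left_comm, Finset.mul_sum _ _ (w s)]
    congr 1
    refine Finset.sum_congr rfl fun i _ => by ring
  simp_rw [h1]
  rw [integral_const_mul, integral_finsetSum _ fun i _ => ((hi i).const_mul _).const_mul _,
    weylKernel, towerSum]
  congr 1
  refine Finset.sum_congr rfl fun i _ => ?_
  rw [integral_const_mul, integral_const_mul]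

theorem hasDerivAt_heatTower_right (s : ℝ) (i : ℕ) (x : ℝ) :
    HasDerivAt (heatTower s i) (heatTower s (i + 1) x) x := by
  have h := ((((hasDerivAt_id x).div_const (4 * s)).neg.exp).const_mul
    (s ^ (-(1 / 2) : ℝ) * (-1 / (4 * s)) ^ i)).const_mul (√Real.pi)⁻¹
  refine h.ofReal_comp.congr_deriv ?_
  rw [heatTower]
  congr 1
  simp only [id, Pi.neg_apply, pow_succ]
  ring

theorem continuousOn_heatTower (i : ℕ) (x : ℝ) :
    ContinuousOn (fun s => heatTower s i x) (Set.Ioi 0) :=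
  fun _ hs => (hasDerivAt_heatTower hs i x).continuousAt.continuousWithinAt

/-- Away from `x = 0` the Gaussian absorbs the powers `s^(-i)` coming from differentiation in `x`.
This dominates the differentiated Laplace integrals. -/
theorem exists_norm_heatTower_le (i : ℕ) {δ : ℝ} (hδ : 0 < δ) : ∃ C : ℝ, ∀ s : ℝ, 0 < s →
    ∀ x : ℝ, δ ≤ x → ‖heatTower s i x‖ ≤ C * s ^ (-(1 / 2) : ℝ) := by
  obtain ⟨C, hC0, hC⟩ := exists_one_add_pow_mul_exp_le i
  refine ⟨(δ ^ i)⁻¹ * C, fun s hs x hx => ?_⟩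
  have hx0 : 0 < x := hδ.trans_le hx
  have h1 := norm_heatTower_le hs hx0.le i
  rw [norm_mul, norm_pow, Complex.norm_real, Real.norm_of_nonneg hx0.le] at h1
  have h2 := hC (x / s) (by positivity)
  have h3 : x ^ i * ‖heatTower s i x‖ ≤ s ^ (-(1 / 2) : ℝ) * C :=
    h1.trans (mul_le_mul_of_nonneg_left h2 (by positivity))
  rw [mul_assoc, ← div_eq_inv_mul, le_div_iff₀ (by positivity), mul_comm C, mul_comm]
  refine le_trans ?_ h3
  gcongr

theorem integrableOn_exp_mul_heatTower {μ : ℝ} (hμ : 0 < μ) (i : ℕ) {x : ℝ} (hx : 0 < x) :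
    IntegrableOn (fun s : ℝ => ((Real.exp (-(μ * s)) : ℝ) : ℂ) * heatTower s i x) (Set.Ioi 0) := by
  obtain ⟨C, hC⟩ := exists_norm_heatTower_le i hx
  have hc : ContinuousOn (fun s : ℝ => ((Real.exp (-(μ * s)) : ℝ) : ℂ)) (Set.Ioi 0) := by fun_prop
  refine Integrable.mono' ((integrableOn_exp_mul_rpow_neg_half hμ).const_mul C)
    ((hc.mul (continuousOn_heatTower i x)).aestronglyMeasurable measurableSet_Ioi) ?_
  filter_upwards [ae_restrict_mem measurableSet_Ioi] with s hs
  rw [norm_mul, Complex.norm_real, Real.norm_of_nonneg (Real.exp_pos _).le, mul_left_comm]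
  gcongr
  exact hC s hs x le_rfl

theorem hasDerivAt_integral_exp_mul_heatTower {μ : ℝ} (hμ : 0 < μ) (i : ℕ) {x : ℝ} (hx : 0 < x) :
    HasDerivAt (fun x => ∫ s in Set.Ioi (0 : ℝ),
        ((Real.exp (-(μ * s)) : ℝ) : ℂ) * heatTower s i x)
      (∫ s in Set.Ioi (0 : ℝ), ((Real.exp (-(μ * s)) : ℝ) : ℂ) * heatTower s (i + 1) x) x := by
  obtain ⟨C, hC⟩ := exists_norm_heatTower_le (i + 1) (half_pos hx)
  refine (hasDerivAt_integral_of_dominated_loc_of_deriv_le (𝕜 := ℝ) (x₀ := x)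
    (μ := volume.restrict (Set.Ioi (0 : ℝ)))
    (F := fun x s => ((Real.exp (-(μ * s)) : ℝ) : ℂ) * heatTower s i x)
    (F' := fun x s => ((Real.exp (-(μ * s)) : ℝ) : ℂ) * heatTower s (i + 1) x)
    (s := Set.Ioi (x / 2))
    (bound := fun s => C * (Real.exp (-(μ * s)) * s ^ (-(1 / 2) : ℝ)))
    (Ioi_mem_nhds (half_lt_self hx)) ?_ (integrableOn_exp_mul_heatTower hμ i hx)
    (integrableOn_exp_mul_heatTower hμ (i + 1) hx).aestronglyMeasurable ?_
    ((integrableOn_exp_mul_rpow_neg_half hμ).const_mul C) ?_).2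
  · filter_upwards [lt_mem_nhds hx] with y hy using
      (integrableOn_exp_mul_heatTower hμ i hy).aestronglyMeasurable
  · filter_upwards [ae_restrict_mem measurableSet_Ioi] with s hs y hy
    rw [norm_mul, Complex.norm_real, Real.norm_of_nonneg (Real.exp_pos _).le, mul_left_comm]
    gcongr
    exact hC s hs y (le_of_lt hy)
  · exact Eventually.of_forall fun s y _ => (hasDerivAt_heatTower_right s i y).const_mul _

/-- The Laplace transform of the Weyl derivative of the heat kernel. -/
theorem integral_exp_mul_weylKernel_heatTower {l t : ℝ} (hl : 0 < l) (ht : 0 < t) (m : ℕ) :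
    ∫ s in Set.Ioi (0 : ℝ), ((Real.exp (-(l ^ 2 * s)) : ℝ) : ℂ) *
        weylKernel (m + 1) (heatTower s) t =
      ((l ^ m * Real.exp (-(l * t)) * t ^ (m + 1) : ℝ) : ℂ) := by
  have hl2 : 0 < l ^ 2 := by positivity
  rw [integral_mul_weylKernel (m + 1)
    fun i => integrableOn_exp_mul_heatTower hl2 i (by positivity : 0 < t ^ 2)]
  set G : ℕ → ℝ → ℂ := fun i x => ∫ s in Set.Ioi (0 : ℝ),
    ((Real.exp (-(l ^ 2 * s)) : ℝ) : ℂ) * heatTower s i x with hG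
  have h0 : ∀ t : ℝ, 0 < t → G 0 (t ^ 2) = ((Real.exp (-(l * t)) / l : ℝ) : ℂ) := by
    intro t ht
    have h1 : ∀ s : ℝ, ((Real.exp (-(l ^ 2 * s)) : ℝ) : ℂ) * heatTower s 0 (t ^ 2) =
        (((√Real.pi)⁻¹ * (Real.exp (-(l ^ 2 * s)) * s ^ (-(1 / 2) : ℝ) *
          Real.exp (-(t ^ 2 / (4 * s)))) : ℝ) : ℂ) := by
      intro s
      rw [heatTower, ← Complex.ofReal_mul]
      congr 1
      ring
    simp only [hG, h1]
    rw [integral_complex_ofReal, integral_const_mul, integral_exp_mul_heat hl ht]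
    congr 1
    have := Real.sqrt_pos.2 Real.pi_pos
    field_simp
  have hd := fun (j : ℕ) (t : ℝ) (ht : 0 < t) => hasDerivAt_towerSum (F := G)
    (fun i x hx => hasDerivAt_integral_exp_mul_heatTower hl2 i hx) j ht
  -- For `j = 0` this is the Laplace transform of the heat kernel, `e^(-lt)/l`. Both sides obey the
  -- same differentiation rule, and uniqueness of derivatives gives the induction.
  have key : ∀ j : ℕ, ∀ t : ℝ, 0 < t → ((t : ℂ) ^ j)⁻¹ * towerSum G j t =
      (((-l) ^ j * (Real.exp (-(l * t)) / l) : ℝ) : ℂ) := by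
    intro j
    induction j with
    | zero => intro t ht; simp [towerSum, towerCoeff, h0 t ht]
    | succ j ih =>
      intro t ht
      refine (hd j t ht).unique ?_
      have h1 : HasDerivAt (fun t : ℝ => (((-l) ^ j * (Real.exp (-(l * t)) / l) : ℝ) : ℂ))
          ((((-l) ^ j * (Real.exp (-(l * t)) * -l / l) : ℝ)) : ℂ) t :=
        (((hasDerivAt_exp_neg_mul l t).div_const l).const_mul _).ofReal_comp
      refine (h1.congr_of_eventuallyEq ?_).congr_deriv ?_
      · filter_upwards [lt_mem_nhds ht] with r hr using ih r hr
      · congr 1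
        rw [pow_succ]
        ring
  have h2 := key (m + 1) t ht
  have ht0 : ((t : ℂ) ^ (m + 1)) ≠ 0 := pow_ne_zero _ (by exact_mod_cast ht.ne')
  rw [inv_mul_eq_iff_eq_mul₀ ht0] at h2
  rw [weylKernel, h2]
  have h3 : (-1 : ℂ) ^ (m + 1) = (((-1) ^ (m + 1) : ℝ) : ℂ) := by push_cast; rfl
  rw [h3, ← Complex.ofReal_pow, ← Complex.ofReal_mul, ← Complex.ofReal_mul]
  congr 1
  rw [neg_pow l (m + 1), pow_succ l]
  have h4 : ((-1 : ℝ) ^ (m + 1)) * (-1) ^ (m + 1) = 1 := by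
    rw [← mul_pow]; norm_num
  calc _ = ((-1 : ℝ) ^ (m + 1) * (-1) ^ (m + 1)) * (t ^ (m + 1) * l ^ m *
        (l * (Real.exp (-(l * t)) / l))) := by ring
    _ = _ := by rw [h4, mul_div_cancel₀ _ hl.ne']; ring

theorem integrableOn_rpow_mul_exp_neg_sq_div {a z : ℝ} (ha : 1 / 2 < a) (hz : 0 < z) :
    IntegrableOn (fun s : ℝ => s ^ (-a - 1 / 2) * Real.exp (-(z ^ 2 / 4 / s))) (Set.Ioi 0) := by
  have h := integrableOn_rpow_mul_exp_neg_div (b := a - 1 / 2) (y := z ^ 2 / 4) (by linarith)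
    (by positivity)
  refine h.congr_fun (fun s _ => ?_) measurableSet_Ioi
  dsimp only
  congr 2
  ring

theorem continuousOn_rpow_mul_exp_neg_div (b y : ℝ) :
    ContinuousOn (fun s : ℝ => s ^ b * Real.exp (-(y / s))) (Set.Ioi 0) := by
  refine (continuousOn_id.rpow_const fun q hq => Or.inl (ne_of_gt hq)).mul
    (Real.continuous_exp.comp_continuousOn (ContinuousOn.neg
      (continuousOn_const.div continuousOn_id fun q hq => ne_of_gt hq)))

theorem rpow_mul_exp_mul_heatTower {a z x s : ℝ} (hs : 0 < s) (i : ℕ) :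
    ((s ^ (-a - 1 / 2) * Real.exp (-(z ^ 2 / 4 / s)) : ℝ) : ℂ) * heatTower s i x =
      (((√Real.pi)⁻¹ * (-1 / 4) ^ i *
        (s ^ (-(a + i) - 1) * Real.exp (-((z ^ 2 + x) / 4 / s))) : ℝ) : ℂ) := by
  rw [heatTower, ← Complex.ofReal_mul]
  congr 1
  have h1 : (-1 / (4 * s)) ^ i = (-1 / 4) ^ i * s ^ (-(i : ℝ)) := by
    rw [Real.rpow_neg hs.le, Real.rpow_natCast, ← inv_pow, ← mul_pow]
    congr 1
    field_simp
  have h2 : s ^ (-(a + i) - 1) = s ^ (-a - 1 / 2) * s ^ (-(1 / 2) : ℝ) * s ^ (-(i : ℝ)) := by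
    rw [← Real.rpow_add hs, ← Real.rpow_add hs]
    congr 1; ring
  have h3 : Real.exp (-((z ^ 2 + x) / 4 / s)) = Real.exp (-(z ^ 2 / 4 / s)) *
      Real.exp (-(x / (4 * s))) := by
    rw [← Real.exp_add]
    congr 1
    field_simp
    ring
  rw [h1, h2, h3]
  ring

theorem integrableOn_rpow_mul_heatTower {a z x : ℝ} (ha : 0 < a) (hz : 0 < z) (hx : 0 ≤ x) (i : ℕ) :
    IntegrableOn (fun s : ℝ => ((s ^ (-a - 1 / 2) * Real.exp (-(z ^ 2 / 4 / s)) : ℝ) : ℂ) *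
      heatTower s i x) (Set.Ioi 0) := by
  have h := (integrableOn_rpow_mul_exp_neg_div (b := a + i) (y := (z ^ 2 + x) / 4) (by positivity)
    (by positivity)).const_mul ((√Real.pi)⁻¹ * (-1 / 4) ^ i)
  exact IntegrableOn.congr_fun (Integrable.ofReal (𝕜 := ℂ) h)
    (fun s hs => (rpow_mul_exp_mul_heatTower hs i).symm) measurableSet_Ioi

/-- The weight times the Gaussian has exponent `-(z² + x)/(4s)`, so the integral is a Gamma integral
of order `a + i`. The powers of `4` left over from it give the normalisation `√π 4^(-a)`. -/
theorem mainTower_eq_integral {a z x : ℝ} (ha : 0 < a) (hz : 0 < z) (hx : 0 ≤ x) (i : ℕ) :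
    mainTower a z i x = ((√Real.pi * 4 ^ (-a) : ℝ) : ℂ) * ∫ s in Set.Ioi (0 : ℝ),
      ((s ^ (-a - 1 / 2) * Real.exp (-(z ^ 2 / 4 / s)) : ℝ) : ℂ) * heatTower s i x := by
  have hp : 0 < z ^ 2 + x := by positivity
  rw [setIntegral_congr_fun measurableSet_Ioi fun s hs => rpow_mul_exp_mul_heatTower hs i,
    integral_complex_ofReal, integral_const_mul, integral_rpow_mul_exp_neg_div (by positivity)
    (by positivity), mainTower, ← Complex.ofReal_pow, ← Complex.ofReal_add, ← Complex.ofReal_neg,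
    ← Complex.ofReal_cpow hp.le, ← Complex.ofReal_mul]
  have e : (-1 : ℂ) ^ i = (((-1) ^ i : ℝ) : ℂ) := by push_cast; rfl
  rw [e, ← Complex.ofReal_mul, ← Complex.ofReal_mul]
  congr 1
  have h1 : ((z ^ 2 + x) / 4) ^ (-(a + i)) = (z ^ 2 + x) ^ (-(a + i)) * (4 ^ a * 4 ^ i) := by
    rw [Real.div_rpow hp.le (by norm_num), Real.rpow_neg
      (by norm_num : (0 : ℝ) ≤ 4), div_inv_eq_mul,
      Real.rpow_add (by norm_num), Real.rpow_natCast]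
  rw [h1, Real.rpow_neg (by norm_num : (0 : ℝ) ≤ 4), div_pow]
  have := Real.sqrt_pos.2 Real.pi_pos
  field_simp

theorem weylKernel_mainTower_eq_integral {a z : ℝ} (ha : 0 < a) (hz : 0 < z) (n : ℕ) (t : ℝ) :
    weylKernel n (mainTower a z) t = ((√Real.pi * 4 ^ (-a) : ℝ) : ℂ) * ∫ s in Set.Ioi (0 : ℝ),
      ((s ^ (-a - 1 / 2) * Real.exp (-(z ^ 2 / 4 / s)) : ℝ) : ℂ) *
        weylKernel n (heatTower s) t := by
  rw [integral_mul_weylKernel n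
    fun i => integrableOn_rpow_mul_heatTower ha hz (sq_nonneg t) i, weylKernel, weylKernel,
    mul_left_comm, towerSum, towerSum, Finset.mul_sum _ _ ((√Real.pi * 4 ^ (-a) : ℝ) : ℂ)]
  congr 1
  refine Finset.sum_congr rfl fun i _ => ?_
  rw [mainTower_eq_integral ha hz (sq_nonneg t)]
  ring

/-! ### The heat family of the generator and the subordination formula. -/

section HeatFamily

variable {X : Type*} [NormedAddCommGroup X] [NormedSpace ℂ X] [CompleteSpace X]
  {B : ℝ → X →L[ℂ] X} {N : ℝ}

/-- Subordination to the heat family, for real `z` only. Identities derived from it reach complex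
`z` through the identity theorem. -/
theorem mainOp_eq_integral (hB : IsBoundedFamily B N) (n : ℕ) {a z : ℝ} (ha : 1 / 2 < a)
    (hz : 0 < z) (f : X) :
    mainOp B N n a z f = (√Real.pi * 4 ^ (-a)) • ∫ s in Set.Ioi (0 : ℝ),
      (s ^ (-a - 1 / 2) * Real.exp (-(z ^ 2 / 4 / s))) •
        kernelOp B N (weylKernel n (heatTower s)) f := by
  obtain ⟨K, hK⟩ := exists_isParabolicKernel_heat n
  rw [hK.integral_smul_op hB (integrableOn_rpow_mul_exp_neg_sq_div ha hz)
    (continuousOn_rpow_mul_exp_neg_div _ _) f, mainOp, kernelOp_apply hB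
    ((isTower_mainTower ha (by simpa using hz)).integrableOn_weylKernel n), ← integral_smul]
  refine setIntegral_congr_fun measurableSet_Ioi fun t _ => ?_
  rw [weylKernel_mainTower_eq_integral (by linarith) hz n t, mul_smul, Complex.coe_smul]

/-- The heat semigroup generated by the generator of a tempered integrated cosine family. -/
theorem exists_isLaplaceFamily {A : X →ₗ.[ℂ] X} (hB : IsBoundedFamily B N) {m : ℕ}
    (hright : ∀ l : ℝ, 0 < l → ∀ f : X, ∃ x : A.domain,
      (x : X) = ∫ p in Set.Ioi (0 : ℝ),
        ((l ^ m * Real.exp (-(l * p)) * p ^ (m + 1) : ℝ) : ℂ) • B p f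
        ∧ (l : ℂ) ^ 2 • (x : X) - A x = f)
    (hleft : ∀ l : ℝ, 0 < l → ∀ x : A.domain, (l : ℂ) ^ 2 • (x : X) - A x = 0 → x = 0) :
    ∃ (R T' : ℝ → X →L[ℂ] X) (K : ℝ),
      IsLaplaceFamily A R (fun s => kernelOp B N (weylKernel (m + 1) (heatTower s))) T' K := by
  obtain ⟨K, hK⟩ := exists_isParabolicKernel_heat (m + 1)
  have hint : ∀ l : ℝ, 0 < l → IntegrableOn
      (fun p : ℝ => ((l ^ m * Real.exp (-(l * p)) * p ^ (m + 1) : ℝ) : ℂ)) (Set.Ioi 0) := by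
    intro l hl
    have h :=
      (integrableOn_rpow_mul_exp_neg_mul (a := (m : ℝ) + 1 + 1) (by positivity) hl).const_mul
      (l ^ m)
    refine IntegrableOn.congr_fun (Integrable.ofReal (𝕜 := ℂ) h) (fun p _ => ?_) measurableSet_Ioi
    have e : p ^ ((m : ℝ) + 1 + 1 - 1) = p ^ (m + 1) := by
      rw [← Real.rpow_natCast]; congr 1; push_cast; ring
    have e2 : l ^ m * (p ^ (m + 1) * Real.exp (-(l * p))) =
      l ^ m * Real.exp (-(l * p)) * p ^ (m + 1) := by ring
    rw [e, e2]
    rfl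
  -- The resolvent of the cosine family is `(l² - A)⁻¹`, hence `l = √μ`.
  set R : ℝ → X →L[ℂ] X := fun μ => kernelOp B N fun p : ℝ =>
    (((√μ) ^ m * Real.exp (-(√μ * p)) * p ^ (m + 1) : ℝ) : ℂ) with hR
  have hRa : ∀ μ : ℝ, 0 < μ → ∀ f, ∃ x : A.domain, (x : X) = R μ f ∧ (μ : ℂ) • (x : X) - A x = f :=
    by
    intro μ hμ f
    obtain ⟨x, hx1, hx2⟩ := hright (√μ) (Real.sqrt_pos.2 hμ) f
    refine ⟨x, ?_, ?_⟩
    · rw [hx1, hR, kernelOp_apply hB (hint _ (Real.sqrt_pos.2 hμ))]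
    · rw [← hx2, ← Complex.ofReal_pow, Real.sq_sqrt hμ.le]
  refine ⟨R, _, _, fun s hs => hK.norm_op_le hB hs, fun s hs => hK.norm_op_le' hB hs,
    fun s hs f => hK.hasDerivAt_op hB hs f, fun μ hμ f => ?_, hRa, fun μ hμ x => ?_⟩
  · have hc : ContinuousOn (fun s : ℝ => Real.exp (-(μ * s))) (Set.Ioi 0) := by fun_prop
    rw [hK.integral_smul_op hB (integrableOn_exp_neg_mul hμ) hc, hR,
      kernelOp_apply hB (hint _ (Real.sqrt_pos.2 hμ))]
    refine setIntegral_congr_fun measurableSet_Ioi fun t ht => ?_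
    have h := integral_exp_mul_weylKernel_heatTower (Real.sqrt_pos.2 hμ) ht m
    rw [Real.sq_sqrt hμ.le] at h
    rw [h]
  -- Injectivity of `μ - A` makes the right inverse a left inverse: `x` and `y` have the same image.
  · obtain ⟨y, hy1, hy2⟩ := hRa μ hμ ((μ : ℂ) • (x : X) - A x)
    have h := hleft (√μ) (Real.sqrt_pos.2 hμ) (y - x) ?_
    · rw [← hy1, sub_eq_zero.1 h]
    · rw [← Complex.ofReal_pow, Real.sq_sqrt hμ.le, A.map_sub, Submodule.coe_sub, smul_sub,
        sub_sub_sub_comm, hy2, sub_self]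

end HeatFamily

/-! ### The three kernels of the theorem as functions of `t²`. -/

theorem IsTower.const_mul {F : ℕ → ℝ → ℂ} {a : ℝ} (hF : IsTower F a) (c : ℂ) :
    IsTower (fun i x => c * F i x) a := by
  refine ⟨fun i x hx => (hF.hasDeriv i x hx).const_mul c, fun i δ hδ => ?_, fun i => ?_⟩
  · obtain ⟨K, hK⟩ := hF.decay i δ hδ
    refine ⟨‖c‖ * K, fun x hx => ?_⟩
    rw [norm_mul, mul_assoc]
    exact mul_le_mul_of_nonneg_left (hK x hx) (norm_nonneg _)
  · refine Integrable.congr ((hF.integrable i).const_mul c) (Eventually.of_forall fun t => ?_)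
    exact mul_left_comm _ _ _

theorem weylKernel_const_mul (n : ℕ) (F : ℕ → ℝ → ℂ) (c : ℂ) (t : ℝ) :
    weylKernel n (fun i x => c * F i x) t = c * weylKernel n F t := by
  rw [weylKernel, weylKernel, towerSum, towerSum, mul_left_comm c, Finset.mul_sum _ _ c]
  congr 1
  refine Finset.sum_congr rfl fun i _ => by ring

section Family

variable {X : Type*} [NormedAddCommGroup X] [NormedSpace ℂ X] {B : ℝ → X →L[ℂ] X} {N : ℝ}

theorem kernelOp_weylKernel_const_mul (hB : IsBoundedFamily B N) (n : ℕ) {F : ℕ → ℝ → ℂ} {a : ℝ}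
    (hF : IsTower F a) (c : ℂ) (f : X) : kernelOp B N (weylKernel n fun i x => c * F i x) f =
      c • kernelOp B N (weylKernel n F) f := by
  rw [kernelOp_apply hB ((hF.const_mul c).integrableOn_weylKernel n),
    kernelOp_apply hB (hF.integrableOn_weylKernel n), ← integral_smul]
  simp_rw [weylKernel_const_mul, mul_smul]

end Family

theorem poissonKernel_eq {σ : ℝ} (hσ : 0 < σ) (z : ℂ) (t : ℝ) :
    poissonKernel σ z t = z ^ (2 * (σ : ℂ)) / (Real.Gamma (σ + 1 / 2) : ℂ) *
      mainTower (σ + 1 / 2) z 0 (t ^ 2) := by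
  have hg : ((Real.Gamma (σ + 1 / 2) : ℝ) : ℂ) ≠ 0 := by
    exact_mod_cast (Real.Gamma_pos_of_pos (by positivity)).ne'
  rw [poissonKernel, mainTower, Nat.cast_zero, add_zero, pow_zero, one_mul, Complex.cpow_neg]
  generalize ((Real.Gamma (σ + 1 / 2) : ℝ) : ℂ) = g at hg ⊢
  push_cast
  field_simp

theorem mul_add_mem_slitPlane {z : ℂ} (hz : 0 < z.re) {x r : ℝ} (hx : 0 < x) (hr : 0 ≤ r) :
    (r : ℂ) * z ^ 2 + x ∈ Complex.slitPlane := by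
  rcases hr.eq_or_lt with rfl | hr
  · rw [Complex.ofReal_zero, zero_mul, zero_add]
    exact Complex.ofReal_mem_slitPlane.2 hx
  · have h := sq_add_mem_slitPlane (sqrt_mul_re_pos hz hr) hx.le
    rwa [mul_pow, ← Complex.ofReal_pow, Real.sq_sqrt hr.le] at h

theorem diffTower_zero_eq (a : ℝ) (z : ℂ) (x : ℝ) :
    diffTower a z 0 x = ∫ r in (0 : ℝ)..1, z ^ 2 *
      ((Real.Gamma a : ℂ) * ((r : ℂ) * z ^ 2 + x) ^ (-(a : ℂ))) := by
  rw [intervalIntegral.integral_of_le zero_le_one, diffTower]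
  refine setIntegral_congr_fun measurableSet_Ioc fun r hr => ?_
  simp only [mainTower, Nat.cast_zero, add_zero, pow_zero, one_mul]
  rw [mul_pow, ← Complex.ofReal_pow, Real.sq_sqrt hr.1.le]

theorem continuousOn_mul_add_cpow {z : ℂ} (hz : 0 < z.re) {x : ℝ} (hx : 0 < x) (b : ℂ) :
    ContinuousOn (fun r : ℝ => ((r : ℂ) * z ^ 2 + x) ^ b) (Set.uIcc 0 1) := by
  refine ContinuousOn.cpow (Continuous.continuousOn (by fun_prop)) continuousOn_const fun r hr => ?_
  rw [Set.uIcc_of_le zero_le_one] at hr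
  exact mul_add_mem_slitPlane hz hx hr.1

theorem hasDerivAt_mul_add (z : ℂ) (x r : ℝ) :
    HasDerivAt (fun w : ℂ => w * z ^ 2 + x) (z ^ 2) (r : ℂ) := by
  simpa using ((hasDerivAt_id (r : ℂ)).mul_const (z ^ 2)).add_const (x : ℂ)

/-- The fundamental theorem of calculus for `r ↦ (r z² + t²)^(σ-1/2)` between `0` and `1`. The
derivative has exponent `σ - 3/2`, whence the parameter `3/2 - σ`. -/
theorem differenceKernel_eq {σ : ℝ} (hσ1 : σ < 1) {z : ℂ} (hz : 0 < z.re) {t : ℝ} (ht : 0 < t) :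
    differenceKernel σ z t = ((σ - 1 / 2 : ℝ) / (Real.Gamma (3 / 2 - σ) : ℂ)) *
      diffTower (3 / 2 - σ) z 0 (t ^ 2) := by
  have ht2 : 0 < t ^ 2 := by positivity
  have hg : ((Real.Gamma (3 / 2 - σ) : ℝ) : ℂ) ≠ 0 := by
    exact_mod_cast (Real.Gamma_pos_of_pos (by linarith)).ne'
  have hd : ∀ r ∈ Set.uIcc (0 : ℝ) 1, HasDerivAt
      (fun r : ℝ => ((r : ℂ) * z ^ 2 + (t ^ 2 : ℝ)) ^ ((σ : ℂ) - 1 / 2))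
      (((σ : ℂ) - 1 / 2) * ((r : ℂ) * z ^ 2 + (t ^ 2 : ℝ)) ^ ((σ : ℂ) - 1 / 2 - 1) * z ^ 2) r := by
    intro r hr
    rw [Set.uIcc_of_le zero_le_one] at hr
    exact ((hasDerivAt_mul_add z (t ^ 2) r).cpow_const
      (mul_add_mem_slitPlane hz ht2 hr.1)).comp_ofReal
  have hI := intervalIntegral.integral_eq_sub_of_hasDerivAt hd
    (((continuousOn_const.mul (continuousOn_mul_add_cpow hz ht2 _)).mul
      continuousOn_const).intervalIntegrable)
  have e1 : (t : ℂ) ^ (2 * (σ : ℂ) - 1) = ((t ^ 2 : ℝ) : ℂ) ^ ((σ : ℂ) - 1 / 2) := by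
    have h1 : (t : ℂ) ^ (2 * (σ : ℂ) - 1) = ((t ^ (2 * σ - 1) : ℝ) : ℂ) := by
      rw [Complex.ofReal_cpow ht.le]; push_cast; rfl
    have h2 : ((t ^ 2 : ℝ) : ℂ) ^ ((σ : ℂ) - 1 / 2) = (((t ^ 2) ^ (σ - 1 / 2) : ℝ) : ℂ) := by
      rw [Complex.ofReal_cpow ht2.le]; push_cast; rfl
    rw [h1, h2, ← Real.rpow_natCast, ← Real.rpow_mul ht.le]
    congr 2; push_cast; ring
  have e2 : differenceKernel σ z t = ((1 : ℝ) * z ^ 2 + (t ^ 2 : ℝ)) ^ ((σ : ℂ) - 1 / 2) -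
      (((0 : ℝ) : ℂ) * z ^ 2 + (t ^ 2 : ℝ)) ^ ((σ : ℂ) - 1 / 2) := by
    rw [differenceKernel, e1]
    simp
  rw [e2, ← hI, diffTower_zero_eq, ← intervalIntegral.integral_const_mul]
  congr 1
  ext r
  have e3 : (-((3 / 2 - σ : ℝ) : ℂ)) = (σ : ℂ) - 1 / 2 - 1 := by push_cast; ring
  rw [e3]
  generalize ((Real.Gamma (3 / 2 - σ) : ℝ) : ℂ) = g at hg ⊢
  push_cast
  field_simp

/-- The same argument with the logarithm in place of the power. The principal logarithm of the
quotient splits because `t²` is positive and `z² + t²` lies in the slit plane. -/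
theorem logKernel_eq {z : ℂ} (hz : 0 < z.re) {t : ℝ} (ht : 0 < t) :
    logKernel z t = (-1) * diffTower 1 z 0 (t ^ 2) := by
  have ht2 : 0 < t ^ 2 := by positivity
  have hd : ∀ r ∈ Set.uIcc (0 : ℝ) 1, HasDerivAt
      (fun r : ℝ => Complex.log ((r : ℂ) * z ^ 2 + (t ^ 2 : ℝ)))
      (z ^ 2 / ((r : ℂ) * z ^ 2 + (t ^ 2 : ℝ))) r := by
    intro r hr
    rw [Set.uIcc_of_le zero_le_one] at hr
    exact ((hasDerivAt_mul_add z (t ^ 2) r).clog (mul_add_mem_slitPlane hz ht2 hr.1)).comp_ofReal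
  have e0 : ∀ r : ℝ, z ^ 2 * ((Real.Gamma 1 : ℂ) * ((r : ℂ) * z ^ 2 + (t ^ 2 : ℝ)) ^
      (-((1 : ℝ) : ℂ))) = z ^ 2 / ((r : ℂ) * z ^ 2 + (t ^ 2 : ℝ)) := by
    intro r
    rw [Real.Gamma_one, Complex.ofReal_one, one_mul, Complex.cpow_neg_one, div_eq_mul_inv]
  have hI := intervalIntegral.integral_eq_sub_of_hasDerivAt hd (ContinuousOn.intervalIntegrable (by
    simp_rw [← e0]
    exact continuousOn_const.mul (continuousOn_const.mul (continuousOn_mul_add_cpow hz ht2 _))))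
  rw [diffTower_zero_eq]
  simp_rw [e0]
  rw [hI, logKernel]
  have hs := sq_add_mem_slitPlane hz ht2.le
  have hs0 : z ^ 2 + ((t ^ 2 : ℝ) : ℂ) ≠ 0 := Complex.slitPlane_ne_zero hs
  have e1 : (t : ℂ) ^ 2 / (z ^ 2 + (t : ℂ) ^ 2) = ((t ^ 2 : ℝ) : ℂ) *
      (z ^ 2 + ((t ^ 2 : ℝ) : ℂ))⁻¹ := by
    push_cast
    rw [div_eq_mul_inv]
  rw [e1, Complex.log_ofReal_mul ht2 (inv_ne_zero hs0),
    Complex.log_inv _ (Complex.slitPlane_arg_ne_pi hs), Complex.ofReal_log ht2.le]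
  simp
  ring

/-! ### Balakrishnan power and generator through the heat family. -/

theorem tendsto_rpow_mul_exp_neg_div_zero {b c : ℝ} (hc : 0 < c) :
    Tendsto (fun s : ℝ => s ^ (-b) * Real.exp (-(c / s))) (𝓝[>] 0) (𝓝 0) := by
  have h := (tendsto_rpow_mul_exp_neg_mul_atTop_nhds_zero b c hc).comp tendsto_inv_nhdsGT_zero
  refine h.congr' ?_
  filter_upwards [self_mem_nhdsWithin] with s hs
  have hs : (0 : ℝ) < s := hs
  simp only [Function.comp]
  rw [Real.inv_rpow hs.le, Real.rpow_neg hs.le, neg_mul, div_eq_mul_inv]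

theorem tendsto_rpow_mul_exp_neg_div_atTop {b c : ℝ} (hb : 0 < b) :
    Tendsto (fun s : ℝ => s ^ (-b) * Real.exp (-(c / s))) atTop (𝓝 0) := by
  have h2 : Tendsto (fun s : ℝ => Real.exp (-(c / s))) atTop (𝓝 (Real.exp (-0))) :=
    (Real.continuous_exp.tendsto _).comp ((tendsto_const_nhds.div_atTop tendsto_id).neg)
  have := (tendsto_rpow_neg_atTop hb).mul h2
  rwa [zero_mul] at this

theorem hasDerivAt_rpow_mul_exp_neg_div {b c s : ℝ} (hs : 0 < s) :
    HasDerivAt (fun s : ℝ => s ^ (-b) * Real.exp (-(c / s)))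
      (-b * (s ^ (-b - 1) * Real.exp (-(c / s))) + c * (s ^ (-b - 2) * Real.exp (-(c / s)))) s := by
  have h1 : HasDerivAt (fun s : ℝ => s ^ (-b)) (-b * s ^ (-b - 1)) s :=
    Real.hasDerivAt_rpow_const (Or.inl hs.ne')
  have h2 : HasDerivAt (fun s : ℝ => Real.exp (-(c / s))) (Real.exp (-(c / s)) * (c / s ^ 2)) s :=
    by
    have h := (((hasDerivAt_inv hs.ne').const_mul c).neg).exp
    refine (h.congr_of_eventuallyEq (Eventually.of_forall fun r => ?_)).congr_deriv ?_
    · simp only [Pi.neg_apply, div_eq_mul_inv]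
    · simp only [Pi.neg_apply, div_eq_mul_inv]
      ring
  refine (h1.mul h2).congr_deriv ?_
  have e : s ^ (-b - 2) = s ^ (-b) / s ^ 2 := by
    rw [Real.rpow_sub hs, Real.rpow_two]
  rw [e]
  ring

namespace IsLaplaceFamily

variable {X : Type*} [NormedAddCommGroup X] [NormedSpace ℂ X]
  {A : X →ₗ.[ℂ] X} {R T T' : ℝ → X →L[ℂ] X} {K : ℝ}

theorem resolventApply_eq (h : IsLaplaceFamily A R T T' K) {μ : ℝ} (hμ : 0 < μ) (g : X) :
    resolventApply A μ g = R μ g := by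
  obtain ⟨x, hx1, hx2⟩ := h.right μ hμ g
  have hinj : Function.Injective fun x : A.domain => (μ : ℂ) • (x : X) - A x := by
    intro x y hxy
    have hxy : (μ : ℂ) • (x : X) - A x = (μ : ℂ) • (y : X) - A y := hxy
    refine Subtype.ext ?_
    rw [← h.left μ hμ x, ← h.left μ hμ y, hxy]
  rw [resolventApply, ← hx1, ← hx2]
  exact congrArg Subtype.val (Function.leftInverse_invFun hinj x)

/-- Euler's reflection formula cancels `sin(πσ)/π` against `Γ(σ) Γ(1 - σ)`; the sign comes from `-A
f` in the definition. -/
theorem fracPow_eq [CompleteSpace X] (h : IsLaplaceFamily A R T T' K) {σ : ℝ} (hσ0 : 0 < σ)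
    (hσ1 : σ < 1)
    (x : A.domain) : ∫ s in Set.Ioi (0 : ℝ), s ^ (-σ) • T s (A x) =
      (-Real.Gamma (1 - σ)) • fracPow A σ x := by
  have h1 : ∫ μ in Set.Ioi (0 : ℝ), ((μ ^ (σ - 1) : ℝ) : ℂ) • resolventApply A (μ : ℂ) (-(A x)) =
      -∫ μ in Set.Ioi (0 : ℝ), μ ^ (σ - 1) • R μ (A x) := by
    rw [← integral_neg]
    refine setIntegral_congr_fun measurableSet_Ioi fun μ hμ => ?_
    rw [h.resolventApply_eq hμ, map_neg, smul_neg, Complex.coe_smul]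
  have hs : Real.sin (Real.pi * σ) ≠ 0 :=
    (Real.sin_pos_of_pos_of_lt_pi (by positivity) (by nlinarith [Real.pi_pos])).ne'
  rw [fracPow, h1, h.integral_rpow_smul_resolvent hσ0 hσ1, Complex.coe_smul, smul_neg, smul_neg,
    smul_smul, smul_smul, neg_mul, neg_mul, neg_smul, neg_neg, mul_assoc]
  have h2 : Real.Gamma (1 - σ) * (Real.sin (Real.pi * σ) / Real.pi * Real.Gamma σ) = 1 := by
    have := Real.Gamma_mul_Gamma_one_sub σ
    calc _ = Real.sin (Real.pi * σ) / Real.pi * (Real.Gamma σ * Real.Gamma (1 - σ)) := by ring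
      _ = 1 := by
        rw [this]
        have := Real.pi_pos
        field_simp
  rw [h2, one_smul]

/-- Integration by parts: with `w(s) = s^(-b) e^(-c/s)`, `A ∫ w T f = ∫ w T' f = -∫ w' T f`, where
the boundary terms vanish at both ends. The identity is stated through `R 1`, so that only bounded
operators meet the integrals. -/
theorem resolvent_integral [CompleteSpace X] (h : IsLaplaceFamily A R T T' K) {b c : ℝ}
    (hb : 1 < b) (hc : 0 < c)
    (f : X) : R 1 ((∫ s in Set.Ioi (0 : ℝ), (s ^ (-b) * Real.exp (-(c / s))) • T s f) -
      (b • (∫ s in Set.Ioi (0 : ℝ), (s ^ (-b - 1) * Real.exp (-(c / s))) • T s f) -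
        c • ∫ s in Set.Ioi (0 : ℝ), (s ^ (-b - 2) * Real.exp (-(c / s))) • T s f)) =
      ∫ s in Set.Ioi (0 : ℝ), (s ^ (-b) * Real.exp (-(c / s))) • T s f := by
  have hw : ∀ d : ℝ, 0 < d →
      IntegrableOn (fun s : ℝ => s ^ (-d - 1) * Real.exp (-(c / s))) (Set.Ioi 0) :=
    fun d hd => integrableOn_rpow_mul_exp_neg_div hd hc
  have hw0 : IntegrableOn (fun s : ℝ => s ^ (-b) * Real.exp (-(c / s))) (Set.Ioi 0) := by
    have := hw (b - 1) (by linarith)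
    rwa [show -(b - 1) - 1 = -b by ring] at this
  have hw1 := hw b (by linarith)
  have hw2 : IntegrableOn (fun s : ℝ => s ^ (-b - 2) * Real.exp (-(c / s))) (Set.Ioi 0) := by
    have := hw (b + 1) (by linarith)
    rwa [show -(b + 1) - 1 = -b - 2 by ring] at this
  have hi0 := h.integrableOn_smul hw0 f
  have hi1 := h.integrableOn_smul hw1 f
  have hi2 := h.integrableOn_smul hw2 f
  have hr : ∀ w : ℝ → ℝ, IntegrableOn (fun s => w s • T s f) (Set.Ioi 0) →
      R 1 (∫ s in Set.Ioi (0 : ℝ), w s • T s f) = ∫ s in Set.Ioi (0 : ℝ), w s • R 1 (T s f) := by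
    intro w hw
    rw [← ContinuousLinearMap.integral_comp_comm _ hw]
    simp only [ContinuousLinearMap.map_smul_of_tower]
  have hri : ∀ w : ℝ → ℝ, IntegrableOn (fun s => w s • T s f) (Set.Ioi 0) →
      IntegrableOn (fun s => w s • R 1 (T s f)) (Set.Ioi 0) := by
    intro w hw
    have := (R 1).integrable_comp hw
    simp only [ContinuousLinearMap.map_smul_of_tower] at this
    exact this
  set w : ℝ → ℝ := fun s => s ^ (-b) * Real.exp (-(c / s)) with hwdef
  set w' : ℝ → ℝ := fun s => -b * (s ^ (-b - 1) * Real.exp (-(c / s))) +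
    c * (s ^ (-b - 2) * Real.exp (-(c / s))) with hw'def
  have hw'i : IntegrableOn w' (Set.Ioi 0) := (hw1.const_mul _).add (hw2.const_mul _)
  -- Since `R 1 (T' s f) = R 1 (T s f) - T s f`, the derivative contains no unbounded operator.
  have hd : ∀ s : ℝ, 0 < s → HasDerivAt (fun s => w s • R 1 (T s f))
      (w s • (R 1 (T s f) - T s f) + w' s • R 1 (T s f)) s := by
    intro s hs
    have h1 := (hasDerivAt_rpow_mul_exp_neg_div (b := b) (c := c) hs).smul
      (((R 1).restrictScalars ℝ).hasFDerivAt.comp_hasDerivAt s (h.hasDeriv s hs f))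
    refine h1.congr_deriv ?_
    have := h.resolvent_sub_deriv one_pos hs f
    rw [Complex.ofReal_one, one_smul, map_sub] at this
    have h2 : R 1 (T s f) - T s f = R 1 (T' s f) := by
      rw [sub_eq_iff_eq_add', ← sub_eq_iff_eq_add]; exact this
    rw [h2]
    rfl
  have hbound : ∀ s : ℝ, 0 < s → ‖w s • R 1 (T s f)‖ ≤ ‖w s‖ * (‖R 1‖ * (K * ‖f‖)) := by
    intro s hs
    rw [norm_smul]
    gcongr
    exact (R 1).le_opNorm_of_le (h.norm_apply_le hs f)
  have hlim : ∀ l : Filter ℝ, Tendsto w l (𝓝 0) → (∀ᶠ s in l, 0 < s) →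
      Tendsto (fun s => w s • R 1 (T s f)) l (𝓝 0) := by
    intro l hl hp
    refine squeeze_zero_norm' (a := fun s => ‖w s‖ * (‖R 1‖ * (K * ‖f‖))) ?_ ?_
    · filter_upwards [hp] with s hs using hbound s hs
    · have := hl.norm.mul_const (‖R 1‖ * (K * ‖f‖))
      rwa [norm_zero, zero_mul] at this
  have hI0 : IntegrableOn (fun s => w s • R 1 (T s f)) (Set.Ioi 0) := hri w hi0
  have hI1 : IntegrableOn (fun s => w' s • R 1 (T s f)) (Set.Ioi 0) :=
    hri w' (h.integrableOn_smul hw'i f)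
  have hI2 : IntegrableOn (fun s => w s • (R 1 (T s f) - T s f)) (Set.Ioi 0) := by
    simp only [smul_sub]
    exact hI0.sub hi0
  have hFTC := integral_Ioi_zero_of_hasDerivAt hd (hI2.add hI1)
    (hlim _ (tendsto_rpow_mul_exp_neg_div_zero hc) self_mem_nhdsWithin)
    (hlim _ (tendsto_rpow_mul_exp_neg_div_atTop (by linarith)) (eventually_gt_atTop 0))
  rw [integral_add hI2 hI1] at hFTC
  simp only [smul_sub (w _)] at hFTC
  rw [integral_sub hI0 hi0, ← hr w hi0, ← hr w' (h.integrableOn_smul hw'i f), sub_zero] at hFTC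
  have hw'T : ∫ s in Set.Ioi (0 : ℝ), w' s • T s f =
      -(b • (∫ s in Set.Ioi (0 : ℝ), (s ^ (-b - 1) * Real.exp (-(c / s))) • T s f) -
        c • ∫ s in Set.Ioi (0 : ℝ), (s ^ (-b - 2) * Real.exp (-(c / s))) • T s f) := by
    have hi1' : IntegrableOn (fun s => b • (s ^ (-b - 1) * Real.exp (-(c / s))) • T s f)
      (Set.Ioi 0) := hi1.smul b
    have hi2' : IntegrableOn (fun s => c • (s ^ (-b - 2) * Real.exp (-(c / s))) • T s f)
      (Set.Ioi 0) := hi2.smul c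
    rw [← integral_smul, ← integral_smul, ← integral_sub hi1' hi2', ← integral_neg]
    congr 1
    ext s
    simp only [hw'def, add_smul, mul_smul, neg_smul]
    abel
  rw [hw'T, map_neg] at hFTC
  rw [map_sub]
  rw [← sub_eq_zero, ← hFTC]
  abel

end IsLaplaceFamily

/-! ### Bounds in sectors and the solution operators. -/

section Family

variable {X : Type*} [NormedAddCommGroup X] [NormedSpace ℂ X] {B : ℝ → X →L[ℂ] X} {N : ℝ}

/-- The constant in the bound for `mainOp`. -/
def mainConst (N : ℝ) (n : ℕ) (a : ℝ) : ℝ :=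
  N * (weylConst n a * ∫ t in Set.Ioi (0 : ℝ), (1 + t ^ 2) ^ (-a))

theorem mainConst_nonneg (hN : 0 ≤ N) (n : ℕ) {a : ℝ} (ha : 0 < a) : 0 ≤ mainConst N n a :=
  mul_nonneg hN (mul_nonneg (weylConst_nonneg ha)
    (integral_nonneg fun t => Real.rpow_nonneg (by positivity) _))

theorem norm_mainOp_le_of_le (hB : IsBoundedFamily B N) (n : ℕ) {a : ℝ} (ha : 1 / 2 < a) {z : ℂ}
    (hz : 0 < z.re) {m : ℝ} (hm : 0 < m) (hmz : m ≤ z.re / ‖z‖) :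
    ‖mainOp B N n a z‖ ≤ mainConst N n a * m ^ (-(a + n)) * ‖z‖ ^ (1 - 2 * a) := by
  refine (norm_mainOp_le hB n ha hz).trans ?_
  have h0 := mainConst_nonneg hB.nonneg n (a := a) (by linarith)
  rw [mainConst] at h0 ⊢
  have h1 : (z.re / ‖z‖) ^ (-(a + n)) ≤ m ^ (-(a + n)) :=
    Real.rpow_le_rpow_of_nonpos hm hmz (by rw [neg_nonpos]; positivity)
  gcongr

theorem norm_mainOp_sqrt_le (hB : IsBoundedFamily B N) (n : ℕ) {a : ℝ} (ha : 1 / 2 < a) {z : ℂ}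
    (hz : 0 < z.re) {m r : ℝ} (hr : 0 < r) (hm : 0 < m) (hmz : m ≤ z.re / ‖z‖) :
    ‖mainOp B N n a ((√r : ℂ) * z)‖ ≤
      mainConst N n a * m ^ (-(a + n)) * (r ^ (1 / 2 - a) * ‖z‖ ^ (1 - 2 * a)) := by
  refine (norm_mainOp_le_of_le hB n ha (sqrt_mul_re_pos hz hr) hm ?_).trans (le_of_eq ?_)
  · rwa [sqrt_mul_re_div_norm z hr]
  · rw [norm_mul, Complex.norm_real, Real.norm_of_nonneg (Real.sqrt_nonneg r),
      Real.mul_rpow (Real.sqrt_nonneg r) (norm_nonneg z), Real.sqrt_eq_rpow, ← Real.rpow_mul hr.le]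
    congr 3
    ring

theorem integrableOn_rpow_Ioc {b : ℝ} (hb : -1 < b) :
    IntegrableOn (fun r : ℝ => r ^ b) (Set.Ioc 0 1) :=
  (intervalIntegrable_iff_integrableOn_Ioc_of_le zero_le_one).1
    (intervalIntegral.intervalIntegrable_rpow' hb)

theorem continuousOn_mainOp_sqrt (hB : IsBoundedFamily B N) (n : ℕ) {a : ℝ} (ha : 1 / 2 < a) {z : ℂ}
    (hz : 0 < z.re) (f : X) :
    ContinuousOn (fun r : ℝ => mainOp B N n a ((√r : ℂ) * z) f) (Set.Ioc 0 1) := by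
  intro r hr
  have h1 := (hasDerivAt_mainOp_apply hB n ha (sqrt_mul_re_pos hz hr.1) f).continuousAt
  have h2 : ContinuousAt (fun r : ℝ => (√r : ℂ) * z) r :=
    ((Complex.continuous_ofReal.comp Real.continuous_sqrt).mul continuous_const).continuousAt
  exact (ContinuousAt.comp (x := r) (f := fun r : ℝ => (√r : ℂ) * z)
    (g := fun w => mainOp B N n a w f) h1 h2).continuousWithinAt

/-- The exponent `3 - 2a` is positive. For `a = 3/2 - σ` it equals `2σ`, so the correction term
tends to `0` with `z` in each sector. -/
theorem norm_integral_mainOp_sqrt_le (hB : IsBoundedFamily B N) (n : ℕ) {a : ℝ} (ha : 1 / 2 < a)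
    (ha' : a < 3 / 2) {m : ℝ} (hm : 0 < m) {z : ℂ} (hz : 0 < z.re) (hmz : m ≤ z.re / ‖z‖) (f : X) :
    ‖∫ r in Set.Ioc (0 : ℝ) 1, z ^ 2 • mainOp B N n a ((√r : ℂ) * z) f‖ ≤
      (∫ r in Set.Ioc (0 : ℝ) 1, r ^ (1 / 2 - a)) * (mainConst N n a * m ^ (-(a + n)) * ‖f‖) *
        ‖z‖ ^ (3 - 2 * a) := by
  have hz0 : 0 < ‖z‖ := norm_pos_iff.2 (by rintro rfl; simp at hz)
  have hb := ((integrableOn_rpow_Ioc (b := 1 / 2 - a) (by linarith)).mul_const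
    (mainConst N n a * m ^ (-(a + n)) * ‖f‖)).mul_const (‖z‖ ^ (3 - 2 * a))
  refine (norm_integral_le_of_norm_le hb ?_).trans (le_of_eq ?_)
  · filter_upwards [ae_restrict_mem measurableSet_Ioc] with r hr
    rw [norm_smul, norm_pow]
    have h1 := (mainOp B N n a ((√r : ℂ) * z)).le_of_opNorm_le
      (norm_mainOp_sqrt_le hB n ha hz hr.1 hm hmz) f
    have e : ‖z‖ ^ (3 - 2 * a) = ‖z‖ ^ 2 * ‖z‖ ^ (1 - 2 * a) := by
      rw [← Real.rpow_natCast, ← Real.rpow_add hz0]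
      congr 1; push_cast; ring
    rw [e]
    calc _ ≤ ‖z‖ ^ 2 * (mainConst N n a * m ^ (-(a + n)) *
          (r ^ (1 / 2 - a) * ‖z‖ ^ (1 - 2 * a)) * ‖f‖) := by gcongr
      _ = _ := by ring
  · rw [integral_mul_const, integral_mul_const]

theorem differentiableOn_integral_mainOp_sqrt (hB : IsBoundedFamily B N) (n : ℕ) {a : ℝ}
    (ha : 1 / 2 < a) (ha' : a < 3 / 2) (f : X) :
    DifferentiableOn ℂ (fun z : ℂ => ∫ r in Set.Ioc (0 : ℝ) 1,
      z ^ 2 • mainOp B N n a ((√r : ℂ) * z) f) {z : ℂ | 0 < z.re} := by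
  intro z₀ hz₀
  have hz₀ : 0 < z₀.re := hz₀
  have hn0 : 0 < ‖z₀‖ := norm_pos_iff.2 (by rintro rfl; simp at hz₀)
  set S : Set ℂ := {z | z₀.re / 2 < z.re ∧ ‖z‖ < 2 * ‖z₀‖} with hS
  have hSo : S ∈ 𝓝 z₀ := by
    refine IsOpen.mem_nhds ((isOpen_lt continuous_const Complex.continuous_re).inter
      (isOpen_lt continuous_norm continuous_const)) ⟨?_, ?_⟩
    · exact half_lt_self hz₀
    · exact (lt_mul_iff_one_lt_left hn0).2 one_lt_two
  have hρ : 0 < z₀.re / 2 := by positivity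
  have hSre : ∀ z ∈ S, 0 < z.re := fun z hz => hρ.trans hz.1
  set m := z₀.re / 2 / (2 * ‖z₀‖) with hm
  have hm0 : 0 < m := by positivity
  have hmz : ∀ z ∈ S, m ≤ z.re / ‖z‖ := fun z hz => by
    have hzr := hSre z hz
    exact div_le_div₀ hzr.le hz.1.le (norm_pos_iff.2 (by rintro rfl; simp at hzr)) hz.2.le
  have hop : ∀ b : ℝ, 1 / 2 < b → ∀ z ∈ S, ∀ r : ℝ, 0 < r → ‖mainOp B N n b ((√r : ℂ) * z) f‖ ≤
      mainConst N n b * m ^ (-(b + n)) * (r ^ (1 / 2 - b) * (z₀.re / 2) ^ (1 - 2 * b)) * ‖f‖ := by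
    intro b hb z hz r hr
    refine (mainOp B N n b ((√r : ℂ) * z)).le_of_opNorm_le
      ((norm_mainOp_sqrt_le hB n hb (hSre z hz) hr hm0 (hmz z hz)).trans ?_) f
    have h0 := mainConst_nonneg hB.nonneg n (a := b) (by linarith)
    have h1 : ‖z‖ ^ (1 - 2 * b) ≤ (z₀.re / 2) ^ (1 - 2 * b) :=
      Real.rpow_le_rpow_of_nonpos hρ (hz.1.le.trans (Complex.re_le_norm z)) (by linarith)
    gcongr
  have hmeas : ∀ z ∈ S, AEStronglyMeasurable (fun r : ℝ => z ^ 2 • mainOp B N n a ((√r : ℂ) * z) f)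
      (volume.restrict (Set.Ioc 0 1)) := fun z hz =>
    (continuousOn_const.smul (continuousOn_mainOp_sqrt hB n ha (hSre z hz) f)).aestronglyMeasurable
      measurableSet_Ioc
  have hz₀S : z₀ ∈ S := mem_of_mem_nhds hSo
  refine (hasDerivAt_integral_of_dominated_loc_of_deriv_le (𝕜 := ℂ) (x₀ := z₀) (s := S)
    (μ := volume.restrict (Set.Ioc (0 : ℝ) 1))
    (F := fun z r => z ^ 2 • mainOp B N n a ((√r : ℂ) * z) f)
    (F' := fun z r => z ^ 2 • ((√r : ℂ) • (-2 * ((√r : ℂ) * z)) •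
      mainOp B N n (a + 1) ((√r : ℂ) * z) f) + (2 * z) • mainOp B N n a ((√r : ℂ) * z) f)
    (bound := fun r => ((2 * ‖z₀‖) ^ 2 * (2 * (2 * ‖z₀‖)) * (mainConst N n (a + 1) *
      m ^ (-(a + 1 + n)) * (z₀.re / 2) ^ (1 - 2 * (a + 1)) * ‖f‖) + 2 * (2 * ‖z₀‖) *
      (mainConst N n a * m ^ (-(a + n)) * (z₀.re / 2) ^ (1 - 2 * a) * ‖f‖)) * r ^ (1 / 2 - a))
    hSo ?_ ?_ ?_ ?_ ?_ ?_).2.differentiableAt.differentiableWithinAt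
  · filter_upwards [hSo] with z hz using hmeas z hz
  · refine Integrable.mono' ((integrableOn_rpow_Ioc (b := 1 / 2 - a) (by linarith)).const_mul
      (‖z₀‖ ^ 2 * (mainConst N n a * m ^ (-(a + n)) * (z₀.re / 2) ^ (1 - 2 * a) * ‖f‖)))
      (hmeas z₀ hz₀S) ?_
    filter_upwards [ae_restrict_mem measurableSet_Ioc] with r hr
    rw [norm_smul, norm_pow]
    calc _ ≤ ‖z₀‖ ^ 2 * (mainConst N n a * m ^ (-(a + n)) *
          (r ^ (1 / 2 - a) * (z₀.re / 2) ^ (1 - 2 * a)) * ‖f‖) := by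
          gcongr
          exact hop a ha z₀ hz₀S r hr.1
      _ = _ := by ring
  · refine ContinuousOn.aestronglyMeasurable ?_ measurableSet_Ioc
    have hs : ContinuousOn (fun r : ℝ => (√r : ℂ)) (Set.Ioc 0 1) :=
      (Complex.continuous_ofReal.comp Real.continuous_sqrt).continuousOn
    exact (continuousOn_const.smul (hs.smul ((continuousOn_const.mul
      (hs.mul continuousOn_const)).smul (continuousOn_mainOp_sqrt hB n (by linarith) hz₀ f)))).add
      (continuousOn_const.smul (continuousOn_mainOp_sqrt hB n ha hz₀ f))
  · filter_upwards [ae_restrict_mem measurableSet_Ioc] with r hr z hz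
    have h1 := hop (a + 1) (by linarith) z hz r hr.1
    have h2 := hop a ha z hz r hr.1
    have hz2 : ‖z‖ ≤ 2 * ‖z₀‖ := hz.2.le
    -- The operator with parameter `a + 1` is more singular in `r` by one power, but the chain rule
    -- supplies two factors `√r` that restore the integrable exponent.
    have e : r ^ (1 / 2 - a) = √r * √r * r ^ (1 / 2 - (a + 1)) := by
      rw [Real.mul_self_sqrt hr.1.le]
      nth_rewrite 2 [← Real.rpow_one r]
      rw [← Real.rpow_add hr.1]
      congr 1; ring
    have h0 := mainConst_nonneg hB.nonneg n (a := a) (by linarith)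
    have h0' := mainConst_nonneg hB.nonneg n (a := a + 1) (by linarith)
    have hr0 := hr.1
    refine (norm_add_le _ _).trans ?_
    rw [norm_smul, norm_smul, norm_smul, norm_smul, norm_mul, norm_mul, norm_mul, norm_pow,
      norm_neg, Complex.norm_ofNat, Complex.norm_real, Real.norm_of_nonneg (Real.sqrt_nonneg r)]
    calc _ ≤ (2 * ‖z₀‖) ^ 2 * (√r * (2 * (√r * (2 * ‖z₀‖)) * (mainConst N n (a + 1) *
          m ^ (-(a + 1 + n)) * (r ^ (1 / 2 - (a + 1)) * (z₀.re / 2) ^ (1 - 2 * (a + 1))) *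
          ‖f‖))) + 2 * (2 * ‖z₀‖) * (mainConst N n a * m ^ (-(a + n)) *
          (r ^ (1 / 2 - a) * (z₀.re / 2) ^ (1 - 2 * a)) * ‖f‖) := by gcongr
      _ = (2 * ‖z₀‖) ^ 2 * (2 * (2 * ‖z₀‖)) * (mainConst N n (a + 1) *
          m ^ (-(a + 1 + n)) * (z₀.re / 2) ^ (1 - 2 * (a + 1)) * ‖f‖) *
          (√r * √r * r ^ (1 / 2 - (a + 1))) + 2 * (2 * ‖z₀‖) *
          (mainConst N n a * m ^ (-(a + n)) * (z₀.re / 2) ^ (1 - 2 * a) * ‖f‖) *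
          r ^ (1 / 2 - a) := by ring
      _ = _ := by rw [← e]; ring
  · exact (integrableOn_rpow_Ioc (by linarith)).const_mul _
  · filter_upwards [ae_restrict_mem measurableSet_Ioc] with r hr z hz
    have h1 := hasDerivAt_mainOp_apply hB n ha (sqrt_mul_re_pos (hSre z hz) hr.1) f
    have h2 : HasDerivAt (fun z : ℂ => (√r : ℂ) * z) (√r : ℂ) z := by
      simpa using (hasDerivAt_id z).const_mul (√r : ℂ)
    have h3 : HasDerivAt (fun z : ℂ => z ^ 2) (2 * z) z := by simpa using hasDerivAt_pow 2 z
    exact h3.smul (h1.scomp z h2)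

/-- The solution operators of the extension problem. -/
def extensionOp (B : ℝ → X →L[ℂ] X) (N : ℝ) (n : ℕ) (σ : ℝ) (z : ℂ) : X →L[ℂ] X :=
  (((2 / (√Real.pi * Real.Gamma σ) : ℝ) : ℂ) * z ^ (2 * (σ : ℂ))) • mainOp B N n (σ + 1 / 2) z

theorem differentiableOn_extensionOp (hB : IsBoundedFamily B N) (n : ℕ) {σ : ℝ} (hσ : 0 < σ) :
    DifferentiableOn ℂ (extensionOp B N n σ) {z : ℂ | 0 < z.re} := by
  intro z hz
  have h1 := hasDerivAt_mainOp hB n (a := σ + 1 / 2) (by linarith) hz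
  have h2 : HasDerivAt (fun z : ℂ => z ^ (2 * (σ : ℂ)))
    (2 * (σ : ℂ) * z ^ (2 * (σ : ℂ) - 1) * 1) z :=
    (hasDerivAt_id z).cpow_const (Or.inl hz)
  exact ((h2.const_mul _).smul h1).differentiableAt.differentiableWithinAt

/-- For `a = σ + 1/2` the operator scales like `|z|^(-2σ)`, exactly balanced by `z^(2σ)`; the bound
depends on the aperture alone. -/
theorem norm_extensionOp_le (hB : IsBoundedFamily B N) (n : ℕ) {σ : ℝ} (hσ : 0 < σ) {m : ℝ}
    (hm : 0 < m) {z : ℂ} (hz : 0 < z.re) (hmz : m ≤ z.re / ‖z‖) : ‖extensionOp B N n σ z‖ ≤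
      2 / (√Real.pi * Real.Gamma σ) *
        (mainConst N n (σ + 1 / 2) * m ^ (-(σ + 1 / 2 + n))) := by
  have hz0 : 0 < ‖z‖ := norm_pos_iff.2 (by rintro rfl; simp at hz)
  have hg := Real.Gamma_pos_of_pos hσ
  have h1 := norm_mainOp_le_of_le hB n (a := σ + 1 / 2) (by linarith) hz hm hmz
  have e1 : ‖z ^ (2 * (σ : ℂ))‖ = ‖z‖ ^ (2 * σ) := by
    have : (2 * (σ : ℂ)) = ((2 * σ : ℝ) : ℂ) := by push_cast; rfl
    rw [this, Complex.norm_cpow_real]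
  have e2 : ‖z‖ ^ (2 * σ) * ‖z‖ ^ (1 - 2 * (σ + 1 / 2)) = 1 := by
    rw [← Real.rpow_add hz0, show 2 * σ + (1 - 2 * (σ + 1 / 2)) = 0 by ring, Real.rpow_zero]
  rw [extensionOp, norm_smul, norm_mul, Complex.norm_real, Real.norm_of_nonneg (by positivity), e1]
  calc _ ≤ 2 / (√Real.pi * Real.Gamma σ) * ‖z‖ ^ (2 * σ) * (mainConst N n (σ + 1 / 2) *
          m ^ (-(σ + 1 / 2 + n)) * ‖z‖ ^ (1 - 2 * (σ + 1 / 2))) := by gcongr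
    _ = 2 / (√Real.pi * Real.Gamma σ) * (mainConst N n (σ + 1 / 2) *
        m ^ (-(σ + 1 / 2 + n))) * (‖z‖ ^ (2 * σ) * ‖z‖ ^ (1 - 2 * (σ + 1 / 2))) := by ring
    _ = _ := by rw [e2, mul_one]

theorem hasDerivAt_cpow_smul_mainOp (hB : IsBoundedFamily B N) (n : ℕ) {a : ℝ} (ha : 1 / 2 < a)
    (b : ℂ) {z : ℂ} (hz : 0 < z.re) (f : X) :
    HasDerivAt (fun z : ℂ => z ^ b • mainOp B N n a z f)
      (b • z ^ (b - 1) • mainOp B N n a z f - (2 : ℂ) • z ^ (b + 1) • mainOp B N n (a + 1) z f)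
      z := by
  have hz0 : z ≠ 0 := by rintro rfl; simp at hz
  have h2 : HasDerivAt (fun z : ℂ => z ^ b) (b * z ^ (b - 1) * 1) z :=
    (hasDerivAt_id z).cpow_const (Or.inl hz)
  refine (h2.smul (hasDerivAt_mainOp_apply hB n ha hz f)).congr_deriv ?_
  rw [Complex.cpow_add _ _ hz0, Complex.cpow_one, mul_one]
  module

end Family

/-! ### The differential equation, the formula on the domain, and the boundary value. -/

section Solution

variable {X : Type*} [NormedAddCommGroup X] [NormedSpace ℂ X] [CompleteSpace X]
  {B : ℝ → X →L[ℂ] X} {N : ℝ} {A : X →ₗ.[ℂ] X} {R T' : ℝ → X →L[ℂ] X} {K : ℝ} {n : ℕ}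

theorem sqrt_pi_mul_rpow_succ (a : ℝ) : √Real.pi * (4 : ℝ) ^ (-(a + 1)) =
    √Real.pi * 4 ^ (-a) / 4 := by
  rw [neg_add, Real.rpow_add (by norm_num), Real.rpow_neg_one]
  ring

/-- The action of the generator on the operators `mainOp`. -/
theorem exists_domain_mainOp (hB : IsBoundedFamily B N)
    (h : IsLaplaceFamily A R (fun s => kernelOp B N (weylKernel n (heatTower s))) T' K)
    {a : ℝ} (ha : 1 / 2 < a) {z : ℂ} (hz : 0 < z.re) (f : X) :
    ∃ x : A.domain, (x : X) = mainOp B N n a z f ∧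
      A x = (4 * (a : ℂ) + 2) • mainOp B N n (a + 1) z f -
        (4 * z ^ 2) • mainOp B N n (a + 2) z f := by
  have hdiff : ∀ b : ℝ, 1 / 2 < b →
      DifferentiableOn ℂ (fun z => mainOp B N n b z f) {z : ℂ | 0 < z.re} := fun b hb z hz =>
    (hasDerivAt_mainOp_apply hB n hb hz f).differentiableAt.differentiableWithinAt
  set g : ℂ → X := fun z => mainOp B N n a z f - ((4 * (a : ℂ) + 2) • mainOp B N n (a + 1) z f -
    (4 * z ^ 2) • mainOp B N n (a + 2) z f) with hg
  have hgd : DifferentiableOn ℂ g {z : ℂ | 0 < z.re} := by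
    refine (hdiff a ha).sub (((hdiff (a + 1) (by linarith)).const_smul _).sub
      (DifferentiableOn.smul ?_ (hdiff (a + 2) (by linarith))))
    exact (Differentiable.const_mul (differentiable_pow 2) 4).differentiableOn
  have key : R 1 (g z) - mainOp B N n a z f = 0 := by
    refine eq_zero_of_eq_zero_on_pos (F := fun z => R 1 (g z) - mainOp B N n a z f)
      (((R 1).differentiable.comp_differentiableOn hgd).sub (hdiff a ha)) (fun y hy => ?_) hz
    -- For real `y` the operators with parameters `a`, `a + 1`, `a + 2` are subordination integrals
    -- with consecutive weights, and each step in `a` contributes a factor `1/4`. The coefficients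
    -- `4a + 2` and `4y²` are therefore `4 (a + 1/2)` and `16 (y²/4)`.
    have h1 := h.resolvent_integral (b := a + 1 / 2) (c := y ^ 2 / 4) (by linarith)
      (by positivity) f
    have e0 := mainOp_eq_integral hB n ha hy f
    have e1 := mainOp_eq_integral hB n (a := a + 1) (by linarith) hy f
    have e2 := mainOp_eq_integral hB n (a := a + 2) (by linarith) hy f
    rw [show -a - 1 / 2 = -(a + 1 / 2) by ring] at e0
    rw [show -(a + 1) - 1 / 2 = -(a + 1 / 2) - 1 by ring, sqrt_pi_mul_rpow_succ] at e1
    rw [show -(a + 2) - 1 / 2 = -(a + 1 / 2) - 2 by ring, show a + 2 = a + 1 + 1 by ring,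
      sqrt_pi_mul_rpow_succ, sqrt_pi_mul_rpow_succ, show a + 1 + 1 = a + 2 by ring] at e2
    have c1 : 4 * (a : ℂ) + 2 = ((4 * a + 2 : ℝ) : ℂ) := by push_cast; rfl
    have c2 : 4 * (y : ℂ) ^ 2 = ((4 * y ^ 2 : ℝ) : ℂ) := by push_cast; rfl
    simp only [hg]
    rw [sub_eq_zero, c1, c2, e0, e1, e2, Complex.coe_smul, Complex.coe_smul]
    set V := ∫ s in Set.Ioi (0 : ℝ), (s ^ (-(a + 1 / 2)) * Real.exp (-(y ^ 2 / 4 / s))) •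
      kernelOp B N (weylKernel n (heatTower s)) f
    set V1 := ∫ s in Set.Ioi (0 : ℝ), (s ^ (-(a + 1 / 2) - 1) * Real.exp (-(y ^ 2 / 4 / s))) •
      kernelOp B N (weylKernel n (heatTower s)) f
    set V2 := ∫ s in Set.Ioi (0 : ℝ), (s ^ (-(a + 1 / 2) - 2) * Real.exp (-(y ^ 2 / 4 / s))) •
      kernelOp B N (weylKernel n (heatTower s)) f
    have e3 : (√Real.pi * 4 ^ (-a)) • V - ((4 * a + 2) • (√Real.pi * 4 ^ (-a) / 4) • V1 -
        (4 * y ^ 2) • (√Real.pi * 4 ^ (-a) / 4 / 4) • V2) =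
        (√Real.pi * 4 ^ (-a)) • (V - ((a + 1 / 2) • V1 - (y ^ 2 / 4) • V2)) := by
      module
    rw [e3, ContinuousLinearMap.map_smul_of_tower, h1]
  obtain ⟨x, hx1, hx2⟩ := h.right 1 one_pos (g z)
  rw [sub_eq_zero] at key
  refine ⟨x, hx1.trans key, ?_⟩
  rw [Complex.ofReal_one, one_smul, hx1, key] at hx2
  have h3 : A x = mainOp B N n a z f - g z := by rw [← hx2]; abel
  rw [h3]
  exact sub_sub_cancel _ _

/-- With `u = k z^(2σ) U_(σ+1/2)` and `U_a' = -2z U_(a+1)`, the term in `U_(σ+1/2)` has coefficient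
`2σ(2σ-1) + (1-2σ)2σ = 0`. The other two have coefficients `-(4σ+4)` and `4z²` relative to `k
z^(2σ)`, which are those of `-A u`. -/
theorem extensionOp_equation (hB : IsBoundedFamily B N)
    (h : IsLaplaceFamily A R (fun s => kernelOp B N (weylKernel n (heatTower s))) T' K)
    {σ : ℝ} (hσ : 0 < σ) {z : ℂ} (hz : 0 < z.re) (f : X) :
    ∃ x : A.domain, (x : X) = extensionOp B N n σ z f ∧
      deriv (deriv fun z => extensionOp B N n σ z f) z +
        ((1 - 2 * (σ : ℂ)) / z) • deriv (fun z => extensionOp B N n σ z f) z = -(A x) := by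
  have hz0 : z ≠ 0 := by rintro rfl; simp at hz
  have ha : 1 / 2 < σ + 1 / 2 := by linarith
  set k : ℂ := ((2 / (√Real.pi * Real.Gamma σ) : ℝ) : ℂ) with hk
  set U : ℝ → ℂ → X := fun a z => mainOp B N n a z f with hU
  have hu : (fun z => extensionOp B N n σ z f) = fun z =>
      k • z ^ (2 * (σ : ℂ)) • U (σ + 1 / 2) z := by
    ext z
    rw [extensionOp, smul_apply, mul_smul]
  set u1 : ℂ → X := fun z => k • ((2 * (σ : ℂ)) • z ^ (2 * (σ : ℂ) - 1) • U (σ + 1 / 2) z -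
    (2 : ℂ) • z ^ (2 * (σ : ℂ) + 1) • U (σ + 1 / 2 + 1) z) with hu1
  have hd1 : ∀ w : ℂ, 0 < w.re → HasDerivAt (fun z => extensionOp B N n σ z f) (u1 w) w := by
    intro w hw
    rw [hu]
    exact (hasDerivAt_cpow_smul_mainOp hB n ha _ hw f).const_smul k
  have hd2 := (((hasDerivAt_cpow_smul_mainOp hB n ha (2 * (σ : ℂ) - 1) hz f).const_smul
    (2 * (σ : ℂ))).sub ((hasDerivAt_cpow_smul_mainOp hB n (a := σ + 1 / 2 + 1) (by linarith)
      (2 * (σ : ℂ) + 1) hz f).const_smul (2 : ℂ))).const_smul k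
  have hev : deriv (fun z => extensionOp B N n σ z f) =ᶠ[𝓝 z] u1 := by
    filter_upwards [(isOpen_lt continuous_const Complex.continuous_re).mem_nhds hz] with w hw
    exact (hd1 w hw).deriv
  obtain ⟨x, hx1, hx2⟩ := exists_domain_mainOp hB h ha hz f
  refine ⟨(k * z ^ (2 * (σ : ℂ))) • x, ?_, ?_⟩
  · rw [Submodule.coe_smul, hx1, extensionOp, smul_apply]
  · rw [hev.deriv_eq, (hd1 z hz).deriv]
    have hd2' : deriv u1 z = _ := hd2.deriv
    rw [hd2', A.map_smul, hx2, hu1]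
    have p0 : z ^ (2 * (σ : ℂ) - 1) = z ^ (2 * (σ : ℂ)) * z⁻¹ := by
      rw [Complex.cpow_sub _ _ hz0, Complex.cpow_one, div_eq_mul_inv]
    have p1 : z ^ (2 * (σ : ℂ) + 1) = z ^ (2 * (σ : ℂ)) * z := by
      rw [Complex.cpow_add _ _ hz0, Complex.cpow_one]
    have p2 : z ^ (2 * (σ : ℂ) - 1 - 1) = z ^ (2 * (σ : ℂ)) * (z⁻¹ * z⁻¹) := by
      rw [Complex.cpow_sub _ _ hz0, Complex.cpow_one, p0, div_eq_mul_inv, mul_assoc]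
    have p3 : z ^ (2 * (σ : ℂ) - 1 + 1) = z ^ (2 * (σ : ℂ)) := by
      rw [sub_add_cancel]
    have p4 : z ^ (2 * (σ : ℂ) + 1 - 1) = z ^ (2 * (σ : ℂ)) := by
      rw [add_sub_cancel_right]
    have p5 : z ^ (2 * (σ : ℂ) + 1 + 1) = z ^ (2 * (σ : ℂ)) * z ^ 2 := by
      rw [Complex.cpow_add _ _ hz0, Complex.cpow_one, p1, pow_two, mul_assoc]
    have e2 : σ + 1 / 2 + 1 + 1 = σ + 1 / 2 + 2 := by ring
    simp only [p0, p1, p2, p3, p4, p5, e2, hU]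
    generalize mainOp B N n (σ + 1 / 2) z f = U0
    generalize mainOp B N n (σ + 1 / 2 + 1) z f = U1
    generalize mainOp B N n (σ + 1 / 2 + 2) z f = U2
    generalize z ^ (2 * (σ : ℂ)) = q
    push_cast
    match_scalars
    · field_simp
      ring
    · field_simp
      ring
    · field_simp
      ring

/-- Subordination of `T(s)x = x + s ∫_0^1 T(rs)(A x) dr` separates `x` from an integral over `r`.
The convolution identity with `r y²/4` identifies each inner integral with `U_(3/2-σ)(√r y)` applied
to the fractional power of `x`. -/
theorem extensionOp_apply_domain_of_pos (hB : IsBoundedFamily B N)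
    (h : IsLaplaceFamily A R (fun s => kernelOp B N (weylKernel n (heatTower s))) T' K)
    {σ : ℝ} (hσ0 : 0 < σ) (hσ1 : σ < 1) {y : ℝ} (hy : 0 < y) (x : A.domain) :
    extensionOp B N n σ y x = x - ((2 / (4 ^ σ * √Real.pi * Real.Gamma σ) : ℝ) : ℂ) •
      ∫ r in Set.Ioc (0 : ℝ) 1, (y : ℂ) ^ 2 •
        mainOp B N n (3 / 2 - σ) ((√r : ℂ) * y) (fracPow A σ x) := by
  have hc : 0 < y ^ 2 / 4 := by positivity
  have hg := Real.Gamma_pos_of_pos hσ0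
  have hg1 : 0 < Real.Gamma (1 - σ) := Real.Gamma_pos_of_pos (by linarith)
  have hpi := Real.sqrt_pos.2 Real.pi_pos
  set c := y ^ 2 / 4 with hcdef
  have hyc : y ^ 2 = 4 * c := by rw [hcdef]; ring
  have h4 : (0 : ℝ) < 4 ^ σ := by positivity
  have e0 := mainOp_eq_integral hB n (a := σ + 1 / 2) (by linarith) hy (x : X)
  rw [show -(σ + 1 / 2) - 1 / 2 = -σ - 1 by ring, h.integral_subordination_eq hσ0 hσ1 x hc] at e0
  have hD : ∀ r ∈ Set.Ioc (0 : ℝ) 1, (y : ℂ) ^ 2 •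
      mainOp B N n (3 / 2 - σ) ((√r : ℂ) * y) (fracPow A σ x) =
      (-(4 * c * (√Real.pi * (4 ^ σ / 8)) * c ^ (σ - 1))) • r ^ (σ - 1) •
        ∫ p in Set.Ioi (0 : ℝ), (p ^ (-σ) * Real.exp (-(r * c / p))) •
          kernelOp B N (weylKernel n (heatTower p)) (A x) := by
    intro r hr
    have hrc : 0 < r * c := mul_pos hr.1 hc
    have h1 := h.integral_exp_smul_apply_integral hσ0 hσ1 x hrc
    rw [h.fracPow_eq hσ0 hσ1 x] at h1
    simp only [ContinuousLinearMap.map_smul_of_tower, smul_comm _ (-Real.Gamma (1 - σ))] at h1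
    rw [integral_smul, mul_smul, neg_smul, ← smul_neg] at h1
    have h2 := smul_right_injective X hg1.ne' h1
    have h3 : (((√r * y : ℝ)) : ℂ) = (√r : ℂ) * y := by push_cast; rfl
    have e1 := mainOp_eq_integral hB n (a := 3 / 2 - σ) (by linarith)
      (mul_pos (Real.sqrt_pos.2 hr.1) hy) (fracPow A σ x)
    have h4' : (√r * y) ^ 2 / 4 = r * c := by
      rw [mul_pow, Real.sq_sqrt hr.1.le, hcdef]; ring
    -- For `a = 3/2 - σ` the subordination weight is `s^(σ-2)`, the one on the left of the
    -- convolution identity.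
    rw [show -(3 / 2 - σ) - 1 / 2 = σ - 2 by ring, h3, h4', ← neg_eq_iff_eq_neg.2 h2.symm] at e1
    have h5 : (4 : ℝ) ^ (-(3 / 2 - σ)) = 4 ^ σ / 8 := by
      rw [neg_sub, Real.rpow_sub (by norm_num)]
      congr 1
      rw [show (4 : ℝ) = 2 ^ (2 : ℝ) by norm_num, ← Real.rpow_mul (by norm_num)]
      norm_num
    rw [e1, h5, ← Complex.ofReal_pow, Complex.coe_smul, hyc, Real.mul_rpow hr.1.le hc.le]
    module
  rw [setIntegral_congr_fun measurableSet_Ioc hD, integral_smul, extensionOp, smul_apply, e0]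
  generalize (∫ r in Set.Ioc (0 : ℝ) 1, r ^ (σ - 1) • ∫ p in Set.Ioi (0 : ℝ),
    (p ^ (-σ) * Real.exp (-(r * c / p))) • kernelOp B N (weylKernel n (heatTower p)) (A x)) = J
  have e1 : (y : ℂ) ^ (2 * (σ : ℂ)) = ((c ^ σ * 4 ^ σ : ℝ) : ℂ) := by
    have : (y : ℂ) ^ (2 * (σ : ℂ)) = ((y ^ (2 * σ) : ℝ) : ℂ) := by
      rw [Complex.ofReal_cpow hy.le]; push_cast; rfl
    rw [this, ← Real.mul_rpow hc.le (by norm_num), mul_comm c, ← hyc, ← Real.rpow_natCast,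
      ← Real.rpow_mul hy.le]
    push_cast; rfl
  have e2 : (4 : ℝ) ^ (-(σ + 1 / 2)) = (4 ^ σ)⁻¹ / 2 := by
    rw [neg_add, Real.rpow_add (by norm_num), Real.rpow_neg (by norm_num), div_eq_mul_inv]
    congr 1
    rw [Real.rpow_neg (by norm_num), show (4 : ℝ) = 2 ^ (2 : ℝ) by norm_num,
      ← Real.rpow_mul (by norm_num)]
    norm_num
  rw [e1, e2, ← Complex.ofReal_mul, Complex.coe_smul, Complex.coe_smul, smul_smul, smul_smul,
    smul_add, smul_smul, Real.rpow_neg hc.le, Real.rpow_sub_one hc.ne']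
  have hcs : 0 < c ^ σ := by positivity
  have s1 : 2 / (√Real.pi * Real.Gamma σ) * (c ^ σ * 4 ^ σ) *
      (√Real.pi * ((4 ^ σ)⁻¹ / 2)) * (Real.Gamma σ * (c ^ σ)⁻¹) = 1 := by field_simp
  have s2 : 2 / (4 ^ σ * √Real.pi * Real.Gamma σ) *
      -(4 * c * (√Real.pi * (4 ^ σ / 8)) * (c ^ σ / c)) =
      -(2 / (√Real.pi * Real.Gamma σ) * (c ^ σ * 4 ^ σ) * (√Real.pi * ((4 ^ σ)⁻¹ / 2))) := by
    field_simp
    norm_num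
  rw [s1, s2, one_smul, neg_smul, sub_neg_eq_add]

theorem extensionOp_apply_domain (hB : IsBoundedFamily B N)
    (h : IsLaplaceFamily A R (fun s => kernelOp B N (weylKernel n (heatTower s))) T' K)
    {σ : ℝ} (hσ0 : 0 < σ) (hσ1 : σ < 1) {z : ℂ} (hz : 0 < z.re) (x : A.domain) :
    extensionOp B N n σ z x = x - ((2 / (4 ^ σ * √Real.pi * Real.Gamma σ) : ℝ) : ℂ) •
      ∫ r in Set.Ioc (0 : ℝ) 1, z ^ 2 •
        mainOp B N n (3 / 2 - σ) ((√r : ℂ) * z) (fracPow A σ x) := by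
  rw [← sub_eq_zero]
  have hd : DifferentiableOn ℂ (fun z => extensionOp B N n σ z x) {z : ℂ | 0 < z.re} :=
    (differentiableOn_extensionOp hB n hσ0).clm_apply (differentiableOn_const _)
  refine eq_zero_of_eq_zero_on_pos (F := fun z => extensionOp B N n σ z x - (x -
    ((2 / (4 ^ σ * √Real.pi * Real.Gamma σ) : ℝ) : ℂ) • ∫ r in Set.Ioc (0 : ℝ) 1, z ^ 2 •
        mainOp B N n (3 / 2 - σ) ((√r : ℂ) * z) (fracPow A σ x)))
    (hd.sub ((differentiableOn_const _).sub ((differentiableOn_integral_mainOp_sqrt hB n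
      (by linarith) (by linarith) _).const_smul _))) (fun y hy => ?_) hz
  exact sub_eq_zero.2 (extensionOp_apply_domain_of_pos hB h hσ0 hσ1 hy x)

/-- `Re z / |z| = cos (arg z)` exceeds `cos (π/2 - η) = sin η`. When `π/2 - η ≤ 0` the sector is the
positive ray, where the quotient is `1`. -/
theorem re_div_norm_of_mem_sector {η : ℝ} (hη : 0 < η) {z : ℂ} (hz : z ∈ sector (Real.pi / 2 - η)) :
    0 < z.re ∧ Real.sin η ≤ z.re / ‖z‖ := by
  unfold sector at hz
  split_ifs at hz with h0
  · have hz0 : 0 < ‖z‖ := norm_pos_iff.2 hz.1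
    have h1 : Real.sin η < z.re / ‖z‖ := by
      rw [← Complex.cos_arg hz.1, ← Real.cos_pi_div_two_sub, ← Real.cos_abs z.arg]
      exact Real.cos_lt_cos_of_nonneg_of_le_pi_div_two (abs_nonneg _) (by linarith) hz.2
    have h2 : 0 < Real.sin η := Real.sin_pos_of_pos_of_lt_pi hη (by linarith [Real.pi_pos])
    exact ⟨(div_pos_iff_of_pos_right hz0).1 (h2.trans h1), h1.le⟩
  · refine ⟨hz.1, ?_⟩
    have : z = (z.re : ℂ) := Complex.ext rfl (by simp [hz.2])
    have h1 : ‖z‖ = z.re := by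
      rw [this, Complex.norm_real, Complex.ofReal_re, Real.norm_of_nonneg hz.1.le]
    rw [h1, div_self hz.1.ne']
    exact Real.sin_le_one η

/-- The operators are uniformly bounded on the sector and converge on the dense domain, where the
correction term is `O(|z|^(2σ))`. -/
theorem tendsto_extensionOp (hB : IsBoundedFamily B N)
    (h : IsLaplaceFamily A R (fun s => kernelOp B N (weylKernel n (heatTower s))) T' K)
    (hA : Dense (A.domain : Set X)) {σ : ℝ} (hσ0 : 0 < σ) (hσ1 : σ < 1) (f : X) {η : ℝ}
    (hη : 0 < η) (hη' : η ≤ Real.pi / 2) :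
    Tendsto (fun z => extensionOp B N n σ z f) (𝓝[sector (Real.pi / 2 - η)] 0) (𝓝 f) := by
  have hm : 0 < Real.sin η := Real.sin_pos_of_pos_of_lt_pi hη (by linarith [Real.pi_pos])
  obtain ⟨M, hM⟩ : ∃ M : ℝ, ∀ z ∈ sector (Real.pi / 2 - η), ‖extensionOp B N n σ z‖ ≤ M :=
    ⟨_, fun z hz => norm_extensionOp_le hB n hσ0 hm (re_div_norm_of_mem_sector hη hz).1
      (re_div_norm_of_mem_sector hη hz).2⟩
  have hdom : ∀ x : A.domain, Tendsto (fun z => extensionOp B N n σ z x)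
      (𝓝[sector (Real.pi / 2 - η)] 0) (𝓝 x) := by
    intro x
    obtain ⟨D, hD⟩ : ∃ D : ℝ, ∀ z ∈ sector (Real.pi / 2 - η), ‖∫ r in Set.Ioc (0 : ℝ) 1,
        z ^ 2 • mainOp B N n (3 / 2 - σ) ((√r : ℂ) * z) (fracPow A σ x)‖ ≤
        D * ‖z‖ ^ (3 - 2 * (3 / 2 - σ)) :=
      ⟨_, fun z hz => norm_integral_mainOp_sqrt_le hB n (by linarith) (by linarith) hm
        (re_div_norm_of_mem_sector hη hz).1 (re_div_norm_of_mem_sector hη hz).2 _⟩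
    have h0 : Tendsto (fun z : ℂ => D * ‖z‖ ^ (3 - 2 * (3 / 2 - σ)))
        (𝓝[sector (Real.pi / 2 - η)] 0) (𝓝 0) := by
      have hc : Continuous fun z : ℂ => D * ‖z‖ ^ (3 - 2 * (3 / 2 - σ)) :=
        continuous_const.mul (continuous_norm.rpow_const fun _ => Or.inr (by linarith))
      have := hc.tendsto 0
      rw [norm_zero, Real.zero_rpow (by linarith), mul_zero] at this
      exact this.mono_left nhdsWithin_le_nhds
    have h1 : Tendsto (fun z : ℂ => ∫ r in Set.Ioc (0 : ℝ) 1, z ^ 2 •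
        mainOp B N n (3 / 2 - σ) ((√r : ℂ) * z) (fracPow A σ x))
        (𝓝[sector (Real.pi / 2 - η)] 0) (𝓝 0) := by
      refine squeeze_zero_norm' ?_ h0
      filter_upwards [self_mem_nhdsWithin] with z hz using hD z hz
    have h2 := tendsto_const_nhds (x := (x : X)).sub (h1.const_smul
      ((2 / (4 ^ σ * √Real.pi * Real.Gamma σ) : ℝ) : ℂ))
    rw [smul_zero, sub_zero] at h2
    refine h2.congr' ?_
    filter_upwards [self_mem_nhdsWithin] with z hz
    exact (extensionOp_apply_domain hB h hσ0 hσ1 (re_div_norm_of_mem_sector hη hz).1 x).symm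
  have hM0 : 0 < |M| + 2 := by positivity
  rw [Metric.tendsto_nhds]
  intro ε hε
  obtain ⟨x, hx, hfx⟩ := hA.exists_dist_lt f (div_pos hε hM0)
  rw [dist_eq_norm, lt_div_iff₀ hM0] at hfx
  have hx1 := (Metric.tendsto_nhds.1 (hdom ⟨x, hx⟩)) (ε - ‖f - x‖ * (|M| + 1)) (by
    nlinarith [norm_nonneg (f - x), abs_nonneg M])
  filter_upwards [hx1, self_mem_nhdsWithin] with z hz hzs
  rw [dist_eq_norm] at hz ⊢
  have h1 : ‖extensionOp B N n σ z (f - x)‖ ≤ |M| * ‖f - x‖ :=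
    (extensionOp B N n σ z).le_of_opNorm_le ((hM z hzs).trans (le_abs_self M)) _
  calc ‖extensionOp B N n σ z f - f‖
      = ‖extensionOp B N n σ z (f - x) + (extensionOp B N n σ z x - x) - (f - x)‖ := by
        rw [map_sub]
        congr 1
        abel
    _ ≤ ‖extensionOp B N n σ z (f - x)‖ + ‖extensionOp B N n σ z x - x‖ + ‖f - x‖ :=
        (norm_sub_le _ _).trans (by gcongr; exact norm_add_le _ _)
    _ < |M| * ‖f - x‖ + (ε - ‖f - x‖ * (|M| + 1)) + ‖f - x‖ :=
        add_lt_add_left (add_lt_add_of_le_of_lt h1 hz) _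
    _ = ε := by ring

end Solution

/-- The functional equation of `Γ` at `1/2 - σ`, which must not be zero. At `σ = 1/2` the constant
has a pole while the difference kernel vanishes; the logarithm takes over there. -/
theorem gammaRatio_difference {σ : ℝ} (hσ1 : σ < 1) (hσ : σ ≠ 1 / 2) :
    kappaConst σ * ((σ - 1 / 2) / Real.Gamma (3 / 2 - σ)) =
      -(2 / (4 ^ σ * √Real.pi * Real.Gamma σ)) := by
  have h1 : (1 / 2 - σ) ≠ 0 := sub_ne_zero.2 (Ne.symm hσ)
  have h2 : Real.Gamma (3 / 2 - σ) = (1 / 2 - σ) * Real.Gamma (1 / 2 - σ) := by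
    rw [← Real.Gamma_add_one h1]; congr 1; ring
  have h3 : 0 < Real.Gamma (3 / 2 - σ) := Real.Gamma_pos_of_pos (by linarith)
  have h4 : Real.Gamma (1 / 2 - σ) ≠ 0 := by
    intro h; rw [h2, h, mul_zero] at h3; exact h3.false
  rw [kappaConst, h2, show σ - 1 / 2 = -(1 / 2 - σ) by ring]
  generalize Real.Gamma (1 / 2 - σ) = g at h4 ⊢
  generalize 1 / 2 - σ = e at h1 ⊢
  field_simp

end ExtensionProblem

end

/-! ### Assembly of the theorem. -/

open ExtensionProblem in
theorem theorem1p2 {X : Type*} [NormedAddCommGroup X] [NormedSpace ℂ X] [CompleteSpace X]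
    (α : ℝ) (hα : 0 ≤ α) (σ : ℝ) (hσ0 : 0 < σ) (hσ1 : σ < 1)
    (C : ℝ → X →L[ℂ] X) (A : X →ₗ.[ℂ] X) (hA : IsTemperedIntegratedCosine α C A) :
    ∃ u : ℂ → X →L[ℂ] X,
      DifferentiableOn ℂ u (sector (Real.pi / 2)) ∧
      (∀ f : X, IsExtensionSolution A σ (Real.pi / 2) f (fun z => u z f)) ∧
      (∀ f : X, ∀ z ∈ sector (Real.pi / 2),
        IntegrableOn (fun t : ℝ => weylDeriv α (poissonKernel σ z) t • C t f) (Set.Ioi 0) ∧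
        u z f = (dConst σ : ℂ) •
          ∫ t in Set.Ioi (0 : ℝ), weylDeriv α (poissonKernel σ z) t • C t f) ∧
      (σ ≠ 1 / 2 → ∀ f : A.domain, ∀ z ∈ sector (Real.pi / 2),
        IntegrableOn
          (fun t : ℝ => weylDeriv α (differenceKernel σ z) t • C t (fracPow A σ f))
          (Set.Ioi 0) ∧
        u z (f : X) = (f : X) + (kappaConst σ : ℂ) •
          ∫ t in Set.Ioi (0 : ℝ),
            weylDeriv α (differenceKernel σ z) t • C t (fracPow A σ f)) ∧
      (σ = 1 / 2 → ∀ f : A.domain, ∀ z ∈ sector (Real.pi / 2),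
        IntegrableOn
          (fun t : ℝ => weylDeriv α (logKernel z) t • C t (fracPow A (1 / 2) f))
          (Set.Ioi 0) ∧
        u z (f : X) = (f : X) + ((1 / Real.pi : ℝ) : ℂ) •
          ∫ t in Set.Ioi (0 : ℝ),
            weylDeriv α (logKernel z) t • C t (fracPow A (1 / 2) f)) := by
  obtain ⟨B, N, hB, hW, hL⟩ := hA.exists_boundedFamily hα
  set n := ⌊α⌋₊ + 1 with hn
  have hpos : ∀ l : ℝ, 0 < l → 0 < (l : ℂ).re := fun l hl => by simpa using hl
  obtain ⟨R, T', K, h⟩ := exists_isLaplaceFamily (A := A) hB (m := ⌊α⌋₊)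
    (fun l hl f => by
      obtain ⟨x, hx1, hx2⟩ := hA.right_inverse l (hpos l hl) f
      exact ⟨x, hx1.trans (hL l hl f), hx2⟩)
    (fun l hl x hx => hA.left_inverse l (hpos l hl) x hx)
  have hsec : ∀ z : ℂ, z ∈ sector (Real.pi / 2) ↔ 0 < z.re := fun z => mem_sector_pi_div_two
  have hset : sector (Real.pi / 2) = {z : ℂ | 0 < z.re} := Set.ext hsec
  -- Each of the three kernels is a constant multiple of a normalised tower, so the constant is
  -- pulled out once.
  have hWc : ∀ (F : ℕ → ℝ → ℂ) (a : ℝ) (φ : ℝ → ℂ) (c : ℂ), IsTower F a → 1 / 2 < a →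
      (∀ t : ℝ, 0 < t → φ t = c * F 0 (t ^ 2)) → ∀ f : X,
      IntegrableOn (fun t : ℝ => weylDeriv α φ t • C t f) (Set.Ioi 0) ∧
      ∫ t in Set.Ioi (0 : ℝ), weylDeriv α φ t • C t f = c • kernelOp B N (weylKernel n F) f := by
    intro F a φ c hF ha hφ f
    have h1 := hW (fun i x => c * F i x) a φ (hF.const_mul c) ha hφ f
    rwa [kernelOp_weylKernel_const_mul hB n hF c f] at h1
  have hdiff := differentiableOn_extensionOp hB n hσ0
  refine ⟨extensionOp B N n σ, hset ▸ hdiff, fun f => ⟨?_, fun z hz => ?_, fun η hη hη' => ?_⟩,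
    fun f z hz => ?_, fun hσ f z hz => ?_, fun hσ f z hz => ?_⟩
  · rw [hset]
    exact hdiff.clm_apply (differentiableOn_const _)
  · exact extensionOp_equation hB h hσ0 ((hsec z).1 hz) f
  · exact tendsto_extensionOp hB h hA.dense hσ0 hσ1 f hη hη'
  · rw [hsec] at hz
    obtain ⟨h1, h2⟩ := hWc _ (σ + 1 / 2) (poissonKernel σ z) _
      (isTower_mainTower (by linarith) hz) (by linarith) (fun t _ => poissonKernel_eq hσ0 z t) f
    refine ⟨h1, ?_⟩
    rw [h2, extensionOp, smul_apply, smul_smul, mainOp]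
    congr 1
    have hg : ((Real.Gamma (σ + 1 / 2) : ℝ) : ℂ) ≠ 0 := by
      exact_mod_cast (Real.Gamma_pos_of_pos (by positivity)).ne'
    rw [dConst, mul_div_right_comm, Complex.ofReal_mul]
    generalize ((Real.Gamma (σ + 1 / 2) : ℝ) : ℂ) = g at hg ⊢
    field_simp
  · rw [hsec] at hz
    obtain ⟨h1, h2⟩ := hWc _ (3 / 2 - σ) (differenceKernel σ z) _
      (isTower_diffTower (by linarith) (by linarith) hz) (by linarith)
      (fun t ht => differenceKernel_eq hσ1 hz ht) (fracPow A σ f)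
    refine ⟨h1, ?_⟩
    rw [h2, extensionOp_apply_domain hB h hσ0 hσ1 hz f,
      kernelOp_diffTower hB n (by linarith) (by linarith) hz, smul_smul, ← Complex.ofReal_div,
      ← Complex.ofReal_mul, gammaRatio_difference hσ1 hσ, Complex.ofReal_neg, neg_smul,
      ← sub_eq_add_neg]
  · rw [hsec] at hz
    subst hσ
    obtain ⟨h1, h2⟩ := hWc _ 1 (logKernel z) _
      (isTower_diffTower (by norm_num) (by norm_num) hz) (by norm_num)
      (fun t ht => logKernel_eq hz ht) (fracPow A (1 / 2) f)
    refine ⟨h1, ?_⟩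
    -- At `σ = 1/2` one has `Γ(1/2) = √π`, so the general constant becomes `1/π`, and the parameter
    -- `3/2 - σ` becomes `1`, that of the logarithmic kernel.
    have e1 : 2 / ((4 : ℝ) ^ (1 / 2 : ℝ) * √Real.pi * Real.Gamma (1 / 2)) = 1 / Real.pi := by
      rw [Real.Gamma_one_half_eq, mul_assoc, Real.mul_self_sqrt Real.pi_pos.le,
        ← Real.sqrt_eq_rpow, show (4 : ℝ) = 2 ^ 2 by norm_num, Real.sqrt_sq (by norm_num)]
      field_simp
    rw [h2, extensionOp_apply_domain hB h hσ0 hσ1 hz f,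
      kernelOp_diffTower hB n (by norm_num) (by norm_num) hz, e1,
      show (3 / 2 - 1 / 2 : ℝ) = 1 by norm_num, neg_smul, one_smul, smul_neg, ← sub_eq_add_neg]
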